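/- **Notation.** Write $\mathcal L=\log N$, $D_0=\log\mathcal L/\log\log\mathcal L$, $P(z)=\prod_{p<z}p$; $\mu$, $\varphi$ are the Möbius and Euler functions, $\tau_j(q)$ is the number of ordered factorizations of $q$ into $j$ positive integers, $X(E;n)$ is the indicator function of $E$, $\mathbb P$ is the set of primes, and $D(S)=\max S-\min S$ for a finite nonempty set $S$ of integers. A finite set $\mathcal H$ of non-negative integers is admissible if for every prime $p$ some residue class mod $p$ contains no element of $\mathcal H$. For $k\ge 1$ let $\mathcal R_k=\{x\in[0,1]^k:\sum_i x_i\le 1\}$, and for a smooth function $F:\mathbb R^k\to\mathbb R$ supported on $\mathcal R_k$ put $$I_k(F)=\int_{[0,1]^k}F^2,\qquad J^{(m)}_k(F)=\int_{[0,1]^{k-1}}\Big(\int_0^1F(t_1,\dots,t_k)\,dt_m\Big)^2dt_1\cdots dt_{m-1}\,dt_{m+1}\cdots dt_k .$$ Let $M_k=\sup_F \sum_{m=1}^kJ_k^{(m)}(F)/I_k(F)$ over all such $F$ with $I_k(F)\ne0$ and $J_k^{(m)}(F)\neq0$ for every $m$, and let $k_0(t,b,\theta)$ be the least integer $k$ with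 $M_k>\frac{2t-2}{b\theta}$. **Theorem.** Fix integers $t\ge1$ and $1\le a\le s$, real numbers $\theta,\varepsilon,b>0$, an integer $k\ge k_0(t,b,\theta)$, positive constants $b_{g,m}$ $(1\le g\le s,\ 1\le m\le k)$ with $$b_{1,m}+\cdots+b_{a,m}-(b_{a+1,m}+\cdots+b_{s,m})\ge b\qquad(m=1,\dots,k),$$ an implied constant for the two estimates marked $\ll$ below, and a function of $N$ tending to $0$ as $N\to\infty$ which bounds in absolute value the quantities written $o(1)$. Then there is an $N_0$, depending only on these data, such that the following holds for every real $N\ge N_0$. Let $Y>0$, let $q_0,q_1\le N$ be positive integers with $(q_1,q_0P(D_0))=1$ and $\varphi(q_1)=q_1(1+o(1))$, let $(a_0,q_0)=1$, and let $\mathcal A\subset[N,2N)\cap\mathbb N$ satisfy $n\equiv a_0\pmod{q_0}$ for all $n\in\mathcal A$. Let $\mathcal H=\{h_1,\dots,h_k\}$ be an admissible set of $k$ distinct non-negative integers, all divisible by $q_0$, such that whenever a prime $p>D_0$ divides $h-h'$ for some distinct $h,h'\in\mathcal H$, then $p\mid q_0$. Suppose: (I) for any integers $a_q\equiv a_0\pmod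 {q_0}$, $$\sum_{\substack{q\le N^\theta\\(q,q_0q_1)=1}}\mu^2(q)\tau_{3k}(q)\Big|\sum_{n\equiv a_q\,(qq_0)}X(\mathcal A;n)-\frac{Y}{qq_0}\Big|\ll\frac{Y}{q_0\mathcal L^{k+\varepsilon}};$$ (II) there are nonnegative functions $\varrho_1,\dots,\varrho_s$ on $[N,2N)\cap\mathbb N$ with $$X(\mathbb P;n)\ge\varrho_1(n)+\cdots+\varrho_a(n)-(\varrho_{a+1}(n)+\cdots+\varrho_s(n)),$$ with $\varrho_g(n)=0$ unless $(n,P(N^{\theta/2}))=1$, and positive numbers $Y_{g,m}=Y(b_{g,m}+o(1))\mathcal L^{-1}$, such that for all $g\le s$, $m\le k$ and any integers $a_q\equiv a_0\pmod{q_0}$ with $(a_q,q)=1$, $$\sum_{\substack{q\le N^\theta\\(q,q_0q_1)=1}}\mu^2(q)\tau_{3k}(q)\Big|\sum_{n\equiv a_q\,(qq_0)}\varrho_g(n)X((\mathcal A+h_m)\cap\mathcal A;n)-\frac{Y_{g,m}}{\varphi(q_0q)}\Big|\ll\frac{Y}{\varphi(q_0)\mathcal L^{k+\varepsilon}}.$$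 Then there is a set $\mathcal S$ of $t$ primes, contained in $\mathcal A$, with $D(\mathcal S)\le D(\mathcal H)$. -/

import Mathlib

namespace PrimeGaps

open scoped ContDiff
open MeasureTheory

noncomputable section

/-! ### The variational quantity `M_k` and the threshold `k₀(t, b, θ)` -/

/-- The simplex `{x ∈ [0,1]^k : x₁ + ⋯ + x_k ≤ 1}`. -/
def simplex (k : ℕ) : Set (Fin k → ℝ) :=
  {x | (∀ i, x i ∈ Set.Icc (0 : ℝ) 1) ∧ ∑ i, x i ≤ 1}

/-- `I_k(F) = ∫_{[0,1]^k} F²`. -/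
def funI {k : ℕ} (F : (Fin k → ℝ) → ℝ) : ℝ :=
  ∫ x in Set.Icc (0 : Fin k → ℝ) 1, F x ^ 2

/-- `J_k^{(m)}(F)`: the integral over the `k - 1` coordinates other than the `m`-th, each in
`[0,1]`, of the square of `∫₀¹ F(t₁, …, t_k) dt_m`. -/
def funJ {k : ℕ} (m : Fin k) (F : (Fin k → ℝ) → ℝ) : ℝ :=
  ∫ x in Set.Icc (0 : {j : Fin k // j ≠ m} → ℝ) 1,
    (∫ u in (0 : ℝ)..1, F (fun j => if hj : j = m then u else x ⟨j, hj⟩)) ^ 2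

/-- The functions over which the supremum defining `M_k` is taken: smooth, supported on the
simplex, with `I_k(F) ≠ 0` and `J_k^{(m)}(F) ≠ 0` for each `m`. -/
structure IsTestFunction {k : ℕ} (F : (Fin k → ℝ) → ℝ) : Prop where
  smooth : ContDiff ℝ ∞ F
  supported : Function.support F ⊆ simplex k
  I_ne_zero : funI F ≠ 0
  J_ne_zero : ∀ m : Fin k, funJ m F ≠ 0

/-- `M_k = sup_F (∑_m J_k^{(m)}(F)) / I_k(F)`, as an extended real number. -/
def bigM (k : ℕ) : EReal :=
  ⨆ (F : (Fin k → ℝ) → ℝ) (_ : IsTestFunction F), (((∑ m, funJ m F) / funI F : ℝ) : EReal)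

/-- `k₀(t, b, θ)`: the least natural number `k` with `M_k > (2t - 2) / (bθ)`
(and `∞` if there were no such `k`). -/
def kZero (t : ℕ) (b θ : ℝ) : ℕ∞ :=
  ⨅ (k : ℕ) (_ : (((2 * (t : ℝ) - 2) / (b * θ) : ℝ) : EReal) < bigM k), (k : ℕ∞)

/-! ### Arithmetic notation -/

/-- `D₀ = log 𝓛 / log log 𝓛`, where `𝓛 = log N`. -/
def DZero (N : ℝ) : ℝ :=
  Real.log (Real.log N) / Real.log (Real.log (Real.log N))

/-- `P(z)`, the product of the primes `p < z`. -/
def primeProd (z : ℝ) : ℕ :=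
  ∏ p ∈ (Finset.range ⌈z⌉₊).filter Nat.Prime, p

/-- The `j`-fold divisor function: the number of ways to write `q` as an ordered product of `j`
positive integers. -/
def tau (j q : ℕ) : ℕ := (Nat.finMulAntidiag j q).card

/-- `D(S) = max S - min S` for a nonempty finite set `S`. -/
def diameter (S : Finset ℕ) : ℕ :=
  if hS : S.Nonempty then S.max' hS - S.min' hS else 0

/-- A finite set of integers is admissible if, for every prime `p`, it misses some residue class
modulo `p`. -/
def IsAdmissible (H : Finset ℕ) : Prop :=
  ∀ p : ℕ, p.Prime → ∃ a : ℤ, ∀ h ∈ H, ¬ (a ≡ (h : ℤ) [ZMOD (p : ℤ)])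

/-- The moduli `1 ≤ q ≤ N^θ` with `(q, q₀q₁) = 1`. -/
def moduli (N θ : ℝ) (q₀ q₁ : ℕ) : Finset ℕ :=
  (Finset.Icc 1 ⌊N ^ θ⌋₊).filter (fun q => q.Coprime (q₀ * q₁))

/-! ### The hypotheses on `A` and `H`

`N` is the large parameter, `δ` bounds every quantity written `o(1)`, and `C` is an implied
constant. The tuple `H` is enumerated as `h : Fin k → ℕ`. -/

/-- The conditions on `A`, `Y`, `q₀`, `q₁`, `a₀` and the tuple `h` other than the two regularity
conditions. -/
structure Setting {k : ℕ} (N δ : ℝ) (A : Finset ℕ) (Y : ℝ) (q₀ q₁ a₀ : ℕ) (h : Fin k → ℕ) :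
    Prop where
  A_range : ∀ n ∈ A, N ≤ (n : ℝ) ∧ (n : ℝ) < 2 * N
  Y_pos : 0 < Y
  q₀_pos : 0 < q₀
  q₀_le : (q₀ : ℝ) ≤ N
  q₁_pos : 0 < q₁
  q₁_le : (q₁ : ℝ) ≤ N
  q₁_coprime : q₁.Coprime (q₀ * primeProd (DZero N))
  totient_q₁ : |(q₁.totient : ℝ) / (q₁ : ℝ) - 1| ≤ δ
  a₀_coprime : a₀.Coprime q₀
  A_residue : ∀ n ∈ A, n ≡ a₀ [MOD q₀]
  h_injective : Function.Injective h
  h_admissible : IsAdmissible (Finset.univ.image h)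
  h_dvd : ∀ m, q₀ ∣ h m
  h_diff : ∀ m m' : Fin k, m ≠ m' → ∀ p : ℕ, p.Prime → DZero N < (p : ℝ) →
    (p : ℤ) ∣ (h m : ℤ) - (h m' : ℤ) → p ∣ q₀

/-- Regularity condition (I). -/
def RegularityI (k : ℕ) (θ ε C N : ℝ) (A : Finset ℕ) (Y : ℝ) (q₀ q₁ a₀ : ℕ) : Prop :=
  ∀ r : ℕ → ℕ, (∀ q ∈ moduli N θ q₀ q₁, r q ≡ a₀ [MOD q₀]) →
    ∑ q ∈ moduli N θ q₀ q₁, (ArithmeticFunction.moebius q : ℝ) ^ 2 * (tau (3 * k) q : ℝ) *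
        |((A.filter (fun n => n ≡ r q [MOD q * q₀])).card : ℝ) - Y / ((q : ℝ) * (q₀ : ℝ))|
      ≤ C * (Y / ((q₀ : ℝ) * Real.log N ^ ((k : ℝ) + ε)))

/-- Regularity condition (II), with the constants `b_{g,m}` given as `β g m`. The indices
`g = 1, …, s` are represented by `Fin s`, those with `g ≤ a` being the ones of value `< a`. -/
def RegularityII {k s : ℕ} (a : ℕ) (β : Fin s → Fin k → ℝ) (θ ε C N δ : ℝ) (A : Finset ℕ)
    (Y : ℝ) (q₀ q₁ a₀ : ℕ) (h : Fin k → ℕ) : Prop :=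
  ∃ (ϱ : Fin s → ℕ → ℝ) (Ygm : Fin s → Fin k → ℝ),
    -- the functions are nonnegative on `[N, 2N)` and give a minorant for the primes there
    (∀ g, ∀ n : ℕ, N ≤ (n : ℝ) → (n : ℝ) < 2 * N → 0 ≤ ϱ g n) ∧
    (∀ n : ℕ, N ≤ (n : ℝ) → (n : ℝ) < 2 * N →
      (∑ g with g.val < a, ϱ g n) - (∑ g with ¬ g.val < a, ϱ g n)
        ≤ if n.Prime then (1 : ℝ) else 0) ∧
    -- `Y_{g,m} = Y (b_{g,m} + o(1)) / log N` is positive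
    (∀ g m, 0 < Ygm g m) ∧
    (∀ g m, ∃ e : ℝ, |e| ≤ δ ∧ Ygm g m = Y * (β g m + e) / Real.log N) ∧
    -- distribution of `ϱ_g` on `(A + h_m) ∩ A` in reduced residue classes
    (∀ m g, ∀ r : ℕ → ℕ,
      (∀ q ∈ moduli N θ q₀ q₁, r q ≡ a₀ [MOD q₀] ∧ (r q).Coprime q) →
      ∑ q ∈ moduli N θ q₀ q₁, (ArithmeticFunction.moebius q : ℝ) ^ 2 * (tau (3 * k) q : ℝ) *
          |(∑ n ∈ ((A.image (fun x => x + h m)) ∩ A).filter (fun n => n ≡ r q [MOD q * q₀]),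
              ϱ g n) - Ygm g m / ((q₀ * q).totient : ℝ)|
        ≤ C * (Y / ((q₀.totient : ℝ) * Real.log N ^ ((k : ℝ) + ε)))) ∧
    -- `ϱ_g` is supported on integers without prime factors `< N^{θ/2}`
    (∀ g, ∀ n : ℕ, N ≤ (n : ℝ) → (n : ℝ) < 2 * N →
      ¬ n.Coprime (primeProd (N ^ (θ / 2))) → ϱ g n = 0)

end

end PrimeGaps

/-! ### Linear algebra of the sieve forms, one prime at a time -/

namespace PrimeGaps

open Finset

noncomputable section

/-! The proof is the Maynard–Tao sieve, arranged so that each main sum needs only a one-sided bound.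
Let `W` be the product of the primes up to `DZero N` not dividing `q₀ * q₁`; admissibility supplies
a class `ν` mod `W` with every `ν + h i` prime to `W`. Give `n ≡ ν` the weight `w(n) = (∑ λ_d)²`,
over tuples `d` with `d_i ∣ n + h i`. If every translate `n + H` held at most `t - 1` primes of `A`,
the minorant would give `∑_m ∑_n (∑ ± ϱ_g)(n + h m) w(n) ≤ (t - 1) ∑_n w(n)`, with `n + h m ∈ A` on
the left (`sum_minorant_le`). Conditions (I) and (II) turn both sides into quadratic forms in `λ`.
Their leading constants are `(t - 1) M I` against `b θ' ∑_m J_m`, where `I`, `J_m` are discrete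
versions of the integrals on a grid of mesh `1 / M` and `R = N ^ θ'` bounds the products of the
`d_i`. The condition on `M_k`, with `θ'` close to `θ / 2`, makes the second larger, a contradiction
(`Frame.exists_many_primes`).

A tuple `d` is a colouring of primes: a prime has colour `i` if it divides `d_i`. The forms then
have kernels that are products over primes, and each local kernel is a Gram matrix, so a form is a
weighted sum of squares. For the upper bound (`sieveForm_le`) one extra outcome with nonnegative
weight is adjoined at each prime, which makes the vectors orthogonal. For the lower bound
(`le_sieveForm_avoid`) some of the squares are discarded. The remaining squares expand into
nonnegative terms, because the signs in `yCoeff` cancel those of the basis change and the step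
function is nonnegative; so one may keep only squarefree, pairwise coprime tuples, at a loss
controlled by `badness` (`le_stepForm_avoid`).

A smooth test function is replaced by a step function on a grid (`exists_grid_function`), read on a
logarithmic scale. The only analytic input is then `siftedSum_asymptotic`: `∑ 1 / n` over `n < x`
prime to `q₀ q₁ W`, uniformly in these numbers. Inclusion–exclusion loses `2 ^ ω`, harmless because
a number of size `N ^ 3` has `o(log N)` prime factors.

In the error terms a modulus arises from at most `(3 k) ^ ω` pairs `(d, e)`, which explains
`τ_{3k}`, and the worst residue class is used for each modulus (`abs_sum_sieveSq_sub_le`). The power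
`k + ε` of the logarithm exactly absorbs the size of the squared weights and of `W`
(`Scale.error_le`). In (II) one may impose `d_m = 1`, since `ϱ_g` vanishes on multiples of the
sieving primes; this is also what makes the residue classes reduced. -/

theorem sum_le_sum_of_injection {α γ : Type*} {s : Finset α} {t : Finset γ} {f : α → ℝ}
    {g : γ → ℝ} (e : α → γ) (he : ∀ x ∈ s, e x ∈ t)
    (hinj : ∀ x ∈ s, ∀ y ∈ s, e x = e y → x = y)
    (hfg : ∀ x ∈ s, f x ≤ g (e x)) (hg : ∀ y ∈ t, 0 ≤ g y) :
    ∑ x ∈ s, f x ≤ ∑ y ∈ t, g y := by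
  classical
  calc ∑ x ∈ s, f x ≤ ∑ x ∈ s, g (e x) := sum_le_sum hfg
    _ = ∑ y ∈ s.image e, g y := (sum_image fun x hx y hy => hinj x hx y hy).symm
    _ ≤ ∑ y ∈ t, g y := by
      refine sum_le_sum_of_subset_of_nonneg ?_ fun y hy _ => hg y hy
      intro y hy
      obtain ⟨x, hx, rfl⟩ := mem_image.1 hy
      exact he x hx

/-- A quadratic form with a product kernel whose factors are Gram matrices is a weighted sum of
squares. -/
theorem sum_sum_prod_eq_sum_sq {ι Ω D : Type*} [Fintype ι] [DecidableEq ι] [Fintype Ω] [Fintype D]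
    (l : (ι → D) → ℝ) (w : ι → Ω → ℝ) (v : ι → D → Ω → ℝ) :
    ∑ d, ∑ e, l d * l e * ∏ p, ∑ o, w p o * v p (d p) o * v p (e p) o
      = ∑ o : ι → Ω, (∏ p, w p (o p)) * (∑ d, l d * ∏ p, v p (d p) (o p)) ^ 2 := by
  have h : ∀ d e : ι → D, ∏ p, ∑ o, w p o * v p (d p) o * v p (e p) o
      = ∑ o : ι → Ω, (∏ p, w p (o p)) * (∏ p, v p (d p) (o p)) * ∏ p, v p (e p) (o p) := by
    intro d e
    rw [prod_univ_sum, Fintype.piFinset_univ]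
    exact sum_congr rfl fun o _ => by rw [prod_mul_distrib, prod_mul_distrib]
  simp_rw [h, mul_sum]
  rw [sum_congr rfl fun d _ => sum_comm, sum_comm]
  refine sum_congr rfl fun o _ => ?_
  rw [pow_two, sum_mul_sum, mul_sum]
  refine sum_congr rfl fun d _ => ?_
  rw [mul_sum]
  exact sum_congr rfl fun e _ => by ring

/-- Restricting the outcomes of a weighted sum of squares to the range of an injection. -/
theorem sum_sq_comp_le {ι Ω Ω' : Type*} [Fintype ι] [DecidableEq ι] [Fintype Ω] [Fintype Ω']
    (j : Ω' → Ω) (hj : Function.Injective j)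
    (w : ι → Ω → ℝ) (hw : ∀ p o, 0 ≤ w p o) (S : (ι → Ω) → ℝ) :
    ∑ o : ι → Ω', (∏ p, w p (j (o p))) * S (fun p => j (o p)) ^ 2
      ≤ ∑ o : ι → Ω, (∏ p, w p (o p)) * S o ^ 2 := by
  refine sum_le_sum_of_injection (fun o p => j (o p)) (fun _ _ => mem_univ _) ?_
    (fun _ _ => le_rfl) fun o _ => mul_nonneg (prod_nonneg fun p _ => hw p _) (sq_nonneg _)
  intro o _ o' _ h
  funext p
  exact hj (congrFun h p)

/-- Expanding a function given in product coordinates. -/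
theorem sum_change_basis {ι D : Type*} [Fintype ι] [DecidableEq ι] [Fintype D]
    (y : (ι → D) → ℝ) (A : ι → D → D → ℝ) (v : ι → D → ℝ) :
    ∑ d : ι → D, (∑ r, y r * ∏ p, A p (r p) (d p)) * ∏ p, v p (d p)
      = ∑ r, y r * ∏ p, ∑ d, A p (r p) d * v p d := by
  simp_rw [prod_univ_sum, Fintype.piFinset_univ, sum_mul, mul_sum]
  rw [sum_comm]
  exact sum_congr rfl fun r _ => sum_congr rfl fun d _ => by rw [prod_mul_distrib]; ring

section Kernel

variable {κ : Type*} [DecidableEq κ]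

/-- The kernel of the sieve form at one prime: `q` is the density of a residue class. -/
def kern (q : ℝ) : Option κ → Option κ → ℝ
  | none, none => 1
  | none, some _ => q
  | some _, none => q
  | some i, some j => if i = j then q else 0

/-- The one-prime change of basis. -/
def basisCoeff (q : ℝ) : Option κ → Option κ → ℝ
  | none, none => 1
  | none, some _ => 0
  | some _, none => -q
  | some i, some j => if i = j then 1 else 0

/-- The weight `q` at a coloured prime. -/
def colWeight (q : ℝ) : Option κ → ℝ
  | none => 1
  | some _ => q

/-- The indicator that the outcome `o` is divisible by `d`. -/
def divInd : Option κ → Option κ → ℝ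
  | none, _ => 1
  | some _, none => 0
  | some i, some j => if i = j then 1 else 0

/-- Outcome `some i` stands for the prime dividing `n + h i`, each of density `q`, and `none` for it
dividing no `n + h i`. The kernel is the density of the outcomes at which both divisibility
conditions hold. -/
theorem kern_eq_sum [Fintype κ] (q : ℝ) (d e : Option κ) :
    kern q d e = ∑ o : Option κ,
      (match o with
        | none => 1 - Fintype.card κ * q
        | some _ => q) * divInd d o * divInd e o := by
  rw [Fintype.sum_option]
  cases d <;> cases e <;> simp [kern, divInd]

/-- The extended outcome space dominating the sieve form: vectors. -/
def extVec (x : ℝ) : Option κ → Option (Option κ) → ℝ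
  | none, _ => 1
  | some _, none => (x - 2) / (x - 1)
  | some _, some none => -(1 / (x - 1))
  | some i, some (some j) => (if i = j then 1 else 0) - 1 / (x - 1)

/-- The extended outcome space dominating the sieve form: weights. -/
def extWeight [Fintype κ] (x : ℝ) : Option (Option κ) → ℝ
  | none => 1 / (x * (x - 2))
  | some none => 1 - Fintype.card κ * (1 / x)
  | some (some _) => 1 / x

theorem sum_basisCoeff_mul_divInd [Fintype κ] (x : ℝ) (r o : Option κ) :
    ∑ d, basisCoeff (1 / (x - 1)) r d * divInd d o = extVec x r (some o) := by
  rw [Fintype.sum_option]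
  cases r <;> cases o <;> simp [basisCoeff, divInd, extVec]
  ring

/-- On the genuine outcomes the vectors are not orthogonal, because the density is `1 / x` while the
basis change uses `1 / (x - 1)`. The defect off the diagonal has rank one and negative sign, and the
extra outcome, of positive weight, cancels it. -/
theorem sum_extWeight [Fintype κ] {x : ℝ} (hx : 2 < x) (c c' : Option κ) :
    ∑ o, extWeight x o * extVec x c o * extVec x c' o
      = if c = c' then (match c with
          | none => 1 + 1 / (x * (x - 2))
          | some _ => 1 / x) else 0 := by
  have h0 : x ≠ 0 := by linarith
  have h1 : x - 1 ≠ 0 := by linarith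
  have h2 : x - 2 ≠ 0 := by linarith
  rw [Fintype.sum_option, Fintype.sum_option]
  cases c with
  | none =>
    cases c' with
    | none => simp [extWeight, extVec]; ring
    | some j => simp [extWeight, extVec, mul_sub, sum_sub_distrib]; field_simp; ring
  | some i =>
    cases c' with
    | none => simp [extWeight, extVec, mul_sub, sum_sub_distrib]; field_simp; ring
    | some j =>
      simp only [extWeight, extVec, mul_sub, sub_mul, sum_sub_distrib, mul_ite, ite_mul, mul_one,
        mul_zero, zero_mul, sum_ite_eq, mem_univ, if_true, sum_const, card_univ, nsmul_eq_mul,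
        Option.some.injEq]
      by_cases hij : i = j
      · subst hij
        simp
        field_simp
        ring
      · simp [hij]
        field_simp
        ring

/-- The vectors in the sum of squares decomposition of the kernel with density `q`. -/
def lowVec (q : ℝ) : Option κ → Option κ ⊕ (κ × κ) → ℝ
  | none, Sum.inl none => 1
  | none, Sum.inl (some _) => 0
  | none, Sum.inr _ => 0
  | some _, Sum.inl none => q
  | some i, Sum.inl (some j) => if i = j then 1 else 0
  | some l, Sum.inr ij => (if l = ij.1 then 1 else 0) - (if l = ij.2 then 1 else 0)

/-- The weights in the sum of squares decomposition of the kernel with density `q`. -/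
def lowWeight [Fintype κ] (q : ℝ) : Option κ ⊕ (κ × κ) → ℝ
  | Sum.inl none => 1
  | Sum.inl (some _) => q * (1 - Fintype.card κ * q)
  | Sum.inr _ => q ^ 2 / 2

/-- After splitting off the `none` vector, the colour block is `q` on the diagonal minus `q ^ 2`
times the all-ones matrix. The squares of colour differences account for the off-diagonal part,
leaving diagonal weights `q * (1 - card κ * q)`. -/
theorem kern_eq_sum_lowWeight [Fintype κ] (q : ℝ) (d e : Option κ) :
    kern q d e = ∑ o, lowWeight q o * lowVec q d o * lowVec q e o := by
  rw [Fintype.sum_sum_type, Fintype.sum_option, Fintype.sum_prod_type]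
  cases d with
  | none => cases e <;> simp [kern, lowWeight, lowVec]
  | some i =>
    cases e with
    | none => simp [kern, lowWeight, lowVec]
    | some j =>
      simp only [kern, lowWeight, lowVec, mul_sub, sum_sub_distrib, mul_ite, mul_one, mul_zero,
        sum_ite_eq, mem_univ, if_true, sum_const, card_univ, nsmul_eq_mul]
      by_cases hij : i = j
      · subst hij
        simp
        ring
      · simp [hij]
        ring

/-- The coefficients of the diagonalised form without colour `m`. -/
def crossCoeff (m : κ) (q : ℝ) : Option κ → Option κ → ℝ
  | none, none => 1
  | none, some _ => 0
  | some i, none => if i = m then -q else 0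
  | some i, some j => if i = j ∧ i ≠ m then 1 else 0

/-- Here the density and the basis coefficient agree, so for a colour other than `m` the terms `-q`
and `q` cancel. Only the forbidden colour keeps its `-q`; this becomes the summation over the `m`-th
coordinate. -/
theorem sum_basisCoeff_mul_lowVec [Fintype κ] (m : κ) (q : ℝ) (r c : Option κ) :
    ∑ d, basisCoeff q r d * ((if d = some m then 0 else 1) * lowVec q d (Sum.inl c))
      = crossCoeff m q r c := by
  rw [Fintype.sum_option]
  cases r with
  | none => cases c <;> simp [basisCoeff, lowVec, crossCoeff]
  | some i =>
    cases c with
    | none =>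
      rw [sum_eq_single i]
      · by_cases h : i = m <;> simp [basisCoeff, lowVec, crossCoeff, h]
      · intro j _ hj
        simp [basisCoeff, Ne.symm hj]
      · simp
    | some j =>
      simp [basisCoeff, lowVec, crossCoeff]
      split_ifs <;> simp_all

end Kernel

section Forms

variable {ι κ : Type*} [Fintype ι] [DecidableEq ι] [Fintype κ] [DecidableEq κ]

/-- The sieve weights attached to `y`. -/
def sieveWeight (x : ι → ℝ) (y : (ι → Option κ) → ℝ) (d : ι → Option κ) : ℝ :=
  ∑ r, y r * ∏ p, basisCoeff (1 / (x p - 1)) (r p) (d p)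

/-- The form is a sum of squares over genuine outcomes. Allowing the extra outcome at each prime
only adds nonnegative terms, and on the larger space the form is diagonal in `y`. -/
theorem sieveForm_le (x : ι → ℝ) (hx : ∀ p, 2 < x p) (hxk : ∀ p, (Fintype.card κ : ℝ) ≤ x p)
    (y : (ι → Option κ) → ℝ) :
    ∑ d, ∑ e, sieveWeight x y d * sieveWeight x y e * ∏ p, kern (1 / x p) (d p) (e p)
      ≤ (∏ p, (1 + 1 / (x p * (x p - 2)))) *
        ∑ r, y r ^ 2 * ∏ p, colWeight (1 / x p) (r p) := by
  have hw : ∀ p (o : Option (Option κ)), 0 ≤ extWeight (x p) o := by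
    intro p o
    have := hx p
    have := hxk p
    rcases o with _ | _ | o
    · exact one_div_nonneg.2 (mul_nonneg (by linarith) (by linarith))
    · simp only [extWeight]
      rw [mul_one_div, sub_nonneg, div_le_one (by linarith)]
      exact hxk p
    · exact one_div_nonneg.2 (by linarith)
  have h1 : ∑ d, ∑ e, sieveWeight x y d * sieveWeight x y e * ∏ p, kern (1 / x p) (d p) (e p)
      = ∑ o : ι → Option κ, (∏ p, extWeight (x p) (some (o p))) *
        (∑ r, y r * ∏ p, extVec (x p) (r p) (some (o p))) ^ 2 := by
    simp_rw [kern_eq_sum]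
    rw [sum_sum_prod_eq_sum_sq (sieveWeight x y)
      (fun p o => (match o with
        | none => 1 - Fintype.card κ * (1 / x p)
        | some _ => 1 / x p)) (fun _ d o => divInd d o)]
    refine sum_congr rfl fun o _ => ?_
    congr 1
    · exact prod_congr rfl fun p _ => by cases o p <;> rfl
    · unfold sieveWeight
      rw [sum_change_basis y (fun p => basisCoeff (1 / (x p - 1))) (fun p d => divInd d (o p))]
      simp_rw [sum_basisCoeff_mul_divInd]
  rw [h1]
  refine (sum_sq_comp_le some (Option.some_injective _) (fun p => extWeight (x p)) hw
    (fun o => ∑ r, y r * ∏ p, extVec (x p) (r p) (o p))).trans ?_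
  rw [← sum_sum_prod_eq_sum_sq y (fun p => extWeight (x p)) (fun p => extVec (x p)), mul_sum]
  refine sum_le_sum fun r _ => ?_
  rw [sum_eq_single r]
  · have : ∀ p, ∑ o, extWeight (x p) o * extVec (x p) (r p) o * extVec (x p) (r p) o
        ≤ (1 + 1 / (x p * (x p - 2))) * colWeight (1 / x p) (r p) := by
      intro p
      have := hx p
      have h3 : 0 ≤ 1 / (x p * (x p - 2)) :=
        one_div_nonneg.2 (mul_nonneg (by linarith) (by linarith))
      have h4 : 0 ≤ 1 / x p := one_div_nonneg.2 (by linarith)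
      rw [sum_extWeight (hx p), if_pos rfl]
      cases r p with
      | none => simp [colWeight]
      | some i => simp only [colWeight]; nlinarith
    calc y r * y r * ∏ p, ∑ o, extWeight (x p) o * extVec (x p) (r p) o * extVec (x p) (r p) o
        ≤ y r * y r * ∏ p, ((1 + 1 / (x p * (x p - 2))) * colWeight (1 / x p) (r p)) := by
          refine mul_le_mul_of_nonneg_left (prod_le_prod (fun p _ => ?_) fun p _ => this p)
            (mul_self_nonneg _)
          exact sum_nonneg fun o _ => by
            rw [mul_assoc]; exact mul_nonneg (hw p o) (mul_self_nonneg _)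
      _ = _ := by rw [prod_mul_distrib]; ring
  · intro r' _ hr
    obtain ⟨p, hp⟩ : ∃ p, r p ≠ r' p := by
      by_contra! h
      exact hr (funext fun p => (h p).symm)
    rw [prod_eq_zero (mem_univ p), mul_zero]
    rw [sum_extWeight (hx p), if_neg hp]
  · simp

/-- The restriction of a weight function to colourings avoiding the colour `m`. -/
def avoid (m : κ) (l : (ι → Option κ) → ℝ) (d : ι → Option κ) : ℝ :=
  l d * ∏ p, (if d p = some m then 0 else 1)

/-- All weights in the sum of squares are nonnegative, so every outcome with a `Sum.inr` component
may be dropped. -/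
theorem le_sieveForm_avoid (x : ι → ℝ) (hx : ∀ p, (Fintype.card κ : ℝ) + 1 ≤ x p)
    (hx1 : ∀ p, 1 < x p) (m : κ) (y : (ι → Option κ) → ℝ) :
    ∑ c : ι → Option κ, (∏ p, colWeight (1 / (x p - 1) * (1 - Fintype.card κ * (1 / (x p - 1))))
        (c p)) * (∑ r, y r * ∏ p, crossCoeff m (1 / (x p - 1)) (r p) (c p)) ^ 2
      ≤ ∑ d, ∑ e, avoid m (sieveWeight x y) d * avoid m (sieveWeight x y) e *
        ∏ p, kern (1 / (x p - 1)) (d p) (e p) := by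
  have hw : ∀ p (o : Option κ ⊕ (κ × κ)), 0 ≤ lowWeight (1 / (x p - 1)) o := by
    intro p o
    have h1 := hx p
    have h2 := hx1 p
    have h3 : 0 ≤ 1 / (x p - 1) := one_div_nonneg.2 (by linarith)
    rcases o with (_ | o) | o
    · exact zero_le_one
    · refine mul_nonneg h3 ?_
      rw [mul_one_div, sub_nonneg, div_le_one (by linarith)]
      linarith
    · simp only [lowWeight]; positivity
  simp_rw [kern_eq_sum_lowWeight]
  rw [sum_sum_prod_eq_sum_sq (avoid m (sieveWeight x y)) (fun p => lowWeight (1 / (x p - 1)))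
    (fun p => lowVec (1 / (x p - 1)))]
  refine le_trans (le_of_eq ?_) (sum_sq_comp_le Sum.inl Sum.inl_injective
    (fun p => lowWeight (1 / (x p - 1))) hw _)
  refine sum_congr rfl fun c _ => ?_
  congr 1
  · exact prod_congr rfl fun p _ => by cases c p <;> rfl
  · simp_rw [← sum_basisCoeff_mul_lowVec]
    rw [← sum_change_basis y (fun p => basisCoeff (1 / (x p - 1)))
      (fun p d => (if d = some m then 0 else 1) * lowVec (1 / (x p - 1)) d (Sum.inl (c p)))]
    congr 1
    refine sum_congr rfl fun d _ => ?_
    rw [prod_mul_distrib, avoid, sieveWeight, mul_assoc]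

end Forms

end

end PrimeGaps

/-! ### Sums of `1 / n` over integers free of given primes -/

namespace PrimeGaps

open Finset

noncomputable section

/-- The positive integers below `x` divisible by no element of `T`. -/
def sifted (T : Finset ℕ) (x : ℝ) : Finset ℕ :=
  (range ⌈x⌉₊).filter fun n => 0 < n ∧ ∀ p ∈ T, ¬ p ∣ n

theorem mem_sifted {T : Finset ℕ} {x : ℝ} {n : ℕ} :
    n ∈ sifted T x ↔ (n : ℝ) < x ∧ 0 < n ∧ ∀ p ∈ T, ¬ p ∣ n := by
  simp [sifted, Nat.lt_ceil]

/-- The sum of `1 / n` over the sifted integers below `x`. -/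
def siftedSum (T : Finset ℕ) (x : ℝ) : ℝ := ∑ n ∈ sifted T x, 1 / (n : ℝ)

/-- The density of the sifted integers. -/
def density (T : Finset ℕ) : ℝ := ∏ p ∈ T, (1 - 1 / (p : ℝ))

/-- The secondary constant in the asymptotics of `siftedSum`. -/
def logShift (T : Finset ℕ) : ℝ := ∑ p ∈ T, Real.log p / ((p : ℝ) - 1)

/-- All `x > 0` are covered because the induction on `T` replaces `x` by `x / p`. For `x ≤ 1` the
sum is empty and `-log x ≤ 1 / x - 1`; otherwise it is a harmonic number. -/
theorem siftedSum_empty_bound {x : ℝ} (hx : 0 < x) :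
    |siftedSum ∅ x - (Real.log x + Real.eulerMascheroniConstant)| ≤ 2 / x := by
  have hg1 := Real.one_half_lt_eulerMascheroniConstant
  have hg2 := Real.eulerMascheroniConstant_lt_two_thirds
  rcases le_or_gt x 1 with h | h
  · have h0 : siftedSum ∅ x = 0 := by
      refine sum_eq_zero fun n hn => ?_
      obtain ⟨h1, h2, -⟩ := mem_sifted.1 hn
      have : (1 : ℝ) ≤ n := by exact_mod_cast h2
      linarith
    have h1 := Real.log_le_sub_one_of_pos (inv_pos.2 hx)
    rw [Real.log_inv] at h1
    have h2 : Real.log x ≤ 0 := Real.log_nonpos hx.le h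
    have h3 : 1 ≤ 1 / x := by rw [le_div_iff₀ hx]; linarith
    have h4 : 2 / x = 1 / x + 1 / x := by ring
    rw [inv_eq_one_div] at h1
    rw [h0, abs_le]
    constructor <;> linarith
  · obtain ⟨m, hm⟩ : ∃ m, ⌈x⌉₊ = m + 1 :=
      Nat.exists_eq_succ_of_ne_zero (Nat.ceil_pos.2 hx).ne'
    have hmx : (m : ℝ) < x := by
      rw [← Nat.lt_ceil]; omega
    have hxm : x ≤ m + 1 := by
      have := Nat.le_ceil x
      rw [hm] at this
      exact_mod_cast this
    have hm1 : 1 ≤ m := by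
      by_contra h'
      have : m = 0 := by omega
      subst this
      simp at hxm
      linarith
    have hm1' : (1 : ℝ) ≤ m := by exact_mod_cast hm1
    have hS : siftedSum ∅ x = (harmonic m : ℝ) := by
      unfold siftedSum sifted harmonic
      push_cast
      rw [hm, sum_filter, sum_range_succ']
      simp
    have e1 := Real.eulerMascheroniSeq_lt_eulerMascheroniConstant m
    have e2 := Real.eulerMascheroniConstant_lt_eulerMascheroniSeq' m
    rw [Real.eulerMascheroniSeq] at e1
    rw [Real.eulerMascheroniSeq', if_neg (by omega)] at e2
    have l1 : Real.log m ≤ Real.log x := Real.log_le_log (by linarith) hmx.le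
    have l2 : Real.log x ≤ Real.log (m + 1) := Real.log_le_log hx hxm
    have l3 : Real.log (m + 1) - Real.log m ≤ 1 / m := by
      rw [← Real.log_div (by positivity) (by positivity)]
      refine (Real.log_le_sub_one_of_pos (by positivity)).trans (le_of_eq ?_)
      field_simp
      ring
    have l4 : 1 / (m : ℝ) ≤ 2 / x := by
      rw [div_le_div_iff₀ (by linarith) hx]
      linarith
    rw [hS, abs_le]
    constructor <;> linarith

theorem siftedSum_insert {T : Finset ℕ} {p : ℕ} (hp : p.Prime) (hpT : p ∉ T)
    (hT : ∀ r ∈ T, r.Prime) (x : ℝ) :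
    siftedSum (insert p T) x = siftedSum T x - 1 / (p : ℝ) * siftedSum T (x / p) := by
  have hp0 : (0 : ℝ) < p := by exact_mod_cast hp.pos
  have h1 : sifted (insert p T) x = (sifted T x).filter fun n => ¬ p ∣ n := by
    ext n
    simp only [mem_sifted, mem_filter, mem_insert, forall_eq_or_imp]
    tauto
  have h2 : (sifted T x).filter (fun n => p ∣ n) = (sifted T (x / p)).image (fun n => p * n) := by
    ext n
    simp only [mem_sifted, mem_filter, mem_image]
    constructor
    · rintro ⟨⟨a, b, c⟩, m, rfl⟩
      refine ⟨m, ⟨?_, Nat.pos_of_mul_pos_left b, fun r hr h => c r hr (h.mul_left _)⟩, rfl⟩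
      rw [lt_div_iff₀ hp0]
      push_cast at a
      linarith
    · rintro ⟨m, ⟨a, b, c⟩, rfl⟩
      refine ⟨⟨?_, Nat.mul_pos hp.pos b, fun r hr h => ?_⟩, dvd_mul_right _ _⟩
      · rw [lt_div_iff₀ hp0] at a
        push_cast
        linarith
      · rcases (hT r hr).dvd_mul.1 h with h | h
        · exact hpT (((Nat.prime_dvd_prime_iff_eq (hT r hr) hp).1 h) ▸ hr)
        · exact c r hr h
  have h3 := sum_filter_add_sum_filter_not (sifted T x) (fun n => p ∣ n) (fun n => 1 / (n : ℝ))
  rw [h2, sum_image (fun a _ b _ h => Nat.eq_of_mul_eq_mul_left hp.pos h), ← h1] at h3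
  unfold siftedSum
  rw [← h3, mul_sum]
  simp only [Nat.cast_mul, one_div, mul_inv]
  ring

/-- Sieving by one more prime subtracts `1 / p` times the sum at `x / p`. The resulting `log p`
terms collect in `logShift`, and since `(1 / p) / (x / p) = 1 / x`, the error bound doubles. -/
theorem siftedSum_bound {T : Finset ℕ} (hT : ∀ r ∈ T, r.Prime) {x : ℝ} (hx : 0 < x) :
    |siftedSum T x - density T * (Real.log x + Real.eulerMascheroniConstant + logShift T)|
      ≤ 2 * 2 ^ T.card / x := by
  induction T using Finset.induction_on generalizing x with
  | empty => simpa [density, logShift] using siftedSum_empty_bound hx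
  | insert p T hpT ih =>
    have hp : p.Prime := hT p (mem_insert_self _ _)
    have hT' : ∀ r ∈ T, r.Prime := fun r hr => hT r (mem_insert_of_mem hr)
    have hp1 : (1 : ℝ) < p := by exact_mod_cast hp.one_lt
    have hp0 : (0 : ℝ) < p := by linarith
    have i1 := ih hT' hx
    have i2 := ih hT' (div_pos hx hp0)
    rw [Real.log_div hx.ne' hp0.ne'] at i2
    rw [siftedSum_insert hp hpT hT', card_insert_of_notMem hpT]
    have hd : density (insert p T) = (1 - 1 / (p : ℝ)) * density T := prod_insert hpT
    have hl : logShift (insert p T) = Real.log p / (p - 1) + logShift T := sum_insert hpT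
    rw [hd, hl]
    set g := Real.eulerMascheroniConstant
    set V := density T
    have key : siftedSum T x - 1 / (p : ℝ) * siftedSum T (x / p) - (1 - 1 / (p : ℝ)) * V *
          (Real.log x + g + (Real.log p / (p - 1) + logShift T))
        = (siftedSum T x - V * (Real.log x + g + logShift T)) - 1 / (p : ℝ) *
          (siftedSum T (x / p) - V * (Real.log x - Real.log p + g + logShift T)) := by
      have : (p : ℝ) - 1 ≠ 0 := by linarith
      field_simp
      ring
    rw [key]
    refine (abs_sub _ _).trans ?_
    rw [abs_mul, abs_of_pos (by positivity : (0 : ℝ) < 1 / p)]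
    have i3 : 1 / (p : ℝ) * |siftedSum T (x / p) - V * (Real.log x - Real.log p + g + logShift T)|
        ≤ 2 * 2 ^ T.card / x := by
      calc _ ≤ 1 / (p : ℝ) * (2 * 2 ^ T.card / (x / p)) :=
            mul_le_mul_of_nonneg_left i2 (by positivity)
        _ = _ := by field_simp
    calc _ ≤ 2 * 2 ^ T.card / x + 2 * 2 ^ T.card / x := add_le_add i1 i3
      _ = _ := by rw [pow_succ]; ring

theorem density_pos {T : Finset ℕ} (hT : ∀ r ∈ T, r.Prime) : 0 < density T :=
  prod_pos fun p hp => by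
    have : (1 : ℝ) < p := by exact_mod_cast (hT p hp).one_lt
    rw [sub_pos, div_lt_one (by linarith)]
    exact this

theorem density_le_one {T : Finset ℕ} (hT : ∀ r ∈ T, r.Prime) : density T ≤ 1 :=
  prod_le_one (fun p hp => by
    have : (1 : ℝ) < p := by exact_mod_cast (hT p hp).one_lt
    rw [sub_nonneg, div_le_one (by linarith)]
    exact this.le) fun p _ => by
      have : (0 : ℝ) ≤ 1 / p := by positivity
      linarith

/-- Each factor `2 * (1 - 1 / p)` is at least `1`. This converts absolute errors into errors
relative to the density. -/
theorem one_le_density_mul {T : Finset ℕ} (hT : ∀ r ∈ T, r.Prime) :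
    1 ≤ density T * 2 ^ T.card := by
  rw [density, ← prod_const, ← prod_mul_distrib]
  refine Finset.one_le_prod fun p hp => ?_
  have : (2 : ℝ) ≤ p := by exact_mod_cast (hT p hp).two_le
  rw [sub_mul, one_mul, one_div, inv_mul_eq_div, le_sub_iff_add_le, ← le_sub_iff_add_le']
  rw [div_le_iff₀ (by linarith)]
  linarith

theorem siftedSum_mono (T : Finset ℕ) {x y : ℝ} (h : x ≤ y) : siftedSum T x ≤ siftedSum T y := by
  refine sum_le_sum_of_subset_of_nonneg (fun n hn => ?_) fun n _ _ => by positivity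
  rw [mem_sifted] at hn ⊢
  exact ⟨hn.1.trans_le h, hn.2⟩

theorem siftedSum_nonneg (T : Finset ℕ) (x : ℝ) : 0 ≤ siftedSum T x :=
  sum_nonneg fun n _ => by positivity

/-- A prime up to `z` contributes at most `1`, as `log p ≤ p - 1`; beyond `z` the denominator is at
least `z`. -/
theorem logShift_le {T : Finset ℕ} (hT : ∀ r ∈ T, r.Prime) {z : ℕ} (hz : 1 ≤ z) :
    logShift T ≤ z + (∑ p ∈ T, Real.log p) / z := by
  have hz' : (0 : ℝ) < z := by exact_mod_cast hz
  unfold logShift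
  rw [← sum_filter_add_sum_filter_not T (fun p => p ≤ z)]
  refine add_le_add ?_ ?_
  · calc ∑ p ∈ T with p ≤ z, Real.log p / ((p : ℝ) - 1) ≤ ∑ p ∈ T with p ≤ z, (1 : ℝ) := by
          refine sum_le_sum fun p hp => ?_
          have hp1 : (1 : ℝ) < p := by exact_mod_cast (hT p (mem_filter.1 hp).1).one_lt
          rw [div_le_one (by linarith)]
          exact Real.log_le_sub_one_of_pos (by linarith)
      _ = ((T.filter fun p => p ≤ z).card : ℝ) := by simp
      _ ≤ ((Icc 1 z).card : ℝ) := by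
          refine Nat.cast_le.2 (card_le_card fun p hp => ?_)
          rw [mem_filter] at hp
          exact mem_Icc.2 ⟨(hT p hp.1).one_le, hp.2⟩
      _ = z := by simp
  · rw [sum_div]
    calc ∑ p ∈ T with ¬ p ≤ z, Real.log p / ((p : ℝ) - 1)
        ≤ ∑ p ∈ T with ¬ p ≤ z, Real.log p / z := by
          refine sum_le_sum fun p hp => ?_
          rw [mem_filter, not_le] at hp
          have : (z : ℝ) + 1 ≤ p := by exact_mod_cast hp.2
          exact div_le_div_of_nonneg_left (Real.log_natCast_nonneg p) hz' (by linarith)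
      _ ≤ _ := sum_le_sum_of_subset_of_nonneg (filter_subset _ _) fun p _ _ =>
          div_nonneg (Real.log_natCast_nonneg p) hz'.le

theorem card_le_of_sum_log {T : Finset ℕ} (hT : ∀ r ∈ T, r.Prime) {z : ℕ} (hz : 2 ≤ z) :
    (T.card : ℝ) ≤ z + (∑ p ∈ T, Real.log p) / Real.log z := by
  have hz' : (1 : ℝ) < z := by exact_mod_cast hz
  have hlz : 0 < Real.log z := Real.log_pos hz'
  rw [card_eq_sum_ones, Nat.cast_sum, ← sum_filter_add_sum_filter_not T (fun p => p ≤ z)]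
  refine add_le_add ?_ ?_
  · calc _ = ((T.filter fun p => p ≤ z).card : ℝ) := by simp
      _ ≤ ((Icc 1 z).card : ℝ) := by
          refine Nat.cast_le.2 (card_le_card fun p hp => ?_)
          rw [mem_filter] at hp
          exact mem_Icc.2 ⟨(hT p hp.1).one_le, hp.2⟩
      _ = z := by simp
  · rw [sum_div]
    calc _ ≤ ∑ p ∈ T with ¬ p ≤ z, Real.log p / Real.log z := by
          refine sum_le_sum fun p hp => ?_
          rw [mem_filter, not_le] at hp
          rw [Nat.cast_one, one_le_div hlz]
          exact Real.log_le_log (by linarith) (by exact_mod_cast hp.2.le)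
      _ ≤ _ := sum_le_sum_of_subset_of_nonneg (filter_subset _ _) fun p _ _ =>
          div_nonneg (Real.log_natCast_nonneg p) hlz.le

/-- Uniform asymptotics for the sum of `1 / n` over integers free of prime factors in `T`. -/
theorem siftedSum_asymptotic {η : ℝ} (hη : 0 < η) :
    ∃ L₀ : ℝ, ∀ L : ℝ, L₀ ≤ L → ∀ T : Finset ℕ, (∀ p ∈ T, p.Prime) →
      ∑ p ∈ T, Real.log p ≤ 3 * L → ∀ x : ℝ, 1 ≤ x →
      |siftedSum T x - density T * Real.log x| ≤ η * density T * L := by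
  -- The cut-off `z` depends on `η` only. The primes of `T` beyond it then contribute at most `η /
  -- 16 * L` to `logShift` and at most `η / 8 * L` to `log (4 ^ |T|)`.
  obtain ⟨z, hz⟩ : ∃ z : ℕ, 2 ≤ z ∧ 3 / (z : ℝ) ≤ η / 16 ∧ 3 * Real.log 4 / Real.log z ≤ η / 8 := by
    have h1 : Filter.Tendsto (fun z : ℕ => 3 / (z : ℝ)) Filter.atTop (nhds 0) :=
      tendsto_const_nhds.div_atTop tendsto_natCast_atTop_atTop
    have h2 : Filter.Tendsto (fun z : ℕ => 3 * Real.log 4 / Real.log z) Filter.atTop (nhds 0) :=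
      tendsto_const_nhds.div_atTop (Real.tendsto_log_atTop.comp tendsto_natCast_atTop_atTop)
    have := (Filter.eventually_ge_atTop 2).and
      ((h1.eventually_le_const (by positivity : (0 : ℝ) < η / 16)).and
        (h2.eventually_le_const (by positivity : (0 : ℝ) < η / 8)))
    exact this.exists
  obtain ⟨hz2, hz3, hz4⟩ := hz
  have hz0 : (0 : ℝ) < z := by exact_mod_cast (by omega : 0 < z)
  have hlz : 0 < Real.log z := Real.log_pos (by exact_mod_cast hz2)
  have hl4 : 0 < Real.log 4 := Real.log_pos (by norm_num)
  refine ⟨max (16 * z / η) (max (8 * (z * Real.log 4) / η) (max (24 / η) 0)), ?_⟩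
  intro L hL T hT hTL x hx
  simp only [max_le_iff, div_le_iff₀ hη] at hL
  obtain ⟨L1, L2, L3, L4⟩ := hL
  set V := density T with hV
  have hVpos : 0 < V := density_pos hT
  set ℓ := logShift T with hℓ
  have hℓ0 : 0 ≤ ℓ := sum_nonneg fun p hp => by
    have : (1 : ℝ) < p := by exact_mod_cast (hT p hp).one_lt
    exact div_nonneg (Real.log_natCast_nonneg p) (by linarith)
  have hℓ1 : ℓ ≤ η / 8 * L := by
    have h1 := logShift_le hT (by omega : 1 ≤ z)
    have h2 : (∑ p ∈ T, Real.log p) / z ≤ 3 * L / z := div_le_div_of_nonneg_right hTL hz0.le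
    have h3 : 3 * L / z = 3 / z * L := by ring
    have h4 : 3 / z * L ≤ η / 16 * L := mul_le_mul_of_nonneg_right hz3 L4
    linarith
  -- Base `4`: one factor `2 ^ |T|` is the sieve error, the other pays for dividing by the density.
  have hcard : (4 : ℝ) ^ T.card ≤ Real.exp (η / 4 * L) := by
    rw [← Real.rpow_natCast, Real.rpow_def_of_pos (by norm_num)]
    refine Real.exp_le_exp.2 ?_
    have h1 := card_le_of_sum_log hT hz2
    have h2 : (∑ p ∈ T, Real.log p) / Real.log z ≤ 3 * L / Real.log z :=
      div_le_div_of_nonneg_right hTL hlz.le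
    have h3 : Real.log 4 * (3 * L / Real.log z) = 3 * Real.log 4 / Real.log z * L := by ring
    have h4 : 3 * Real.log 4 / Real.log z * L ≤ η / 8 * L := mul_le_mul_of_nonneg_right hz4 L4
    have h5 : Real.log 4 * T.card ≤ Real.log 4 * (z + 3 * L / Real.log z) :=
      mul_le_mul_of_nonneg_left (by linarith) hl4.le
    linarith
  have hg1 := Real.one_half_lt_eulerMascheroniConstant
  have hg2 := Real.eulerMascheroniConstant_lt_two_thirds
  set u := Real.exp (η / 4 * L) with hu
  have hupos : 0 < u := Real.exp_pos _
  have large : ∀ y, u ≤ y → |siftedSum T y - V * Real.log y| ≤ V * (η / 4 * L) := by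
    intro y hy
    have hy0 : 0 < y := hupos.trans_le hy
    have h1 := siftedSum_bound hT hy0
    have h2 : 2 * 2 ^ T.card / y ≤ 2 * V := by
      have h22 : (2 : ℝ) ^ T.card * 2 ^ T.card = 4 ^ T.card := by rw [← mul_pow]; norm_num
      have h3 := one_le_density_mul hT
      rw [div_le_iff₀ hy0]
      have h5 : (2 : ℝ) ^ T.card ≤ V * 4 ^ T.card := by
        rw [← h22, ← mul_assoc]
        exact le_mul_of_one_le_left (by positivity) h3
      have h6 : V * 4 ^ T.card ≤ V * y := mul_le_mul_of_nonneg_left (hcard.trans hy) hVpos.le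
      linarith
    have h3 : siftedSum T y - V * Real.log y =
        (siftedSum T y - V * (Real.log y + Real.eulerMascheroniConstant + ℓ))
          + V * (Real.eulerMascheroniConstant + ℓ) := by ring
    rw [h3]
    refine (abs_add_le _ _).trans ?_
    rw [abs_of_nonneg (by positivity : 0 ≤ V * (Real.eulerMascheroniConstant + ℓ))]
    calc _ ≤ 2 * V + V * (1 + η / 8 * L) :=
          add_le_add (h1.trans h2) (mul_le_mul_of_nonneg_left (by linarith) hVpos.le)
      _ = V * (3 + η / 8 * L) := by ring
      _ ≤ _ := mul_le_mul_of_nonneg_left (by linarith) hVpos.le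
  have hVL : 0 ≤ V * (η * L) := by positivity
  rcases le_or_gt u x with h | h
  · exact (large x h).trans (by nlinarith)
  -- Below `u` the sum lies between `0` and its value at `u`, which is already of the order of the
  -- permitted error.
  · have h1 := abs_le.1 (large u le_rfl)
    rw [hu, Real.log_exp, ← hu] at h1
    have h2 := siftedSum_mono T h.le
    have h3 := siftedSum_nonneg T x
    have h4 : Real.log x ≤ η / 4 * L := by
      have := Real.log_le_log (by linarith) h.le
      rwa [hu, Real.log_exp] at this
    have h5 : V * Real.log x ≤ V * (η / 4 * L) := mul_le_mul_of_nonneg_left h4 hVpos.le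
    have h6 : 0 ≤ V * Real.log x := mul_nonneg hVpos.le (Real.log_nonneg hx)
    rw [abs_le]
    constructor <;> nlinarith

end

end PrimeGaps

/-! ### From the variational problem to a step function on a grid -/

namespace PrimeGaps

open Finset MeasureTheory
open scoped ContDiff Pointwise

noncomputable section

/-- The grid point with coordinates `(j i + 1) / n`. -/
def gridPoint {ι : Type*} (n : ℕ) (j : ι → ℕ) : ι → ℝ := fun i => ((j i : ℝ) + 1) / n

/-- The index set of the grid with `n` points in each direction. -/
def grid (ι : Type*) [Fintype ι] [DecidableEq ι] (n : ℕ) : Finset (ι → ℕ) :=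
  Fintype.piFinset fun _ => range n

theorem mem_grid {ι : Type*} [Fintype ι] [DecidableEq ι] {n : ℕ} {j : ι → ℕ} :
    j ∈ grid ι n ↔ ∀ i, j i < n := by
  simp [grid]

theorem gridPoint_injective {ι : Type*} {n : ℕ} (hn : 0 < n) :
    Function.Injective (gridPoint n : (ι → ℕ) → ι → ℝ) := by
  intro a b h
  funext i
  have h1 := congrFun h i
  have hn' : (n : ℝ) ≠ 0 := by exact_mod_cast hn.ne'
  simp only [gridPoint] at h1
  rw [div_left_inj' hn'] at h1
  exact_mod_cast add_right_cancel h1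

/-- Makes lattice-point Riemann sums explicit. The cube is open at `0` and closed at `1`, so that
the sample points are the upper corners `(j + 1) / n`. -/
theorem inter_smul_eq_image_gridPoint {ι : Type*} [Fintype ι] [DecidableEq ι] {n : ℕ}
    (hn : 0 < n) :
    (Set.pi Set.univ fun _ : ι => Set.Ioc (0 : ℝ) 1) ∩
        (n : ℝ)⁻¹ • (Submodule.span ℤ (Set.range (Pi.basisFun ℝ ι)) : Set (ι → ℝ))
      = ((grid ι n).image (gridPoint n) : Finset (ι → ℝ)) := by
  have : NeZero n := ⟨hn.ne'⟩
  have hn' : (0 : ℝ) < n := by exact_mod_cast hn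
  ext v
  have hspan := BoxIntegral.unitPartition.mem_smul_span_iff (n := n) (v := v)
  rw [Set.mem_inter_iff, Set.mem_univ_pi, Finset.mem_coe, Finset.mem_image]
  constructor
  · rintro ⟨h1, h2⟩
    have h2' := hspan.1 h2
    choose z hz using h2'
    have hz' : ∀ i, (z i : ℝ) = n * v i := fun i => by simpa using hz i
    have hpos : ∀ i, 0 < z i := fun i => by
      have : (0 : ℝ) < z i := by rw [hz']; exact mul_pos hn' (h1 i).1
      exact_mod_cast this
    have hle : ∀ i, z i ≤ n := fun i => by
      have : (z i : ℝ) ≤ n := by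
        rw [hz']; exact mul_le_of_le_one_right hn'.le (h1 i).2
      exact_mod_cast this
    refine ⟨fun i => (z i - 1).toNat, mem_grid.2 fun i => ?_, funext fun i => ?_⟩
    · have := hpos i
      have := hle i
      omega
    · have h3 : (((z i - 1).toNat : ℤ) : ℝ) = (z i : ℝ) - 1 := by
        rw [Int.toNat_of_nonneg (by have := hpos i; omega)]
        push_cast
        ring
      rw [Int.cast_natCast] at h3
      simp only [gridPoint]
      rw [h3, sub_add_cancel, hz']
      field_simp
  · rintro ⟨j, hj, rfl⟩
    rw [mem_grid] at hj
    refine ⟨fun i => ⟨?_, ?_⟩, hspan.2 fun i => ⟨(j i : ℤ) + 1, ?_⟩⟩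
    · simp only [gridPoint]; positivity
    · simp only [gridPoint]
      rw [div_le_one hn']
      exact_mod_cast hj i
    · simp only [gridPoint]
      push_cast
      field_simp

theorem tendsto_grid_sum {ι : Type*} [Fintype ι] [DecidableEq ι] {F : (ι → ℝ) → ℝ}
    (hF : Continuous F) :
    Filter.Tendsto (fun n : ℕ => (∑ j ∈ grid ι n, F (gridPoint n j)) / (n : ℝ) ^ Fintype.card ι)
      Filter.atTop (nhds (∫ x in Set.Icc (0 : ι → ℝ) 1, F x)) := by
  set s : Set (ι → ℝ) := Set.pi Set.univ fun _ : ι => Set.Ioc (0 : ℝ) 1 with hs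
  have hsub : s ⊆ Set.Icc 0 1 := fun x hx =>
    ⟨fun i => (hx i trivial).1.le, fun i => (hx i trivial).2⟩
  have hint : ∫ x in Set.Icc (0 : ι → ℝ) 1, F x = ∫ x in s, F x :=
    (setIntegral_congr_set (Measure.univ_pi_Ioc_ae_eq_Icc (μ := fun _ : ι => volume)
      (f := (0 : ι → ℝ)) (g := 1))).symm
  rw [hint]
  have hconv : Convex ℝ s := convex_pi fun i _ => convex_Ioc 0 1
  have h := tendsto_tsum_div_pow_atTop_integral s F hF
    ((Metric.isBounded_Icc 0 1).subset hsub)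
    (MeasurableSet.univ_pi fun _ => measurableSet_Ioc) (hconv.addHaar_frontier volume)
  refine h.congr' ?_
  filter_upwards [Filter.eventually_gt_atTop 0] with n hn
  congr 1
  rw [tsum_congr_set_coe F (inter_smul_eq_image_gridPoint hn), Finset.tsum_subtype',
    sum_image fun a _ b _ h => gridPoint_injective hn h]

/-- Insert the value `u` as the `m`-th coordinate. -/
def insertCoord {κ α : Type*} [DecidableEq κ] (m : κ) (u : α) (x : {j : κ // j ≠ m} → α) :
    κ → α :=
  fun j => if hj : j = m then u else x ⟨j, hj⟩

theorem riemann_sum_unit {g : ℝ → ℝ} (hg : Continuous g) {ε δ : ℝ}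
    (hδ : ∀ u v, |u - v| ≤ δ → |g u - g v| ≤ ε) {n : ℕ} (hn : 0 < n) (hnδ : 1 / (n : ℝ) ≤ δ) :
    |(∑ l ∈ range n, g (((l : ℝ) + 1) / n)) / n - ∫ u in (0 : ℝ)..1, g u| ≤ ε := by
  have hn' : (0 : ℝ) < n := by exact_mod_cast hn
  have h1 : ∫ u in (0 : ℝ)..1, g u = ∑ l ∈ range n, ∫ u in ((l : ℝ) / n)..((l + 1 : ℕ) / n), g u := by
    rw [intervalIntegral.sum_integral_adjacent_intervals (a := fun l : ℕ => (l : ℝ) / n)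
      fun k _ => hg.intervalIntegrable _ _]
    simp [hn'.ne']
  have h2 : ∀ l ∈ range n, ‖g (((l : ℝ) + 1) / n) / n - ∫ u in ((l : ℝ) / n)..((l + 1 : ℕ) / n), g u‖
      ≤ ε / n := by
    intro l _
    have hlen : ((l + 1 : ℕ) : ℝ) / n - l / n = 1 / n := by push_cast; ring
    have h3 : g (((l : ℝ) + 1) / n) / n
        = ∫ _ in ((l : ℝ) / n)..((l + 1 : ℕ) / n), g (((l : ℝ) + 1) / n) := by
      rw [intervalIntegral.integral_const, hlen, smul_eq_mul]; ring
    rw [h3, ← intervalIntegral.integral_sub (by simp) (hg.intervalIntegrable _ _)]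
    refine (intervalIntegral.norm_integral_le_of_norm_le_const (C := ε) fun u hu => ?_).trans
      (le_of_eq ?_)
    · have hle : (l : ℝ) / n ≤ (l + 1 : ℕ) / n := by
        rw [← sub_nonneg, hlen]; positivity
      rw [Set.uIoc_of_le hle] at hu
      refine hδ _ _ ?_
      push_cast at hu hlen
      rw [abs_of_nonneg (by linarith [hu.2])]
      linarith [hu.1]
    · rw [hlen, abs_of_pos (by positivity)]; ring
  rw [h1, sum_div, ← sum_sub_distrib]
  refine (norm_sum_le_of_le _ h2).trans (le_of_eq ?_)
  rw [sum_const, card_range, nsmul_eq_mul]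
  field_simp

theorem continuous_insertCoord {κ : Type*} [DecidableEq κ] (m : κ) :
    Continuous fun p : ({j : κ // j ≠ m} → ℝ) × ℝ => insertCoord m p.2 p.1 := by
  refine continuous_pi fun j => ?_
  unfold insertCoord
  by_cases hj : j = m
  · simpa [hj] using continuous_snd
  · simp only [hj, dif_neg, not_false_eq_true]
    exact (continuous_apply _).comp continuous_fst

/-- Uniform continuity makes the inner Riemann sums converge uniformly in the other coordinates. As
`F` is bounded, so do their squares, and it remains to take the outer Riemann sum of a continuous
function. -/
theorem tendsto_grid_J {k : ℕ} (m : Fin k) {F : (Fin k → ℝ) → ℝ} (hF : Continuous F)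
    (hU : UniformContinuous F) {B : ℝ} (hB : ∀ x, |F x| ≤ B) :
    Filter.Tendsto (fun n : ℕ => (∑ x ∈ grid {j : Fin k // j ≠ m} n,
        ((∑ l ∈ range n, F (insertCoord m (((l : ℝ) + 1) / n) (gridPoint n x))) / n) ^ 2)
          / (n : ℝ) ^ Fintype.card {j : Fin k // j ≠ m})
      Filter.atTop (nhds (funJ m F)) := by
  have hB0 : 0 ≤ B := (abs_nonneg _).trans (hB 0)
  set G : ({j : Fin k // j ≠ m} → ℝ) → ℝ := fun x => ∫ u in (0 : ℝ)..1, F (insertCoord m u x)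
    with hG
  have hGc : Continuous G :=
    intervalIntegral.continuous_parametric_intervalIntegral_of_continuous'
      (f := fun x u => F (insertCoord m u x)) (hF.comp (continuous_insertCoord m)) 0 1
  have hGB : ∀ x, |G x| ≤ B := fun x => by
    have := intervalIntegral.norm_integral_le_of_norm_le_const (a := 0) (b := 1)
      (f := fun u => F (insertCoord m u x)) (C := B) fun u _ => hB _
    simpa using this
  have hlim := tendsto_grid_sum (F := fun x => G x ^ 2) (hGc.pow 2)
  have hJ' : funJ m F = ∫ x in Set.Icc (0 : {j : Fin k // j ≠ m} → ℝ) 1, G x ^ 2 := rfl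
  rw [← hJ'] at hlim
  have hdiff : Filter.Tendsto (fun n : ℕ => (∑ x ∈ grid {j : Fin k // j ≠ m} n,
        ((∑ l ∈ range n, F (insertCoord m (((l : ℝ) + 1) / n) (gridPoint n x))) / n) ^ 2)
          / (n : ℝ) ^ Fintype.card {j : Fin k // j ≠ m} -
        (∑ j ∈ grid {j : Fin k // j ≠ m} n, G (gridPoint n j) ^ 2)
          / (n : ℝ) ^ Fintype.card {j : Fin k // j ≠ m}) Filter.atTop (nhds 0) := by
    rw [Metric.tendsto_atTop]
    intro ε hε
    obtain ⟨δ, hδ, hδ'⟩ := Metric.uniformContinuous_iff_le.1 hU (ε / (4 * (B + 1))) (by positivity)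
    obtain ⟨n₀, hn₀⟩ := exists_nat_gt (1 / δ)
    refine ⟨max n₀ 1, fun n hn => ?_⟩
    have hn1 : 0 < n := lt_of_lt_of_le one_pos ((le_max_right _ _).trans hn)
    have hn' : (0 : ℝ) < n := by exact_mod_cast hn1
    have hnδ : 1 / (n : ℝ) ≤ δ := by
      rw [div_le_iff₀ hn', ← div_le_iff₀' hδ]
      exact hn₀.le.trans (by exact_mod_cast (le_max_left _ _).trans hn)
    have hpt : ∀ x : {j : Fin k // j ≠ m} → ℝ,
        |((∑ l ∈ range n, F (insertCoord m (((l : ℝ) + 1) / n) x)) / n) ^ 2 - G x ^ 2|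
          ≤ ε / 2 := by
      intro x
      have h1 := riemann_sum_unit (g := fun u => F (insertCoord m u x))
        (ε := ε / (4 * (B + 1))) (δ := δ)
        (hF.comp ((continuous_insertCoord m).comp (by fun_prop : Continuous fun u : ℝ => (x, u))))
        (fun u v huv => by
          refine hδ' ?_
          rw [dist_pi_le_iff hδ.le]
          intro j
          unfold insertCoord
          by_cases hj : j = m
          · simpa [hj, Real.dist_eq] using huv
          · simpa [hj] using hδ.le) hn1 hnδ
      set a := (∑ l ∈ range n, F (insertCoord m (((l : ℝ) + 1) / n) x)) / n
      have ha : |a| ≤ B := by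
        rw [abs_div, abs_of_pos hn', div_le_iff₀ hn']
        refine (abs_sum_le_sum_abs _ _).trans ((sum_le_sum fun l _ => hB _).trans ?_)
        rw [sum_const, card_range, nsmul_eq_mul, mul_comm]
      rw [sq_sub_sq, abs_mul, mul_comm]
      calc |a - G x| * |a + G x| ≤ ε / (4 * (B + 1)) * (B + B) :=
            mul_le_mul h1 ((abs_add_le _ _).trans (add_le_add ha (hGB x))) (abs_nonneg _)
              (by positivity)
        _ ≤ ε / (4 * (B + 1)) * (2 * (B + 1)) := by gcongr; linarith
        _ = ε / 2 := by field_simp; ring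
    rw [dist_zero_right, ← sub_div, ← sum_sub_distrib, norm_div, Real.norm_eq_abs,
      Real.norm_of_nonneg (by positivity : 0 ≤ (n : ℝ) ^ Fintype.card {j : Fin k // j ≠ m})]
    refine lt_of_le_of_lt ?_ (half_lt_self hε)
    rw [div_le_iff₀ (by positivity)]
    refine (abs_sum_le_sum_abs _ _).trans ((sum_le_sum fun x _ => hpt _).trans ?_)
    rw [sum_const, nsmul_eq_mul, grid, Fintype.card_piFinset, prod_const, card_range,
      card_univ, mul_comm]
    push_cast
    exact le_rfl
  have := hdiff.add hlim
  rw [zero_add] at this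
  exact this.congr fun n => by ring

/-- Opens the square of the inner sum: `j` carries one value of the `m`-th coordinate and `l` the
other. This is the shape in which the sieve produces it. -/
theorem sum_grid_sum_update {k : ℕ} (m : Fin k) (n : ℕ) (Φ : (Fin k → ℕ) → ℝ) :
    ∑ j ∈ grid (Fin k) n, ∑ l ∈ range n, Φ j * Φ (Function.update j m l)
      = ∑ x ∈ grid {j : Fin k // j ≠ m} n, (∑ l ∈ range n, Φ (insertCoord m l x)) ^ 2 := by
  have h1 : ∀ x, (∑ l ∈ range n, Φ (insertCoord m l x)) ^ 2
      = ∑ l' ∈ range n, ∑ l ∈ range n, Φ (insertCoord m l' x) * Φ (insertCoord m l x) := by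
    intro x; rw [pow_two, sum_mul_sum]
  simp_rw [h1]
  rw [← sum_product' (grid {j : Fin k // j ≠ m} n) (range n) fun x l' =>
    ∑ l ∈ range n, Φ (insertCoord m l' x) * Φ (insertCoord m l x)]
  refine (sum_bij' (fun p _ => insertCoord m p.2 p.1)
    (fun j _ => ((fun i => j i.1 : {j : Fin k // j ≠ m} → ℕ), j m)) ?_ ?_ ?_ ?_ ?_).symm
  · rintro ⟨x, l⟩ h
    rw [mem_product, mem_grid, mem_range] at h
    refine mem_grid.2 fun i => ?_
    unfold insertCoord
    split_ifs with hi
    · exact h.2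
    · exact h.1 _
  · intro j hj
    rw [mem_grid] at hj
    exact mem_product.2 ⟨mem_grid.2 fun i => hj _, mem_range.2 (hj _)⟩
  · rintro ⟨x, l⟩ _
    ext i
    · simp [insertCoord, i.2]
    · simp [insertCoord]
  · intro j _
    ext i
    by_cases hi : i = m <;> simp [insertCoord, hi]
  · rintro ⟨x, l⟩ _
    refine sum_congr rfl fun l' _ => ?_
    congr 2
    ext i
    by_cases hi : i = m
    · subst hi; simp [insertCoord]
    · simp [insertCoord, hi]

/-- A discrete version of `M_k > ρ`: a nonnegative step function on a grid. -/
theorem exists_grid_function {k : ℕ} {ρ : ℝ} (h : ((ρ : ℝ) : EReal) < bigM k) :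
    ∃ (M : ℕ) (Φ : (Fin k → ℕ) → ℝ), 0 < M ∧ (∀ j, 0 ≤ Φ j) ∧
      (∀ j, Φ j ≠ 0 → ∑ i, (j i + 1) ≤ M) ∧
      ρ * M * ∑ j ∈ grid (Fin k) M, Φ j ^ 2 <
        ∑ m : Fin k, ∑ j ∈ grid (Fin k) M, ∑ l ∈ range M, Φ j * Φ (Function.update j m l) := by
  rw [bigM] at h
  simp only [lt_iSup_iff] at h
  obtain ⟨F, hFt, hF⟩ := h
  rw [EReal.coe_lt_coe_iff] at hF
  have hI0 : 0 ≤ funI F := integral_nonneg fun x => sq_nonneg _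
  have hI : 0 < funI F := lt_of_le_of_ne hI0 (Ne.symm hFt.I_ne_zero)
  rw [lt_div_iff₀ hI] at hF
  have hc : Continuous F := hFt.smooth.continuous
  have hcs : HasCompactSupport F := by
    refine HasCompactSupport.of_support_subset_isCompact (K := Set.Icc 0 1) isCompact_Icc ?_
    exact hFt.supported.trans fun x hx => ⟨fun i => (hx.1 i).1, fun i => (hx.1 i).2⟩
  have hU : UniformContinuous F := hcs.uniformContinuous_of_continuous hc
  obtain ⟨B, hB⟩ := hcs.exists_bound_of_continuous hc
  have t1 := (tendsto_grid_sum (F := fun x => F x ^ 2) (hc.pow 2)).const_mul ρ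
  have t2 := tendsto_finsetSum univ fun m _ => tendsto_grid_J m hc hU hB
  obtain ⟨n, hn, hn0⟩ := ((t1.eventually_lt t2 hF).and (Filter.eventually_gt_atTop 0)).exists
  have hn' : (0 : ℝ) < n := by exact_mod_cast hn0
  have hcard : ∀ m : Fin k, Fintype.card {j : Fin k // j ≠ m} + 1 = k := by
    intro m
    have hm := m.2
    rw [Fintype.card_subtype_compl]
    simp
    omega
  -- Absolute values keep `I` and can only increase each `J`; the nonnegativity is what later
  -- permits dropping terms. Sampling at upper corners gives the support condition with its `+ 1`.
  refine ⟨n, fun j => |F (gridPoint n j)|, hn0, fun j => abs_nonneg _, ?_, ?_⟩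
  · intro j hj
    have h1 := (hFt.supported (abs_ne_zero.1 hj)).2
    simp only [gridPoint] at h1
    rw [← sum_div, div_le_one hn'] at h1
    exact_mod_cast h1
  · simp_rw [sum_grid_sum_update, sq_abs]
    have h2 := mul_lt_mul_of_pos_right hn (pow_pos hn' (k + 1))
    rw [Fintype.card_fin, sum_mul] at h2
    have e1 : ρ * ((∑ j ∈ grid (Fin k) n, F (gridPoint n j) ^ 2) / (n : ℝ) ^ k) * (n : ℝ) ^ (k + 1)
        = ρ * n * ∑ j ∈ grid (Fin k) n, F (gridPoint n j) ^ 2 := by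
      rw [pow_succ]; field_simp
    rw [e1] at h2
    refine h2.trans_le (sum_le_sum fun m _ => ?_)
    have e2 : (n : ℝ) ^ (k + 1) = (n : ℝ) ^ Fintype.card {j : Fin k // j ≠ m} * n ^ 2 := by
      rw [← pow_add]; congr 1; have := hcard m; omega
    rw [e2, ← mul_assoc, div_mul_cancel₀ _ (by positivity), sum_mul]
    refine sum_le_sum fun x _ => ?_
    rw [← mul_pow, div_mul_cancel₀ _ hn'.ne', ← sq_abs]
    refine pow_le_pow_left₀ (abs_nonneg _) ?_ 2
    refine (abs_sum_le_sum_abs _ _).trans (le_of_eq (sum_congr rfl fun l _ => ?_))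
    congr 2
    ext i
    by_cases hi : i = m <;> simp [gridPoint, insertCoord, hi]

end

end PrimeGaps

/-! ### Colourings of primes, tuples of integers, logarithmic cells -/

namespace PrimeGaps

open Finset

noncomputable section

/-- The primes below `R` outside `T`. -/
def freePrimes (T : Finset ℕ) (R : ℝ) : Finset ℕ := (sifted T R).filter Nat.Prime

theorem prime_of_freePrimes {T : Finset ℕ} {R : ℝ} (p : freePrimes T R) : p.1.Prime :=
  (mem_filter.1 p.2).2

theorem cast_pos_of_freePrimes {T : Finset ℕ} {R : ℝ} (p : freePrimes T R) : (0 : ℝ) < p.1 := by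
  exact_mod_cast (prime_of_freePrimes p).pos

theorem lt_of_freePrimes {T : Finset ℕ} {R : ℝ} (p : freePrimes T R) : (p.1 : ℝ) < R :=
  (mem_sifted.1 (mem_filter.1 p.2).1).1

theorem notMem_of_freePrimes {T : Finset ℕ} {R : ℝ} (p : freePrimes T R) : p.1 ∉ T := fun h =>
  (mem_sifted.1 (mem_filter.1 p.2).1).2.2 p.1 h dvd_rfl

theorem mem_freePrimes_of_dvd {T : Finset ℕ} (hT : ∀ p ∈ T, p.Prime) {R : ℝ} {n p : ℕ}
    (hn : n ∈ sifted T R) (hp : p.Prime) (hpn : p ∣ n) : p ∈ freePrimes T R := by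
  obtain ⟨h1, h2, h3⟩ := mem_sifted.1 hn
  refine mem_filter.2 ⟨mem_sifted.2 ⟨lt_of_le_of_lt ?_ h1, hp.pos, fun r hr hrp => ?_⟩, hp⟩
  · exact_mod_cast Nat.le_of_dvd h2 hpn
  · rw [Nat.prime_dvd_prime_iff_eq (hT r hr) hp] at hrp
    exact h3 p (hrp ▸ hr) hpn

section Products

variable {T : Finset ℕ} {R : ℝ}

/-- The product of a set of primes. -/
def setProd (A : Finset (freePrimes T R)) : ℕ := ∏ p ∈ A, p.1

theorem setProd_pos (A : Finset (freePrimes T R)) : 0 < setProd A :=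
  prod_pos fun p _ => (prime_of_freePrimes p).pos

theorem prime_dvd_setProd_iff {A : Finset (freePrimes T R)} {q : ℕ} (hq : q.Prime) :
    q ∣ setProd A ↔ ∃ p ∈ A, p.1 = q := by
  rw [setProd, hq.prime.dvd_finsetProd_iff]
  exact exists_congr fun p => and_congr_right fun _ => by
    rw [Nat.prime_dvd_prime_iff_eq hq (prime_of_freePrimes p), eq_comm]

theorem dvd_setProd_iff {A : Finset (freePrimes T R)} {p : freePrimes T R} :
    p.1 ∣ setProd A ↔ p ∈ A := by
  rw [prime_dvd_setProd_iff (prime_of_freePrimes p)]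
  constructor
  · rintro ⟨r, hr, h⟩
    rwa [← Subtype.ext h]
  · exact fun h => ⟨p, h, rfl⟩

theorem setProd_injective : Function.Injective (setProd : Finset (freePrimes T R) → ℕ) := by
  intro A B h
  ext p
  rw [← dvd_setProd_iff, h, dvd_setProd_iff]

theorem setProd_mem_sifted (hT : ∀ p ∈ T, p.Prime) {A : Finset (freePrimes T R)}
    (h : (setProd A : ℝ) < R) : setProd A ∈ sifted T R := by
  refine mem_sifted.2 ⟨h, setProd_pos A, fun q hq hqA => ?_⟩
  obtain ⟨p, -, rfl⟩ := (prime_dvd_setProd_iff (hT q hq)).1 hqA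
  exact notMem_of_freePrimes p hq

theorem setProd_filter_dvd (hT : ∀ p ∈ T, p.Prime) {n : ℕ} (hn : n ∈ sifted T R)
    (hsq : Squarefree n) : setProd (univ.filter fun p : freePrimes T R => p.1 ∣ n) = n := by
  conv_rhs => rw [← Nat.prod_primeFactors_of_squarefree hsq]
  refine prod_bij (fun p _ => p.1) ?_ (fun a _ b _ h => Subtype.ext h) ?_ fun _ _ => rfl
  · intro p hp
    exact Nat.mem_primeFactors.2 ⟨prime_of_freePrimes p, (mem_filter.1 hp).2, hsq.ne_zero⟩
  · intro q hq
    obtain ⟨h1, h2, -⟩ := Nat.mem_primeFactors.1 hq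
    exact ⟨⟨q, mem_freePrimes_of_dvd hT hn h1 h2⟩, mem_filter.2 ⟨mem_univ _, h2⟩, rfl⟩

theorem prod_one_div (A : Finset (freePrimes T R)) :
    ∏ p ∈ A, 1 / (p.1 : ℝ) = 1 / (setProd A : ℝ) := by
  rw [setProd, Nat.cast_prod, prod_div_distrib, prod_const_one]

variable {k : ℕ}

/-- The primes of colour `i`. -/
def colorClass (c : freePrimes T R → Option (Fin k)) (i : Fin k) : Finset (freePrimes T R) :=
  univ.filter fun p => c p = some i

theorem mem_colorClass {c : freePrimes T R → Option (Fin k)} {i : Fin k} {p : freePrimes T R} :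
    p ∈ colorClass c i ↔ c p = some i := by
  simp [colorClass]

theorem colorClass_injective :
    Function.Injective (colorClass : (freePrimes T R → Option (Fin k)) → _) := by
  intro c c' h
  funext p
  have h1 : ∀ i, c p = some i ↔ c' p = some i := fun i => by
    rw [← mem_colorClass, h, mem_colorClass]
  exact Option.ext h1

theorem prod_colWeight (g : freePrimes T R → ℝ) (c : freePrimes T R → Option (Fin k)) :
    ∏ p, colWeight (g p) (c p) = ∏ i, ∏ p ∈ colorClass c i, g p := by
  simp_rw [colorClass, prod_filter]
  rw [prod_comm]
  refine prod_congr rfl fun p _ => ?_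
  cases h : c p with
  | none => simp [colWeight]
  | some j => simp [colWeight, prod_ite_eq]

/-- The integers attached to a colouring. -/
def colorProd (c : freePrimes T R → Option (Fin k)) (i : Fin k) : ℕ := setProd (colorClass c i)

theorem colorProd_injective :
    Function.Injective (colorProd : (freePrimes T R → Option (Fin k)) → _) := fun _ _ h =>
  colorClass_injective (funext fun i => setProd_injective (congrFun h i))

theorem prod_colWeight_one_div (c : freePrimes T R → Option (Fin k)) :
    ∏ p, colWeight (1 / (p.1 : ℝ)) (c p) = ∏ i, 1 / (colorProd c i : ℝ) := by
  rw [prod_colWeight]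
  exact prod_congr rfl fun i _ => prod_one_div _

end Products

/-- The cell of `n` in the logarithmic subdivision of `[1, R)` into `M` parts. -/
def cell (M : ℕ) (R : ℝ) (n : ℕ) : ℕ := ⌊M * Real.log n / Real.log R⌋₊

theorem cell_lt {M : ℕ} (hM : 0 < M) {R : ℝ} (hR : 1 < R) {n : ℕ} (hn0 : 0 < n) (hn : (n : ℝ) < R) :
    cell M R n < M := by
  have hM' : (0 : ℝ) < M := by exact_mod_cast hM
  rw [cell, Nat.floor_lt' hM.ne', div_lt_iff₀ (Real.log_pos hR)]
  exact mul_lt_mul_of_pos_left (Real.log_lt_log (by exact_mod_cast hn0) hn) hM'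

theorem log_lt_of_cell {M : ℕ} {R : ℝ} (hR : 1 < R) (n : ℕ) :
    M * Real.log n < (cell M R n + 1) * Real.log R := by
  have := Nat.lt_floor_add_one (M * Real.log n / Real.log R)
  rwa [div_lt_iff₀ (Real.log_pos hR)] at this

theorem lt_of_sum_cell_le {k M : ℕ} (hM : 0 < M) {R : ℝ} (hR : 1 < R) {v : Fin k → ℕ}
    (hv : ∀ i, 0 < v i) (h : ∑ i, (cell M R (v i) + 1) ≤ M) (i : Fin k) : (v i : ℝ) < R := by
  have hM' : (0 : ℝ) < M := by exact_mod_cast hM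
  have h1 : cell M R (v i) + 1 ≤ M :=
    (single_le_sum (f := fun i => cell M R (v i) + 1) (fun _ _ => Nat.zero_le _) (mem_univ i)).trans h
  have h2 : ((cell M R (v i) : ℝ) + 1) ≤ M := by exact_mod_cast h1
  have h3 := log_lt_of_cell (M := M) hR (v i)
  have h4 := mul_le_mul_of_nonneg_right h2 (Real.log_pos hR).le
  have h5 : Real.log (v i) < Real.log R := lt_of_mul_lt_mul_left (h3.trans_le h4) hM'.le
  exact (Real.log_lt_log_iff (by exact_mod_cast hv i) (by linarith)).1 h5

/-- Each `v i` is below `R ^ ((cell + 1) / M)`: the `+ 1` in the support condition pays for the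
rounding in `cell`. -/
theorem prod_le_of_sum_cell_le {k M : ℕ} (hM : 0 < M) {R : ℝ} (hR : 1 < R) {v : Fin k → ℕ}
    (hv : ∀ i, 0 < v i) (h : ∑ i, (cell M R (v i) + 1) ≤ M) : ∏ i, (v i : ℝ) ≤ R := by
  have hM' : (0 : ℝ) < M := by exact_mod_cast hM
  have hv' : ∀ i, (0 : ℝ) < v i := fun i => by exact_mod_cast hv i
  rw [← Real.log_le_log_iff (prod_pos fun i _ => hv' i) (by linarith),
    Real.log_prod fun i _ => (hv' i).ne']
  refine le_of_mul_le_mul_left ?_ hM'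
  rw [mul_sum]
  calc ∑ i, (M : ℝ) * Real.log (v i) ≤ ∑ i, ((cell M R (v i) : ℝ) + 1) * Real.log R :=
        sum_le_sum fun i _ => (log_lt_of_cell hR _).le
    _ = ((∑ i, (cell M R (v i) + 1) : ℕ) : ℝ) * Real.log R := by push_cast; rw [sum_mul]
    _ ≤ M * Real.log R := mul_le_mul_of_nonneg_right (by exact_mod_cast h) (Real.log_pos hR).le

/-- The mass of a cell. -/
def cellMass (T : Finset ℕ) (M : ℕ) (R : ℝ) (l : ℕ) : ℝ :=
  ∑ n ∈ sifted T R with cell M R n = l, 1 / (n : ℝ)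

theorem cellMass_eq {T : Finset ℕ} {M : ℕ} (hM : 0 < M) {R : ℝ} (hR : 1 < R) {l : ℕ} (hl : l < M) :
    cellMass T M R l = siftedSum T (R ^ (((l : ℝ) + 1) / M)) - siftedSum T (R ^ ((l : ℝ) / M)) := by
  have hM' : (0 : ℝ) < M := by exact_mod_cast hM
  have hR0 : 0 < R := by linarith
  have hlR := Real.log_pos hR
  have key : ∀ (n : ℕ) (y : ℝ), 0 < n → ((n : ℝ) < R ^ (y / M) ↔ M * Real.log n / Real.log R < y) := by
    intro n y hn
    have hn' : (0 : ℝ) < n := by exact_mod_cast hn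
    rw [← Real.log_lt_log_iff hn' (Real.rpow_pos_of_pos hR0 _), Real.log_rpow hR0,
      div_lt_iff₀ hlR, div_mul_eq_mul_div, lt_div_iff₀ hM', mul_comm (Real.log (n : ℝ))]
  have hle : R ^ ((l : ℝ) / M) ≤ R ^ (((l : ℝ) + 1) / M) :=
    Real.rpow_le_rpow_of_exponent_le hR.le (by gcongr; linarith)
  have hsub : sifted T (R ^ ((l : ℝ) / M)) ⊆ sifted T (R ^ (((l : ℝ) + 1) / M)) := fun n hn => by
    rw [mem_sifted] at hn ⊢
    exact ⟨hn.1.trans_le hle, hn.2⟩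
  have hset : (sifted T R).filter (fun n => cell M R n = l)
      = sifted T (R ^ (((l : ℝ) + 1) / M)) \ sifted T (R ^ ((l : ℝ) / M)) := by
    ext n
    simp only [mem_filter, mem_sdiff, mem_sifted]
    constructor
    · rintro ⟨⟨h1, h2, h3⟩, h4⟩
      have h0 : 0 ≤ M * Real.log n / Real.log R :=
        div_nonneg (mul_nonneg hM'.le (Real.log_natCast_nonneg n)) hlR.le
      rw [cell, Nat.floor_eq_iff h0] at h4
      refine ⟨⟨(key n _ h2).2 h4.2, h2, h3⟩, fun h => ?_⟩
      have := (key n _ h2).1 h.1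
      linarith [h4.1]
    · rintro ⟨⟨h1, h2, h3⟩, h4⟩
      have h0 : 0 ≤ M * Real.log n / Real.log R :=
        div_nonneg (mul_nonneg hM'.le (Real.log_natCast_nonneg n)) hlR.le
      refine ⟨⟨h1.trans_le ?_, h2, h3⟩, ?_⟩
      · calc R ^ (((l : ℝ) + 1) / M) ≤ R ^ (1 : ℝ) :=
              Real.rpow_le_rpow_of_exponent_le hR.le (by
                rw [div_le_one hM']; exact_mod_cast hl)
          _ = R := Real.rpow_one R
      · rw [cell, Nat.floor_eq_iff h0]
        refine ⟨?_, (key n _ h2).1 h1⟩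
        by_contra h
        exact h4 ⟨(key n _ h2).2 (not_le.1 h), h2, h3⟩
  rw [cellMass, hset, siftedSum, siftedSum, ← sum_sdiff hsub, add_sub_cancel_right]

/-- On the logarithmic scale all cells have the same length, hence the same main term; the `2 * η`
comes from the two endpoints. -/
theorem cellMass_bounds {T : Finset ℕ} {M : ℕ} (hM : 0 < M) {R : ℝ} (hR : 1 < R) {η : ℝ}
    (hS : ∀ x : ℝ, 1 ≤ x →
      |siftedSum T x - density T * Real.log x| ≤ η * density T * Real.log R) {l : ℕ} (hl : l < M) :
    density T * Real.log R * (1 / M - 2 * η) ≤ cellMass T M R l ∧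
      cellMass T M R l ≤ density T * Real.log R * (1 / M + 2 * η) := by
  have hM' : (0 : ℝ) < M := by exact_mod_cast hM
  have hR0 : 0 < R := by linarith
  have h1 := abs_le.1 (hS (R ^ (((l : ℝ) + 1) / M)) (Real.one_le_rpow hR.le (by positivity)))
  have h2 := abs_le.1 (hS (R ^ ((l : ℝ) / M)) (Real.one_le_rpow hR.le (by positivity)))
  rw [Real.log_rpow hR0] at h1 h2
  rw [cellMass_eq hM hR hl]
  have e : density T * ((((l : ℝ) + 1) / M) * Real.log R) - density T * (((l : ℝ) / M) * Real.log R)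
      = density T * Real.log R * (1 / M) := by ring
  constructor <;> nlinarith

theorem cellMass_nonneg (T : Finset ℕ) (M : ℕ) (R : ℝ) (l : ℕ) : 0 ≤ cellMass T M R l :=
  sum_nonneg fun _ _ => by positivity

theorem sum_cells {k : ℕ} {S : Finset ℕ} {M : ℕ} {R : ℝ} (hS : ∀ n ∈ S, cell M R n < M)
    (g : (Fin k → ℕ) → ℝ) (w : ℕ → ℝ) :
    ∑ v ∈ Fintype.piFinset (fun _ : Fin k => S), g (fun i => cell M R (v i)) * ∏ i, w (v i)
      = ∑ j ∈ grid (Fin k) M, g j * ∏ i, ∑ n ∈ S with cell M R n = j i, w n := by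
  rw [← sum_fiberwise_of_maps_to (s := Fintype.piFinset (fun _ : Fin k => S)) (t := grid (Fin k) M)
    (g := fun v i => cell M R (v i))]
  · refine sum_congr rfl fun j _ => ?_
    rw [prod_univ_sum, mul_sum]
    refine sum_congr ?_ fun v hv => ?_
    · ext v
      simp only [mem_filter, Fintype.mem_piFinset, funext_iff]
      exact ⟨fun h i => ⟨h.1 i, h.2 i⟩, fun h => ⟨fun i => (h i).1, fun i => (h i).2⟩⟩
    · rw [← show (fun i => cell M R (v i)) = j from
        funext fun i => (mem_filter.1 (Fintype.mem_piFinset.1 hv i)).2]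
  · intro v hv
    exact mem_grid.2 fun i => hS _ (Fintype.mem_piFinset.1 hv i)

end

end PrimeGaps

/-! ### The sieve weights: upper bound for the form, size and support -/

namespace PrimeGaps

open Finset

noncomputable section

/-- The step function evaluated at a tuple of integers. -/
def stepVal {k : ℕ} (Φ : (Fin k → ℕ) → ℝ) (M : ℕ) (R : ℝ) (v : Fin k → ℕ) : ℝ :=
  Φ fun i => cell M R (v i)

/-- The diagonal coefficients of the sieve. -/
def yCoeff {k : ℕ} (Φ : (Fin k → ℕ) → ℝ) (M : ℕ) {T : Finset ℕ} {R : ℝ}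
    (r : freePrimes T R → Option (Fin k)) : ℝ :=
  (∏ p, colWeight (-1) (r p)) * stepVal Φ M R (colorProd r)

/-- The sieve weights built from a step function. -/
def stepWeight {k : ℕ} (Φ : (Fin k → ℕ) → ℝ) (M : ℕ) {T : Finset ℕ} {R : ℝ} :
    (freePrimes T R → Option (Fin k)) → ℝ :=
  sieveWeight (fun p => (p.1 : ℝ)) (yCoeff Φ M)

theorem colWeight_neg_one_mul_self {κ : Type*} (o : Option κ) :
    colWeight (-1) o * colWeight (-1) o = 1 := by
  cases o <;> simp [colWeight]

theorem prod_colWeight_neg_one_sq {ι κ : Type*} [Fintype ι] (r : ι → Option κ) :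
    (∏ p, colWeight (-1) (r p)) ^ 2 = 1 := by
  rw [pow_two, ← prod_mul_distrib]
  exact prod_eq_one fun p _ => colWeight_neg_one_mul_self _

theorem colorProd_lt {k M : ℕ} (hM : 0 < M) {R : ℝ} (hR : 1 < R) {T : Finset ℕ}
    {Φ : (Fin k → ℕ) → ℝ} (hΦ : ∀ j, Φ j ≠ 0 → ∑ i, (j i + 1) ≤ M)
    {c : freePrimes T R → Option (Fin k)} (h : stepVal Φ M R (colorProd c) ≠ 0) (i : Fin k) :
    (colorProd c i : ℝ) < R :=
  lt_of_sum_cell_le hM hR (fun _ => setProd_pos _) (hΦ _ h) i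

/-- After diagonalisation all terms are nonnegative, so the sum over colourings may be enlarged to
one over all tuples of sifted integers. That sum factors over cells. -/
theorem stepForm_le {k M : ℕ} (hM : 0 < M) {R : ℝ} (hR : 1 < R) {T : Finset ℕ}
    (hT : ∀ p ∈ T, p.Prime) {Φ : (Fin k → ℕ) → ℝ}
    (hΦ : ∀ j, Φ j ≠ 0 → ∑ i, (j i + 1) ≤ M) {η : ℝ}
    (hS : ∀ x : ℝ, 1 ≤ x →
      |siftedSum T x - density T * Real.log x| ≤ η * density T * Real.log R)
    (h2 : ∀ p : freePrimes T R, (2 : ℝ) < p.1) (hk : ∀ p : freePrimes T R, (k : ℝ) ≤ p.1) :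
    ∑ d, ∑ e, stepWeight Φ M d * stepWeight Φ M e *
        ∏ p : freePrimes T R, kern (1 / (p.1 : ℝ)) (d p) (e p)
      ≤ (∏ p : freePrimes T R, (1 + 1 / ((p.1 : ℝ) * ((p.1 : ℝ) - 2)))) *
        ((density T * Real.log R * (1 / M + 2 * η)) ^ k * ∑ j ∈ grid (Fin k) M, Φ j ^ 2) := by
  classical
  refine (sieveForm_le (fun p : freePrimes T R => (p.1 : ℝ)) h2 (by simpa using hk)
    (yCoeff Φ M)).trans (mul_le_mul_of_nonneg_left ?_ (prod_nonneg fun p _ => ?_))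
  swap
  · have := h2 p
    have : 0 ≤ 1 / ((p.1 : ℝ) * ((p.1 : ℝ) - 2)) :=
      one_div_nonneg.2 (mul_nonneg (by linarith) (by linarith))
    linarith
  have e1 : ∀ r : freePrimes T R → Option (Fin k),
      yCoeff Φ M r ^ 2 * ∏ p, colWeight (1 / (p.1 : ℝ)) (r p)
        = stepVal Φ M R (colorProd r) ^ 2 * ∏ i, 1 / (colorProd r i : ℝ) := by
    intro r
    rw [yCoeff, mul_pow, prod_colWeight_neg_one_sq, one_mul, prod_colWeight_one_div]
  have e2 : ∑ r : freePrimes T R → Option (Fin k),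
        stepVal Φ M R (colorProd r) ^ 2 * ∏ i, 1 / (colorProd r i : ℝ)
      = ∑ r : freePrimes T R → Option (Fin k) with stepVal Φ M R (colorProd r) ≠ 0,
        stepVal Φ M R (colorProd r) ^ 2 * ∏ i, 1 / (colorProd r i : ℝ) := by
    refine (sum_filter_of_ne (p := fun r => stepVal Φ M R (colorProd r) ≠ 0)
      fun r _ h h' => h ?_).symm
    rw [h']; ring
  simp_rw [e1]
  rw [e2]
  calc _ ≤ ∑ v ∈ Fintype.piFinset (fun _ : Fin k => sifted T R),
          stepVal Φ M R v ^ 2 * ∏ i, 1 / (v i : ℝ) := by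
        refine sum_le_sum_of_injection colorProd (fun c hc => ?_)
          (fun c _ c' _ h => colorProd_injective h) (fun _ _ => le_rfl) fun v _ => by positivity
        exact Fintype.mem_piFinset.2 fun i =>
          setProd_mem_sifted hT (colorProd_lt hM hR hΦ (mem_filter.1 hc).2 i)
    _ = ∑ j ∈ grid (Fin k) M, Φ j ^ 2 * ∏ i, cellMass T M R (j i) :=
        sum_cells (fun n hn => cell_lt hM hR (mem_sifted.1 hn).2.1 (mem_sifted.1 hn).1)
          (fun j => Φ j ^ 2) (fun n => 1 / (n : ℝ))
    _ ≤ ∑ j ∈ grid (Fin k) M, Φ j ^ 2 * (density T * Real.log R * (1 / M + 2 * η)) ^ k := by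
        refine sum_le_sum fun j hj => mul_le_mul_of_nonneg_left ?_ (sq_nonneg _)
        rw [mem_grid] at hj
        calc _ ≤ ∏ _i : Fin k, density T * Real.log R * (1 / M + 2 * η) :=
              prod_le_prod (fun i _ => cellMass_nonneg _ _ _ _)
                fun i _ => (cellMass_bounds hM hR hS (hj i)).2
          _ = _ := by simp
    _ = _ := by rw [← sum_mul, mul_comm]

/-! ### Bounds for the weights -/

theorem sum_setProd_le {T : Finset ℕ} (hT : ∀ p ∈ T, p.Prime) (R : ℝ) :
    ∑ A : Finset (freePrimes T R) with (setProd A : ℝ) < R, ∏ p ∈ A, 1 / (p.1 : ℝ)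
      ≤ siftedSum T R := by
  refine sum_le_sum_of_injection setProd (fun A hA => setProd_mem_sifted hT (mem_filter.1 hA).2)
    (fun A _ B _ h => setProd_injective h) (fun A _ => (prod_one_div A).le) fun n _ => by positivity

/-- Expand the product of `1 / (p - 1) = 1 / p + 1 / (p (p - 1))`. With `E` the set of primes taking
the second term, `(A, E) ↦ (A \ E, E)` is injective and lands in a product of independent sums. -/
theorem sum_setProd_totient_le {T : Finset ℕ} (hT : ∀ p ∈ T, p.Prime) (R : ℝ) :
    ∑ A : Finset (freePrimes T R) with (setProd A : ℝ) < R, ∏ p ∈ A, 1 / ((p.1 : ℝ) - 1)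
      ≤ siftedSum T R * ∏ p : freePrimes T R, (1 + 1 / ((p.1 : ℝ) * ((p.1 : ℝ) - 1))) := by
  classical
  have hp1 : ∀ p : freePrimes T R, (0 : ℝ) < (p.1 : ℝ) - 1 := fun p => by
    have : (1 : ℝ) < p.1 := by exact_mod_cast (prime_of_freePrimes p).one_lt
    linarith
  have e1 : ∀ A : Finset (freePrimes T R), ∏ p ∈ A, 1 / ((p.1 : ℝ) - 1)
      = ∑ E ∈ A.powerset, (∏ p ∈ A \ E, 1 / (p.1 : ℝ)) *
          ∏ p ∈ E, 1 / ((p.1 : ℝ) * ((p.1 : ℝ) - 1)) := by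
    intro A
    have : ∀ p ∈ A, 1 / ((p.1 : ℝ) - 1) = 1 / ((p.1 : ℝ) * ((p.1 : ℝ) - 1)) + 1 / (p.1 : ℝ) := by
      intro p _
      have := (hp1 p).ne'
      have := (cast_pos_of_freePrimes p).ne'
      field_simp
      ring
    rw [prod_congr rfl this, prod_add]
    exact sum_congr rfl fun E _ => mul_comm _ _
  simp_rw [e1]
  rw [sum_sigma', prod_one_add]
  refine le_trans ?_ (mul_le_mul_of_nonneg_right (sum_setProd_le hT R)
    (sum_nonneg fun E _ => prod_nonneg fun p _ =>
      one_div_nonneg.2 (mul_nonneg (cast_pos_of_freePrimes p).le (hp1 p).le)))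
  rw [sum_mul_sum, ← sum_product']
  refine sum_le_sum_of_injection (fun x => (x.1 \ x.2, x.2)) ?_ ?_ (fun _ _ => le_rfl) ?_
  · rintro ⟨A, E⟩ h
    rw [mem_sigma, mem_filter, mem_powerset] at h
    refine mem_product.2 ⟨mem_filter.2 ⟨mem_univ _, lt_of_le_of_lt ?_ h.1.2⟩,
      mem_powerset.2 (subset_univ _)⟩
    exact_mod_cast Nat.le_of_dvd (setProd_pos _) (prod_dvd_prod_of_subset _ _ _ sdiff_subset)
  · rintro ⟨A, E⟩ h ⟨A', E'⟩ h' heq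
    rw [mem_sigma, mem_filter, mem_powerset] at h h'
    simp only [Prod.mk.injEq] at heq
    obtain ⟨h1, rfl⟩ := heq
    have : A = A' := by
      have hE : E ⊆ A := h.2
      have hE' : E ⊆ A' := h'.2
      rw [← sdiff_union_of_subset hE, h1, sdiff_union_of_subset hE']
    rw [this]
  · rintro ⟨A, E⟩ _
    exact mul_nonneg (prod_nonneg fun p _ => one_div_nonneg.2 (cast_pos_of_freePrimes p).le)
      (prod_nonneg fun p _ => one_div_nonneg.2
        (mul_nonneg (cast_pos_of_freePrimes p).le (hp1 p).le))

/-- The part of a colouring `r` off the support of `d`. -/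
def offPart {ι κ : Type*} (d r : ι → Option κ) (p : ι) : Option κ :=
  match d p with
  | none => r p
  | some _ => none

theorem eq_some_of_basisCoeff_ne_zero {κ : Type*} [DecidableEq κ] {q : ℝ} {r d : Option κ}
    (h : basisCoeff q r d ≠ 0) {i : κ} (hd : d = some i) : r = some i := by
  subst hd
  cases r with
  | none => simp [basisCoeff] at h
  | some j =>
    simp only [basisCoeff] at h
    by_contra h'
    rw [if_neg (fun hij => h' (by rw [hij]))] at h
    exact h rfl

theorem colorClass_subset_of_basisCoeff {T : Finset ℕ} {R : ℝ} {k : ℕ} {q : freePrimes T R → ℝ}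
    {r d : freePrimes T R → Option (Fin k)} (h : ∏ p, basisCoeff (q p) (r p) (d p) ≠ 0) (i : Fin k) :
    colorClass d i ⊆ colorClass r i := fun p hp => by
  rw [mem_colorClass] at hp ⊢
  exact eq_some_of_basisCoeff_ne_zero (prod_ne_zero_iff.1 h p (mem_univ p)) hp

/-- Only colourings `r` extending `d` enter the weight at `d`, so the support condition on `r`
passes to `d`. -/
theorem prod_colorProd_le_of_stepWeight_ne_zero {k M : ℕ} (hM : 0 < M) {R : ℝ} (hR : 1 < R)
    {T : Finset ℕ} {Φ : (Fin k → ℕ) → ℝ} (hΦ : ∀ j, Φ j ≠ 0 → ∑ i, (j i + 1) ≤ M)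
    {d : freePrimes T R → Option (Fin k)} (h : stepWeight Φ M d ≠ 0) :
    ∏ i, (colorProd d i : ℝ) ≤ R := by
  obtain ⟨r, -, hr⟩ := exists_ne_zero_of_sum_ne_zero h
  have hy := left_ne_zero_of_mul hr
  have hb := right_ne_zero_of_mul hr
  refine le_trans (prod_le_prod (fun i _ => Nat.cast_nonneg _) fun i _ => ?_)
    (prod_le_of_sum_cell_le hM hR (fun i => setProd_pos _) (hΦ _ (right_ne_zero_of_mul hy)))
  exact_mod_cast Nat.le_of_dvd (setProd_pos _)
    (prod_dvd_prod_of_subset _ _ _ (colorClass_subset_of_basisCoeff hb i))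

/-- For fixed `d`, an extension `r` is determined by its part off the support of `d`, and its
coefficient has absolute value the product of `1 / (p - 1)` over that part. Summing over the `k`
colour classes independently gives a `k`-th power. -/
theorem abs_stepWeight_le {k M : ℕ} (hM : 0 < M) {R : ℝ} (hR : 1 < R) {T : Finset ℕ}
    (hT : ∀ p ∈ T, p.Prime) {Φ : (Fin k → ℕ) → ℝ}
    (hΦ : ∀ j, Φ j ≠ 0 → ∑ i, (j i + 1) ≤ M) {B : ℝ} (hB : ∀ j, |Φ j| ≤ B)
    (d : freePrimes T R → Option (Fin k)) :
    |stepWeight Φ M d| ≤ B * (siftedSum T R *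
      ∏ p : freePrimes T R, (1 + 1 / ((p.1 : ℝ) * ((p.1 : ℝ) - 1)))) ^ k := by
  classical
  have hB0 : 0 ≤ B := (abs_nonneg _).trans (hB 0)
  have hp1 : ∀ p : freePrimes T R, (0 : ℝ) < (p.1 : ℝ) - 1 := fun p => by
    have : (1 : ℝ) < p.1 := by exact_mod_cast (prime_of_freePrimes p).one_lt
    linarith
  set G := ∑ A : Finset (freePrimes T R) with (setProd A : ℝ) < R, ∏ p ∈ A, 1 / ((p.1 : ℝ) - 1)
    with hG
  have hG0 : 0 ≤ G := sum_nonneg fun A _ => prod_nonneg fun p _ => one_div_nonneg.2 (hp1 p).le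
  refine le_trans ?_ (mul_le_mul_of_nonneg_left
    (pow_le_pow_left₀ hG0 (sum_setProd_totient_le hT R) k) hB0)
  have hGk : G ^ k = ∑ A ∈ Fintype.piFinset (fun _ : Fin k =>
      univ.filter fun A : Finset (freePrimes T R) => (setProd A : ℝ) < R),
      ∏ i, ∏ p ∈ A i, 1 / ((p.1 : ℝ) - 1) := by
    rw [← prod_univ_sum (fun _ : Fin k =>
      univ.filter fun A : Finset (freePrimes T R) => (setProd A : ℝ) < R)
      fun _ A => ∏ p ∈ A, 1 / ((p.1 : ℝ) - 1)]
    simp [hG]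
  rw [hGk, mul_sum, stepWeight, sieveWeight]
  refine (abs_sum_le_sum_abs _ _).trans ?_
  rw [← sum_filter_of_ne (p := fun r => yCoeff Φ M r *
    ∏ p, basisCoeff (1 / ((p.1 : ℝ) - 1)) (r p) (d p) ≠ 0) fun r _ h => abs_ne_zero.1 h]
  refine sum_le_sum_of_injection (fun r => colorClass (offPart d r)) ?_ ?_ ?_ ?_
  · intro r hr
    have h0 := (mem_filter.1 hr).2
    have hy := right_ne_zero_of_mul (left_ne_zero_of_mul h0)
    refine Fintype.mem_piFinset.2 fun i => mem_filter.2 ⟨mem_univ _, lt_of_le_of_lt ?_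
      (colorProd_lt hM hR hΦ hy i)⟩
    have hsub : colorClass (offPart d r) i ⊆ colorClass r i := ?_
    · exact Nat.cast_le.2 (Nat.le_of_dvd (setProd_pos _) (prod_dvd_prod_of_subset _ _ _ hsub))
    intro p hp
    rw [mem_colorClass] at hp ⊢
    unfold offPart at hp
    split at hp
    · exact hp
    · simp at hp
  · intro r hr r' hr' heq
    have h0 := right_ne_zero_of_mul (mem_filter.1 hr).2
    have h0' := right_ne_zero_of_mul (mem_filter.1 hr').2
    funext p
    have h1 := congrFun (colorClass_injective heq) p
    unfold offPart at h1
    cases hd : d p with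
    | none => simpa [hd] using h1
    | some i =>
      rw [eq_some_of_basisCoeff_ne_zero (prod_ne_zero_iff.1 h0 p (mem_univ p)) hd,
        eq_some_of_basisCoeff_ne_zero (prod_ne_zero_iff.1 h0' p (mem_univ p)) hd]
  · intro r _
    rw [abs_mul, ← prod_colWeight, yCoeff, abs_mul, abs_prod, abs_prod]
    have h1 : ∏ p, |colWeight (-1) (r p)| = 1 :=
      prod_eq_one fun p _ => by cases r p <;> simp [colWeight]
    rw [h1, one_mul]
    refine mul_le_mul (hB _) (prod_le_prod (fun _ _ => abs_nonneg _) fun p _ => ?_)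
      (prod_nonneg fun _ _ => abs_nonneg _) hB0
    have h3 : (0 : ℝ) ≤ 1 / ((p.1 : ℝ) - 1) := one_div_nonneg.2 (hp1 p).le
    unfold offPart
    cases d p with
    | none => cases r p <;> simp [basisCoeff, colWeight, abs_of_pos (hp1 p)]
    | some i =>
      cases r p with
      | none => simp [basisCoeff, colWeight]
      | some j => simp only [basisCoeff, colWeight]; split_ifs <;> simp
  · intro A _
    exact mul_nonneg hB0 (prod_nonneg fun i _ => prod_nonneg fun p _ => one_div_nonneg.2 (hp1 p).le)

end

end PrimeGaps

/-! ### Tuples that fail to be squarefree and pairwise coprime -/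

namespace PrimeGaps

open Finset

noncomputable section

theorem one_sub_sum_le_prod {α : Type*} (s : Finset α) (f : α → ℝ) (h0 : ∀ a ∈ s, 0 ≤ f a)
    (h1 : ∀ a ∈ s, f a ≤ 1) : 1 - ∑ a ∈ s, f a ≤ ∏ a ∈ s, (1 - f a) := by
  classical
  induction s using Finset.induction_on with
  | empty => simp
  | insert a s ha ih =>
    rw [sum_insert ha, prod_insert ha]
    have i1 := ih (fun b hb => h0 b (mem_insert_of_mem hb)) fun b hb => h1 b (mem_insert_of_mem hb)
    have i2 := h0 a (mem_insert_self _ _)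
    have i3 := h1 a (mem_insert_self _ _)
    have i4 : 0 ≤ ∑ b ∈ s, f b := sum_nonneg fun b hb => h0 b (mem_insert_of_mem hb)
    nlinarith [mul_nonneg i2 i4, mul_le_mul_of_nonneg_left i1 (sub_nonneg.2 i3)]

/-- The absolute value of the diagonalising coefficients. -/
def crossAbs {κ : Type*} [DecidableEq κ] (m : κ) (q : ℝ) : Option κ → Option κ → ℝ
  | none, none => 1
  | none, some _ => 0
  | some i, none => if i = m then q else 0
  | some i, some j => if i = j ∧ i ≠ m then 1 else 0

/-- The reason for the signs in `yCoeff`: they make the coefficients nonnegative up to a sign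
depending only on `c`, and squaring removes that sign. -/
theorem colWeight_mul_crossCoeff {κ : Type*} [DecidableEq κ] (m : κ) (q : ℝ) (r c : Option κ) :
    colWeight (-1) r * crossCoeff m q r c = colWeight (-1) c * crossAbs m q r c := by
  cases r <;> cases c <;> simp [colWeight, crossCoeff, crossAbs]

theorem crossAbs_nonneg {κ : Type*} [DecidableEq κ] (m : κ) {q : ℝ} (hq : 0 ≤ q) (r c : Option κ) :
    0 ≤ crossAbs m q r c := by
  cases r <;> cases c <;> simp only [crossAbs] <;> (try split_ifs) <;> simp [hq]

section Mass

variable {T : Finset ℕ} {R : ℝ} {k : ℕ}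

theorem sum_sifted_dvd_le (T : Finset ℕ) (R : ℝ) {d : ℕ} (hd : 0 < d) :
    ∑ n ∈ sifted T R, (if d ∣ n then 1 / (n : ℝ) else 0) ≤ siftedSum T R * (1 / d) := by
  rw [← sum_filter, siftedSum, sum_mul]
  refine sum_le_sum_of_injection (fun n => n / d) ?_ ?_ ?_ fun n _ => by positivity
  · intro n hn
    obtain ⟨h1, m, rfl⟩ := mem_filter.1 hn
    obtain ⟨h2, h3, h4⟩ := mem_sifted.1 h1
    rw [Nat.mul_div_cancel_left _ hd]
    refine mem_sifted.2 ⟨lt_of_le_of_lt ?_ h2, Nat.pos_of_mul_pos_left h3, fun p hp h =>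
      h4 p hp (h.mul_left _)⟩
    exact_mod_cast Nat.le_mul_of_pos_left m hd
  · intro n hn n' hn' h
    obtain ⟨-, m, rfl⟩ := mem_filter.1 hn
    obtain ⟨-, m', rfl⟩ := mem_filter.1 hn'
    simp only [Nat.mul_div_cancel_left _ hd] at h
    rw [h]
  · intro n hn
    obtain ⟨-, m, rfl⟩ := mem_filter.1 hn
    rw [Nat.mul_div_cancel_left _ hd]
    push_cast
    rw [div_mul_div_comm, mul_one, mul_comm]

theorem sum_tuples_dvd_le (T : Finset ℕ) (R : ℝ) (a : Fin k → ℕ) (ha : ∀ i, 0 < a i) :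
    ∑ v ∈ Fintype.piFinset (fun _ : Fin k => sifted T R),
        (∏ i, 1 / (v i : ℝ)) * (if ∀ i, a i ∣ v i then 1 else 0)
      ≤ siftedSum T R ^ k * ∏ i, 1 / (a i : ℝ) := by
  have h1 : ∀ v : Fin k → ℕ, (∏ i, 1 / (v i : ℝ)) * (if ∀ i, a i ∣ v i then 1 else 0)
      = ∏ i, (if a i ∣ v i then 1 / (v i : ℝ) else 0) := by
    intro v
    split_ifs with h
    · rw [mul_one]
      exact prod_congr rfl fun i _ => by rw [if_pos (h i)]
    · push Not at h
      obtain ⟨i, hi⟩ := h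
      rw [mul_zero, prod_eq_zero (mem_univ i) (if_neg hi)]
  simp_rw [h1]
  rw [← prod_univ_sum (fun _ : Fin k => sifted T R)
    fun i n => if a i ∣ n then 1 / (n : ℝ) else 0]
  refine (prod_le_prod (fun i _ => sum_nonneg fun n _ => by positivity)
    fun i _ => sum_sifted_dvd_le T R (ha i)).trans (le_of_eq ?_)
  rw [prod_mul_distrib]
  simp

theorem sum_tuples_dvd_one_le (T : Finset ℕ) (R : ℝ) (i : Fin k) {d : ℕ} (hd : 0 < d) :
    ∑ v ∈ Fintype.piFinset (fun _ : Fin k => sifted T R),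
        (∏ i, 1 / (v i : ℝ)) * (if d ∣ v i then 1 else 0)
      ≤ siftedSum T R ^ k * (1 / d) := by
  have h := sum_tuples_dvd_le T R (Function.update (fun _ => 1) i d) fun j => by
    by_cases hj : j = i <;> simp [hj, hd]
  refine le_trans (le_of_eq (sum_congr rfl fun v _ => ?_)) (h.trans (le_of_eq ?_))
  · congr 2
    refine propext ⟨fun h j => ?_, fun h => by simpa using h i⟩
    by_cases hj : j = i
    · subst hj; simpa using h
    · simp [hj]
  · congr 1
    rw [prod_eq_single i]
    · simp
    · intro j _ hj; simp [hj]
    · simp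

theorem sum_tuples_dvd_two_le (T : Finset ℕ) (R : ℝ) {i j : Fin k} (hij : j ≠ i) {d : ℕ}
    (hd : 0 < d) :
    ∑ v ∈ Fintype.piFinset (fun _ : Fin k => sifted T R),
        (∏ i, 1 / (v i : ℝ)) * (if d ∣ v i ∧ d ∣ v j then 1 else 0)
      ≤ siftedSum T R ^ k * (1 / (d * d)) := by
  have h := sum_tuples_dvd_le T R (fun l => if l = i ∨ l = j then d else 1) fun l => by
    split_ifs <;> simp [hd]
  refine le_trans (le_of_eq (sum_congr rfl fun v _ => ?_)) (h.trans (le_of_eq ?_))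
  · congr 2
    refine propext ⟨fun h l => ?_, fun h => ⟨by simpa using h i, by simpa using h j⟩⟩
    split_ifs with hl
    · rcases hl with rfl | rfl
      · exact h.1
      · exact h.2
    · exact one_dvd _
  · congr 1
    rw [← prod_subset (subset_univ {i, j}), prod_pair hij.symm]
    · simp
    · intro l _ hl
      simp only [mem_insert, mem_singleton] at hl
      simp [hl]

/-- The failure of a tuple to be squarefree and pairwise coprime, together with the loss in the
weights, measured additively over primes. -/
def badness (T : Finset ℕ) (R : ℝ) (v : Fin k → ℕ) : ℝ :=
  ∑ p : freePrimes T R, ∑ i, ((k : ℝ) / ((p.1 : ℝ) - 1) * (if p.1 ∣ v i then 1 else 0) +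
    (if p.1 * p.1 ∣ v i then 1 else 0) +
    ∑ j with j ≠ i, (if p.1 ∣ v i ∧ p.1 ∣ v j then 1 else 0))

/-- The sum of `1 / (p (p - 1))` over the free primes. -/
def tailSum (T : Finset ℕ) (R : ℝ) : ℝ :=
  ∑ p : freePrimes T R, 1 / ((p.1 : ℝ) * ((p.1 : ℝ) - 1))

theorem freePrimes_sub_one_pos (p : freePrimes T R) : (0 : ℝ) < (p.1 : ℝ) - 1 := by
  have : (1 : ℝ) < p.1 := by exact_mod_cast (prime_of_freePrimes p).one_lt
  linarith

/-- Divisibility of one coordinate by `p` costs a factor `1 / p`, and is multiplied by `k / (p -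
1)`. Divisibility by `p ^ 2`, or of two coordinates by `p`, costs `1 / p ^ 2`. Each of the three
kinds thus totals at most `k ^ 2 * tailSum`. -/
theorem sum_badness_le (T : Finset ℕ) (R : ℝ) :
    ∑ v ∈ Fintype.piFinset (fun _ : Fin k => sifted T R),
        (∏ i, 1 / (v i : ℝ)) * badness T R v
      ≤ 3 * k ^ 2 * tailSum T R * siftedSum T R ^ k := by
  set H := siftedSum T R with hH
  have hH0 : 0 ≤ H ^ k := pow_nonneg (siftedSum_nonneg T R) k
  have e1 : ∑ v ∈ Fintype.piFinset (fun _ : Fin k => sifted T R),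
        (∏ i, 1 / (v i : ℝ)) * badness T R v
      = ∑ p : freePrimes T R, ∑ i : Fin k,
        ((k : ℝ) / ((p.1 : ℝ) - 1) * (∑ v ∈ Fintype.piFinset (fun _ : Fin k => sifted T R),
          (∏ i, 1 / (v i : ℝ)) * (if p.1 ∣ v i then 1 else 0)) +
        (∑ v ∈ Fintype.piFinset (fun _ : Fin k => sifted T R),
          (∏ i, 1 / (v i : ℝ)) * (if p.1 * p.1 ∣ v i then 1 else 0)) +
        ∑ j with j ≠ i, ∑ v ∈ Fintype.piFinset (fun _ : Fin k => sifted T R),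
          (∏ i, 1 / (v i : ℝ)) * (if p.1 ∣ v i ∧ p.1 ∣ v j then 1 else 0)) := by
    simp_rw [badness, mul_sum]
    rw [sum_comm]
    refine sum_congr rfl fun p _ => ?_
    rw [sum_comm]
    refine sum_congr rfl fun i _ => ?_
    rw [sum_comm' (t' := Fintype.piFinset (fun _ : Fin k => sifted T R))
      (s' := fun _ => univ.filter fun j => j ≠ i) (by simp)]
    rw [← sum_add_distrib, ← sum_add_distrib]
    refine sum_congr rfl fun v _ => ?_
    rw [mul_add, mul_add, mul_sum]
    ring
  rw [e1]
  have e2 : 3 * (k : ℝ) ^ 2 * tailSum T R * H ^ k = ∑ p : freePrimes T R, ∑ i : Fin k,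
      (3 * k * (1 / ((p.1 : ℝ) * ((p.1 : ℝ) - 1))) * H ^ k) := by
    simp_rw [sum_const, card_univ, Fintype.card_fin, nsmul_eq_mul, tailSum, mul_sum, sum_mul]
    exact sum_congr rfl fun p _ => by ring
  rw [e2]
  refine sum_le_sum fun p _ => sum_le_sum fun i _ => ?_
  have hp := cast_pos_of_freePrimes p
  have hp1 := freePrimes_sub_one_pos p
  have hpp := (prime_of_freePrimes p).pos
  have hk1 : (1 : ℝ) ≤ k := by exact_mod_cast Nat.one_le_of_lt i.2
  set s := 1 / ((p.1 : ℝ) * ((p.1 : ℝ) - 1)) with hs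
  have hs2 : 1 / ((p.1 : ℝ) * p.1) ≤ s := by
    rw [hs]
    exact one_div_le_one_div_of_le (mul_pos hp hp1) (mul_le_mul_of_nonneg_left (by linarith) hp.le)
  have hs0 : 0 ≤ s := by positivity
  have b1 : (k : ℝ) / ((p.1 : ℝ) - 1) * (∑ v ∈ Fintype.piFinset (fun _ : Fin k => sifted T R),
          (∏ i, 1 / (v i : ℝ)) * (if p.1 ∣ v i then 1 else 0)) ≤ k * s * H ^ k := by
    refine (mul_le_mul_of_nonneg_left (sum_tuples_dvd_one_le T R i hpp)
      (div_nonneg (Nat.cast_nonneg k) hp1.le)).trans (le_of_eq ?_)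
    rw [hs]
    field_simp
    rw [hH]
  have b2 : (∑ v ∈ Fintype.piFinset (fun _ : Fin k => sifted T R),
          (∏ i, 1 / (v i : ℝ)) * (if p.1 * p.1 ∣ v i then 1 else 0)) ≤ k * s * H ^ k := by
    refine (sum_tuples_dvd_one_le T R i (Nat.mul_pos hpp hpp)).trans ?_
    push_cast
    rw [← hH, mul_comm]
    refine mul_le_mul_of_nonneg_right (hs2.trans ?_) hH0
    nlinarith
  have b3 : ∑ j with j ≠ i, ∑ v ∈ Fintype.piFinset (fun _ : Fin k => sifted T R),
          (∏ i, 1 / (v i : ℝ)) * (if p.1 ∣ v i ∧ p.1 ∣ v j then 1 else 0) ≤ k * s * H ^ k := by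
    calc _ ≤ ∑ j : Fin k with j ≠ i, s * H ^ k := by
          refine sum_le_sum fun j hj => (sum_tuples_dvd_two_le T R (mem_filter.1 hj).2 hpp).trans ?_
          rw [← hH, mul_comm]
          exact mul_le_mul_of_nonneg_right hs2 hH0
      _ ≤ ∑ j : Fin k, s * H ^ k :=
          sum_le_sum_of_subset_of_nonneg (filter_subset _ _) fun _ _ _ => mul_nonneg hs0 hH0
      _ = _ := by rw [sum_const, card_univ, Fintype.card_fin, nsmul_eq_mul]; ring
  linarith

theorem badness_nonneg (v : Fin k → ℕ) : 0 ≤ badness T R v := by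
  refine sum_nonneg fun p _ => sum_nonneg fun i _ => add_nonneg (add_nonneg (mul_nonneg
    (div_nonneg (Nat.cast_nonneg k) (freePrimes_sub_one_pos p).le) ?_) ?_)
    (sum_nonneg fun j _ => ?_)
  all_goals split_ifs <;> norm_num

/-- No free prime divides the product of the tuple twice. -/
def IsGood (T : Finset ℕ) (R : ℝ) (v : Fin k → ℕ) : Prop :=
  ∀ p : freePrimes T R, ∀ i, ¬ p.1 * p.1 ∣ v i ∧ ∀ j, j ≠ i → ¬ (p.1 ∣ v i ∧ p.1 ∣ v j)

theorem one_le_badness {v : Fin k → ℕ} (h : ¬ IsGood T R v) : 1 ≤ badness T R v := by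
  unfold IsGood at h
  push Not at h
  obtain ⟨p, i, h⟩ := h
  have hpos : ∀ (p : freePrimes T R) (i : Fin k),
      0 ≤ (k : ℝ) / ((p.1 : ℝ) - 1) * (if p.1 ∣ v i then 1 else 0) := fun p i =>
    mul_nonneg (div_nonneg (Nat.cast_nonneg k) (freePrimes_sub_one_pos p).le)
      (by split_ifs <;> norm_num)
  have hterm : ∀ (p : freePrimes T R) (i : Fin k),
      0 ≤ (k : ℝ) / ((p.1 : ℝ) - 1) * (if p.1 ∣ v i then 1 else 0) +
      (if p.1 * p.1 ∣ v i then 1 else 0) +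
      ∑ j with j ≠ i, (if p.1 ∣ v i ∧ p.1 ∣ v j then (1 : ℝ) else 0) := fun p i =>
    add_nonneg (add_nonneg (hpos p i) (by split_ifs <;> norm_num))
      (sum_nonneg fun j _ => by split_ifs <;> norm_num)
  refine le_trans ?_ (single_le_sum (fun p _ => sum_nonneg fun i _ => hterm p i) (mem_univ p))
  refine le_trans ?_ (single_le_sum (fun i _ => hterm p i) (mem_univ i))
  by_cases h1 : p.1 * p.1 ∣ v i
  · rw [if_pos h1]
    have := hpos p i
    have : 0 ≤ ∑ j with j ≠ i, (if p.1 ∣ v i ∧ p.1 ∣ v j then (1 : ℝ) else 0) :=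
      sum_nonneg fun j _ => by split_ifs <;> norm_num
    linarith
  · obtain ⟨j, hj, h2⟩ := h h1
    have h3 : (1 : ℝ) ≤ ∑ j with j ≠ i, (if p.1 ∣ v i ∧ p.1 ∣ v j then (1 : ℝ) else 0) := by
      refine le_trans ?_ (single_le_sum (f := fun j => if p.1 ∣ v i ∧ p.1 ∣ v j then (1 : ℝ) else 0)
        (fun j _ => by split_ifs <;> norm_num) (mem_filter.2 ⟨mem_univ j, hj⟩))
      rw [if_pos h2]
    have := hpos p i
    have : (0 : ℝ) ≤ if p.1 * p.1 ∣ v i then 1 else 0 := by split_ifs; norm_num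
    linarith

/-- The colouring attached to a tuple of integers. -/
def colorOf (T : Finset ℕ) (R : ℝ) (v : Fin k → ℕ) (p : freePrimes T R) : Option (Fin k) :=
  if h : ∃ i, p.1 ∣ v i then some h.choose else none

theorem colorOf_eq_none_iff {v : Fin k → ℕ} {p : freePrimes T R} :
    colorOf T R v p = none ↔ ∀ i, ¬ p.1 ∣ v i := by
  unfold colorOf
  split_ifs with h
  · simpa using h
  · push Not at h
    simpa using h

theorem colorOf_eq_some_iff {v : Fin k → ℕ} (hv : IsGood T R v) {p : freePrimes T R} {i : Fin k} :
    colorOf T R v p = some i ↔ p.1 ∣ v i := by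
  unfold colorOf
  split_ifs with h
  · rw [Option.some_inj]
    constructor
    · rintro rfl
      exact h.choose_spec
    · intro h1
      by_contra h2
      exact (hv p i).2 _ h2 ⟨h1, h.choose_spec⟩
  · push Not at h
    simp [h i]

theorem colorProd_colorOf (hT : ∀ p ∈ T, p.Prime) {v : Fin k → ℕ} (hv : IsGood T R v)
    (hvS : ∀ i, v i ∈ sifted T R) : colorProd (colorOf T R v) = v := by
  funext i
  have hsq : Squarefree (v i) := by
    rw [Nat.squarefree_iff_prime_squarefree]
    intro q hq hqv
    exact (hv ⟨q, mem_freePrimes_of_dvd hT (hvS i) hq ((dvd_mul_right _ _).trans hqv)⟩ i).1 hqv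
  rw [colorProd, colorClass]
  simp_rw [colorOf_eq_some_iff hv]
  exact setProd_filter_dvd hT (hvS i) hsq

/-- Weierstrass' product inequality: a coloured prime divides some coordinate, so its loss `k / (p -
1)` is counted in `badness`. -/
theorem one_sub_badness_le {v : Fin k → ℕ} (hk : ∀ p : freePrimes T R, (k : ℝ) + 1 ≤ p.1) :
    1 - badness T R v ≤ ∏ p : freePrimes T R,
      (1 - (if colorOf T R v p = none then 0 else (k : ℝ) / ((p.1 : ℝ) - 1))) := by
  refine le_trans (sub_le_sub_left ?_ _) (one_sub_sum_le_prod univ _ ?_ ?_)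
  · refine sum_le_sum fun p _ => ?_
    have h0 : 0 ≤ (k : ℝ) / ((p.1 : ℝ) - 1) :=
      div_nonneg (Nat.cast_nonneg k) (freePrimes_sub_one_pos p).le
    have hterm : ∀ i : Fin k, 0 ≤ (k : ℝ) / ((p.1 : ℝ) - 1) * (if p.1 ∣ v i then 1 else 0) +
        (if p.1 * p.1 ∣ v i then 1 else 0) +
        ∑ j with j ≠ i, (if p.1 ∣ v i ∧ p.1 ∣ v j then (1 : ℝ) else 0) := fun i =>
      add_nonneg (add_nonneg (mul_nonneg h0 (by split_ifs <;> norm_num))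
        (by split_ifs <;> norm_num)) (sum_nonneg fun j _ => by split_ifs <;> norm_num)
    split_ifs with h
    · exact sum_nonneg fun i _ => hterm i
    · rw [colorOf_eq_none_iff] at h
      push Not at h
      obtain ⟨i, hi⟩ := h
      refine le_trans ?_ (single_le_sum (fun i _ => hterm i) (mem_univ i))
      rw [if_pos hi, mul_one, add_assoc]
      refine le_add_of_nonneg_right (add_nonneg (by split_ifs <;> norm_num)
        (sum_nonneg fun j _ => by split_ifs <;> norm_num))
  · intro p _
    split_ifs
    · exact le_rfl
    · exact div_nonneg (Nat.cast_nonneg k) (freePrimes_sub_one_pos p).le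
  · intro p _
    split_ifs
    · exact zero_le_one
    · rw [div_le_one (freePrimes_sub_one_pos p)]
      linarith [hk p]

end Mass

end

end PrimeGaps

/-! ### Lower bound for the form without colour `m` -/

namespace PrimeGaps

open Finset

noncomputable section

theorem sum_sq_expand {α γ : Type*} [Fintype α] [Fintype γ] (w : γ → ℝ) (f : α → ℝ)
    (K : α → γ → ℝ) :
    ∑ c, w c * (∑ r, f r * K r c) ^ 2
      = ∑ x : γ × α × α, w x.1 * (f x.2.1 * K x.2.1 x.1) * (f x.2.2 * K x.2.2 x.1) := by
  rw [Fintype.sum_prod_type]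
  refine sum_congr rfl fun c _ => ?_
  rw [Fintype.sum_prod_type, pow_two, sum_mul_sum, mul_sum]
  refine sum_congr rfl fun r _ => ?_
  rw [mul_sum]
  exact sum_congr rfl fun r' _ => by ring

section Lower

variable {T : Finset ℕ} {R : ℝ} {k : ℕ}

theorem isGood_update_one {v : Fin k → ℕ} (hv : IsGood T R v) (m : Fin k) :
    IsGood T R (Function.update v m 1) := by
  have key : ∀ (p : freePrimes T R) i, p.1 ∣ Function.update v m 1 i → p.1 ∣ v i ∧ i ≠ m := by
    intro p i h
    by_cases hi : i = m
    · subst hi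
      simp only [Function.update_self, Nat.dvd_one] at h
      exact absurd h (prime_of_freePrimes p).ne_one
    · rw [Function.update_of_ne hi] at h
      exact ⟨h, hi⟩
  refine fun p i => ⟨fun h => ?_, fun j hj h => ?_⟩
  · have h1 := (key p i ((dvd_mul_right _ _).trans h)).2
    rw [Function.update_of_ne h1] at h
    exact (hv p i).1 h
  · exact (hv p i).2 j hj ⟨(key p i h.1).1, (key p j h.2).1⟩

/-- If `p` divides a coordinate other than the `m`-th, all three colours agree and the factor `1 - k
/ (p - 1)` appears on both sides. Otherwise the common part is uncoloured at `p`, and each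
occurrence in position `m` costs `1 / p` on the left and `1 / (p - 1)` on the right. -/
theorem prime_factor_lower {v : Fin k → ℕ} {m : Fin k} {n : ℕ} (hv : IsGood T R v)
    (hv' : IsGood T R (Function.update v m n)) (hk : ∀ p : freePrimes T R, (k : ℝ) + 1 ≤ p.1)
    (p : freePrimes T R) :
    colWeight (1 / (p.1 : ℝ)) (colorOf T R v p) *
        (if colorOf T R (Function.update v m n) p = some m then 1 / (p.1 : ℝ) else 1) *
        (1 - (if colorOf T R v p = none then 0 else (k : ℝ) / ((p.1 : ℝ) - 1)))
      ≤ colWeight (1 / ((p.1 : ℝ) - 1) * (1 - k * (1 / ((p.1 : ℝ) - 1))))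
          (colorOf T R (Function.update v m 1) p) *
        crossAbs m (1 / ((p.1 : ℝ) - 1)) (colorOf T R v p)
          (colorOf T R (Function.update v m 1) p) *
        crossAbs m (1 / ((p.1 : ℝ) - 1)) (colorOf T R (Function.update v m n) p)
          (colorOf T R (Function.update v m 1) p) := by
  have hp := cast_pos_of_freePrimes p
  have hp1 := freePrimes_sub_one_pos p
  have hv1 := isGood_update_one hv m
  have hpn1 : ¬ p.1 ∣ 1 := fun h => (prime_of_freePrimes p).ne_one (Nat.dvd_one.1 h)
  set q : ℝ := 1 / ((p.1 : ℝ) - 1) with hq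
  have hτ : (k : ℝ) / ((p.1 : ℝ) - 1) = k * q := by rw [hq]; ring
  have hqp : 1 / (p.1 : ℝ) ≤ q := one_div_le_one_div_of_le hp1 (by linarith)
  have hp0 : 0 ≤ 1 / (p.1 : ℝ) := by positivity
  have hτ0 : 0 ≤ k * q := mul_nonneg (Nat.cast_nonneg k) (hp0.trans hqp)
  have hτ1 : k * q ≤ 1 := by
    rw [hq, mul_one_div, div_le_one hp1]
    linarith [hk p]
  rw [hτ]
  by_cases h : ∃ i, i ≠ m ∧ p.1 ∣ v i
  · obtain ⟨i, hi, hpi⟩ := h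
    have e1 : colorOf T R v p = some i := (colorOf_eq_some_iff hv).2 hpi
    have e2 : colorOf T R (Function.update v m n) p = some i :=
      (colorOf_eq_some_iff hv').2 (by rwa [Function.update_of_ne hi])
    have e3 : colorOf T R (Function.update v m 1) p = some i :=
      (colorOf_eq_some_iff hv1).2 (by rwa [Function.update_of_ne hi])
    rw [e1, e2, e3]
    simp only [colWeight, crossAbs, hi, Option.some.injEq, if_false, mul_one, reduceCtorEq,
      true_and, ne_eq, not_false_eq_true, if_true]
    exact mul_le_mul_of_nonneg_right hqp (by linarith)
  · push Not at h
    have e3 : colorOf T R (Function.update v m 1) p = none := by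
      rw [colorOf_eq_none_iff]
      intro i
      by_cases hi : i = m
      · subst hi; simpa using hpn1
      · rw [Function.update_of_ne hi]; exact h i hi
    have e1 : colorOf T R v p = none ∨ colorOf T R v p = some m := by
      cases h1 : colorOf T R v p with
      | none => exact Or.inl rfl
      | some i =>
        right
        by_contra h2
        exact h i (fun hi => h2 (by rw [hi])) ((colorOf_eq_some_iff hv).1 h1)
    have e2 : colorOf T R (Function.update v m n) p = none ∨
        colorOf T R (Function.update v m n) p = some m := by
      cases h1 : colorOf T R (Function.update v m n) p with
      | none => exact Or.inl rfl
      | some i =>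
        right
        by_contra h2
        have hi : i ≠ m := fun hi => h2 (by rw [hi])
        have := (colorOf_eq_some_iff hv').1 h1
        rw [Function.update_of_ne hi] at this
        exact h i hi this
    rw [e3]
    rcases e1 with e1 | e1 <;> rcases e2 with e2 | e2 <;> rw [e1, e2] <;>
      simp only [colWeight, crossAbs, reduceCtorEq, if_false, if_true, mul_one, one_mul, sub_zero]
    · exact le_rfl
    · exact hqp
    · nlinarith
    · have : 1 / (p.1 : ℝ) * (1 / (p.1 : ℝ)) ≤ q * q := mul_le_mul hqp hqp hp0 (hp0.trans hqp)
      have h3 : 0 ≤ 1 / (p.1 : ℝ) * (1 / (p.1 : ℝ)) := mul_nonneg hp0 hp0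
      nlinarith

theorem weight_lower (hT : ∀ p ∈ T, p.Prime) {v : Fin k → ℕ} {m : Fin k} {n : ℕ}
    (hv : IsGood T R v) (hv' : IsGood T R (Function.update v m n)) (hvS : ∀ i, v i ∈ sifted T R)
    (hn : n ∈ sifted T R) (hk : ∀ p : freePrimes T R, (k : ℝ) + 1 ≤ p.1) :
    (∏ i, 1 / (v i : ℝ)) * (1 / (n : ℝ)) * (1 - badness T R v)
      ≤ (∏ p : freePrimes T R, colWeight (1 / ((p.1 : ℝ) - 1) * (1 - k * (1 / ((p.1 : ℝ) - 1))))
          (colorOf T R (Function.update v m 1) p)) *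
        (∏ p : freePrimes T R, crossAbs m (1 / ((p.1 : ℝ) - 1)) (colorOf T R v p)
          (colorOf T R (Function.update v m 1) p)) *
        ∏ p : freePrimes T R, crossAbs m (1 / ((p.1 : ℝ) - 1))
          (colorOf T R (Function.update v m n) p) (colorOf T R (Function.update v m 1) p) := by
  have hvS' : ∀ i, Function.update v m n i ∈ sifted T R := fun i => by
    by_cases hi : i = m
    · subst hi; simpa using hn
    · simpa [hi] using hvS i
  have e1 : ∏ i, 1 / (v i : ℝ) = ∏ p : freePrimes T R, colWeight (1 / (p.1 : ℝ)) (colorOf T R v p) := by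
    rw [prod_colWeight_one_div, colorProd_colorOf hT hv hvS]
  have e2 : 1 / (n : ℝ) = ∏ p : freePrimes T R,
      (if colorOf T R (Function.update v m n) p = some m then 1 / (p.1 : ℝ) else 1) := by
    have h1 := congrFun (colorProd_colorOf hT hv' hvS') m
    rw [Function.update_self] at h1
    rw [← prod_filter]
    conv_lhs => rw [← h1, colorProd, ← prod_one_div]
    rfl
  rw [← prod_mul_distrib, ← prod_mul_distrib]
  calc _ ≤ (∏ i, 1 / (v i : ℝ)) * (1 / (n : ℝ)) * ∏ p : freePrimes T R,
        (1 - (if colorOf T R v p = none then 0 else (k : ℝ) / ((p.1 : ℝ) - 1))) :=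
        mul_le_mul_of_nonneg_left (one_sub_badness_le hk) (by positivity)
    _ ≤ _ := by
        rw [e1, e2, ← prod_mul_distrib, ← prod_mul_distrib]
        refine prod_le_prod (fun p _ => ?_) fun p _ => prime_factor_lower hv hv' hk p
        have h0 : 0 ≤ 1 / (p.1 : ℝ) := one_div_nonneg.2 (Nat.cast_nonneg _)
        refine mul_nonneg (mul_nonneg ?_ (by split_ifs <;> first | exact h0 | exact zero_le_one)) ?_
        · cases colorOf T R v p
          · exact zero_le_one
          · exact h0
        · rw [sub_nonneg]
          split_ifs
          · exact zero_le_one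
          · rw [div_le_one (freePrimes_sub_one_pos p)]
            linarith [hk p]

/-- Exchanging `n` with the `m`-th coordinate of `v` is a weight-preserving involution, so both
badness terms have the same sum. -/
theorem sum_badness_update_le (m : Fin k) :
    ∑ v ∈ Fintype.piFinset (fun _ : Fin k => sifted T R), ∑ n ∈ sifted T R,
        (∏ i, 1 / (v i : ℝ)) * (1 / (n : ℝ)) *
          (badness T R v + badness T R (Function.update v m n))
      ≤ 6 * k ^ 2 * tailSum T R * siftedSum T R ^ (k + 1) := by
  have h1 : ∑ v ∈ Fintype.piFinset (fun _ : Fin k => sifted T R), ∑ n ∈ sifted T R,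
        (∏ i, 1 / (v i : ℝ)) * (1 / (n : ℝ)) * badness T R v
      ≤ 3 * k ^ 2 * tailSum T R * siftedSum T R ^ (k + 1) := by
    calc _ = (∑ v ∈ Fintype.piFinset (fun _ : Fin k => sifted T R),
          (∏ i, 1 / (v i : ℝ)) * badness T R v) * siftedSum T R := by
          rw [sum_mul]
          refine sum_congr rfl fun v _ => ?_
          rw [siftedSum, mul_sum]
          exact sum_congr rfl fun n _ => by ring
      _ ≤ _ := mul_le_mul_of_nonneg_right (sum_badness_le T R) (siftedSum_nonneg T R)
      _ = _ := by rw [pow_succ]; ring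
  have h2 : ∑ v ∈ Fintype.piFinset (fun _ : Fin k => sifted T R), ∑ n ∈ sifted T R,
        (∏ i, 1 / (v i : ℝ)) * (1 / (n : ℝ)) * badness T R (Function.update v m n)
      = ∑ v ∈ Fintype.piFinset (fun _ : Fin k => sifted T R), ∑ n ∈ sifted T R,
        (∏ i, 1 / (v i : ℝ)) * (1 / (n : ℝ)) * badness T R v := by
    rw [← sum_product' (Fintype.piFinset fun _ : Fin k => sifted T R) (sifted T R)
        fun v n => (∏ i, 1 / (v i : ℝ)) * (1 / (n : ℝ)) * badness T R (Function.update v m n),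
      ← sum_product' (Fintype.piFinset fun _ : Fin k => sifted T R) (sifted T R)
        fun v n => (∏ i, 1 / (v i : ℝ)) * (1 / (n : ℝ)) * badness T R v]
    refine sum_bij' (fun x _ => (Function.update x.1 m x.2, x.1 m))
      (fun x _ => (Function.update x.1 m x.2, x.1 m)) ?_ ?_ ?_ ?_ ?_
    · rintro ⟨v, n⟩ h
      rw [mem_product, Fintype.mem_piFinset] at h
      refine mem_product.2 ⟨Fintype.mem_piFinset.2 fun i => ?_, h.1 m⟩
      by_cases hi : i = m
      · subst hi; simpa using h.2
      · simpa [hi] using h.1 i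
    · rintro ⟨v, n⟩ h
      rw [mem_product, Fintype.mem_piFinset] at h
      refine mem_product.2 ⟨Fintype.mem_piFinset.2 fun i => ?_, h.1 m⟩
      by_cases hi : i = m
      · subst hi; simpa using h.2
      · simpa [hi] using h.1 i
    · rintro ⟨v, n⟩ _
      simp
    · rintro ⟨v, n⟩ _
      simp
    · rintro ⟨v, n⟩ _
      congr 1
      rw [← mul_prod_erase univ _ (mem_univ m), ← mul_prod_erase univ
        (fun i => 1 / ((Function.update v m n i : ℕ) : ℝ)) (mem_univ m), Function.update_self,
        prod_congr rfl fun i (hi : i ∈ univ.erase m) =>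
          show 1 / ((Function.update v m n i : ℕ) : ℝ) = 1 / (v i : ℝ) by
            rw [Function.update_of_ne (ne_of_mem_erase hi)]]
      ring
  simp_rw [mul_add, sum_add_distrib]
  rw [h2]
  linarith

/-- With no squarefreeness or coprimality imposed, the `k + 1` integers are independent and the sum
factors over cells. -/
theorem main_sum_ge {M : ℕ} (hM : 0 < M) (hR : 1 < R) (hT : ∀ p ∈ T, p.Prime)
    {Φ : (Fin k → ℕ) → ℝ} (hΦ0 : ∀ j, 0 ≤ Φ j) {η : ℝ} (hη : 2 * η ≤ 1 / M)
    (hS : ∀ x : ℝ, 1 ≤ x →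
      |siftedSum T x - density T * Real.log x| ≤ η * density T * Real.log R) (m : Fin k) :
    (density T * Real.log R * (1 / M - 2 * η)) ^ (k + 1) *
        ∑ j ∈ grid (Fin k) M, ∑ l ∈ range M, Φ j * Φ (Function.update j m l)
      ≤ ∑ v ∈ Fintype.piFinset (fun _ : Fin k => sifted T R), ∑ n ∈ sifted T R,
        (∏ i, 1 / (v i : ℝ)) * (1 / (n : ℝ)) *
          (stepVal Φ M R v * stepVal Φ M R (Function.update v m n)) := by
  have hcell : ∀ n ∈ sifted T R, cell M R n < M := fun n hn =>
    cell_lt hM hR (mem_sifted.1 hn).2.1 (mem_sifted.1 hn).1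
  have hb0 : 0 ≤ density T * Real.log R * (1 / M - 2 * η) :=
    mul_nonneg (mul_nonneg (density_pos hT).le (Real.log_pos hR).le) (by linarith)
  have e1 : ∀ v : Fin k → ℕ, ∑ n ∈ sifted T R, (∏ i, 1 / (v i : ℝ)) * (1 / (n : ℝ)) *
          (stepVal Φ M R v * stepVal Φ M R (Function.update v m n))
      = (fun j : Fin k → ℕ => Φ j * ∑ l ∈ range M, Φ (Function.update j m l) * cellMass T M R l)
          (fun i => cell M R (v i)) * ∏ i, 1 / (v i : ℝ) := by
    intro v
    have e3 : ∀ n, stepVal Φ M R (Function.update v m n)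
        = Φ (Function.update (fun i => cell M R (v i)) m (cell M R n)) := by
      intro n
      unfold stepVal
      congr 1
      funext i
      by_cases hi : i = m
      · subst hi; simp
      · simp [hi]
    have e2 : ∑ l ∈ range M, Φ (Function.update (fun i => cell M R (v i)) m l) * cellMass T M R l
        = ∑ n ∈ sifted T R, stepVal Φ M R (Function.update v m n) * (1 / (n : ℝ)) := by
      rw [← sum_fiberwise_of_maps_to (t := range M) (g := cell M R)
        fun n hn => mem_range.2 (hcell n hn)]
      refine sum_congr rfl fun l _ => ?_
      rw [cellMass, mul_sum]
      refine sum_congr rfl fun n hn => ?_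
      rw [e3, (mem_filter.1 hn).2]
    simp only
    rw [e2, mul_sum, sum_mul]
    exact sum_congr rfl fun n _ => by unfold stepVal; ring
  simp_rw [e1]
  rw [sum_cells hcell (fun j : Fin k → ℕ =>
    Φ j * ∑ l ∈ range M, Φ (Function.update j m l) * cellMass T M R l) (fun n => 1 / (n : ℝ)),
    mul_sum]
  refine sum_le_sum fun j hj => ?_
  rw [mem_grid] at hj
  rw [mul_sum, mul_sum, sum_mul]
  refine sum_le_sum fun l hl => ?_
  rw [mem_range] at hl
  have h1 : (density T * Real.log R * (1 / M - 2 * η)) ^ k ≤ ∏ i, cellMass T M R (j i) := by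
    calc _ = ∏ _i : Fin k, density T * Real.log R * (1 / M - 2 * η) := by simp
      _ ≤ _ := prod_le_prod (fun _ _ => hb0) fun i _ => (cellMass_bounds hM hR hS (hj i)).1
  have h2 := (cellMass_bounds hM hR hS hl).1
  have h3 := mul_le_mul h1 h2 hb0 (prod_nonneg fun i _ => cellMass_nonneg T M R (j i))
  rw [← pow_succ] at h3
  calc _ ≤ ((∏ i, cellMass T M R (j i)) * cellMass T M R l) * (Φ j * Φ (Function.update j m l)) :=
        mul_le_mul_of_nonneg_right h3 (mul_nonneg (hΦ0 _) (hΦ0 _))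
    _ = _ := by unfold cellMass; ring

/-- In the expanded squares, indexed by triples `(c, r, r')`, all terms are nonnegative. It suffices
to keep those where `r` and `r'` come from good tuples differing only in coordinate `m` and `c` is
their common part. -/
theorem le_stepForm_avoid {M : ℕ} (hM : 0 < M) (hR : 1 < R) (hT : ∀ p ∈ T, p.Prime)
    {Φ : (Fin k → ℕ) → ℝ} (hΦ0 : ∀ j, 0 ≤ Φ j) {B : ℝ} (hB : ∀ j, |Φ j| ≤ B)
    {η : ℝ} (hη : 2 * η ≤ 1 / M)
    (hS : ∀ x : ℝ, 1 ≤ x →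
      |siftedSum T x - density T * Real.log x| ≤ η * density T * Real.log R)
    (hk : ∀ p : freePrimes T R, (k : ℝ) + 1 ≤ p.1) (m : Fin k) :
    (density T * Real.log R * (1 / M - 2 * η)) ^ (k + 1) *
        (∑ j ∈ grid (Fin k) M, ∑ l ∈ range M, Φ j * Φ (Function.update j m l))
        - B ^ 2 * (6 * k ^ 2 * tailSum T R * siftedSum T R ^ (k + 1))
      ≤ ∑ d, ∑ e, avoid m (stepWeight Φ M) d * avoid m (stepWeight Φ M) e *
        ∏ p : freePrimes T R, kern (1 / ((p.1 : ℝ) - 1)) (d p) (e p) := by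
  classical
  have hB0 : 0 ≤ B := (abs_nonneg _).trans (hB 0)
  have hq0 : ∀ p : freePrimes T R, 0 ≤ 1 / ((p.1 : ℝ) - 1) := fun p =>
    one_div_nonneg.2 (freePrimes_sub_one_pos p).le
  have hlow := le_sieveForm_avoid (fun p : freePrimes T R => (p.1 : ℝ)) (by simpa using hk)
    (fun p => by linarith [freePrimes_sub_one_pos p]) m (yCoeff Φ M)
  rw [Fintype.card_fin] at hlow
  refine le_trans ?_ hlow
  have e1 : ∀ c : freePrimes T R → Option (Fin k),
      (∑ r, yCoeff Φ M r * ∏ p, crossCoeff m (1 / ((p.1 : ℝ) - 1)) (r p) (c p)) ^ 2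
        = (∑ r, stepVal Φ M R (colorProd r) *
            ∏ p, crossAbs m (1 / ((p.1 : ℝ) - 1)) (r p) (c p)) ^ 2 := by
    intro c
    have e2 : ∀ r : freePrimes T R → Option (Fin k),
        yCoeff Φ M r * ∏ p, crossCoeff m (1 / ((p.1 : ℝ) - 1)) (r p) (c p)
          = (∏ p, colWeight (-1) (c p)) * (stepVal Φ M R (colorProd r) *
            ∏ p, crossAbs m (1 / ((p.1 : ℝ) - 1)) (r p) (c p)) := by
      intro r
      have e3 : (∏ p, colWeight (-1) (r p)) * ∏ p, crossCoeff m (1 / ((p.1 : ℝ) - 1)) (r p) (c p)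
          = (∏ p, colWeight (-1) (c p)) * ∏ p, crossAbs m (1 / ((p.1 : ℝ) - 1)) (r p) (c p) := by
        rw [← prod_mul_distrib, ← prod_mul_distrib]
        exact prod_congr rfl fun p _ => colWeight_mul_crossCoeff _ _ _ _
      rw [yCoeff, mul_right_comm, e3]
      ring
    simp_rw [e2]
    rw [← mul_sum, mul_pow, prod_colWeight_neg_one_sq, one_mul]
  simp_rw [e1]
  rw [sum_sq_expand]
  set S := Fintype.piFinset (fun _ : Fin k => sifted T R) with hSdef
  have hW0 : ∀ (p : freePrimes T R) (o : Option (Fin k)),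
      0 ≤ colWeight (1 / ((p.1 : ℝ) - 1) * (1 - k * (1 / ((p.1 : ℝ) - 1)))) o := by
    intro p o
    cases o with
    | none => exact zero_le_one
    | some i =>
      refine mul_nonneg (hq0 p) ?_
      rw [mul_one_div, sub_nonneg, div_le_one (freePrimes_sub_one_pos p)]
      linarith [hk p]
  calc _ ≤ ∑ x ∈ S ×ˢ sifted T R, (∏ i, 1 / (x.1 i : ℝ)) * (1 / (x.2 : ℝ)) *
          (1 - badness T R x.1 - badness T R (Function.update x.1 m x.2)) *
          (stepVal Φ M R x.1 * stepVal Φ M R (Function.update x.1 m x.2)) := by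
        rw [sum_product]
        have hmain := main_sum_ge hM hR hT hΦ0 hη hS m
        have hbad := mul_le_mul_of_nonneg_left
          (sum_badness_update_le (T := T) (R := R) m) (sq_nonneg B)
        refine (sub_le_sub hmain hbad).trans ?_
        rw [mul_sum, ← sum_sub_distrib]
        refine sum_le_sum fun v _ => ?_
        rw [mul_sum, ← sum_sub_distrib]
        refine sum_le_sum fun n _ => ?_
        have h1 : stepVal Φ M R v * stepVal Φ M R (Function.update v m n) ≤ B ^ 2 := by
          rw [pow_two]
          exact mul_le_mul ((le_abs_self _).trans (hB _)) ((le_abs_self _).trans (hB _)) (hΦ0 _) hB0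
        have h2 : 0 ≤ (∏ i, 1 / (v i : ℝ)) * (1 / (n : ℝ)) *
            (badness T R v + badness T R (Function.update v m n)) :=
          mul_nonneg (by positivity) (add_nonneg (badness_nonneg _) (badness_nonneg _))
        have h3 := mul_le_mul_of_nonneg_left h1 h2
        linarith
    -- A bad tuple has badness at least `1`, so the discarded terms are nonpositive.
    _ ≤ ∑ x ∈ S ×ˢ sifted T R with IsGood T R x.1 ∧ IsGood T R (Function.update x.1 m x.2),
          (∏ i, 1 / (x.1 i : ℝ)) * (1 / (x.2 : ℝ)) * (1 - badness T R x.1) *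
          (stepVal Φ M R x.1 * stepVal Φ M R (Function.update x.1 m x.2)) := by
        rw [sum_filter]
        refine sum_le_sum fun x _ => ?_
        have h0 : 0 ≤ stepVal Φ M R x.1 * stepVal Φ M R (Function.update x.1 m x.2) :=
          mul_nonneg (hΦ0 _) (hΦ0 _)
        have hw : 0 ≤ (∏ i, 1 / (x.1 i : ℝ)) * (1 / (x.2 : ℝ)) := by positivity
        have hb1 := badness_nonneg (T := T) (R := R) x.1
        have hb2 := badness_nonneg (T := T) (R := R) (Function.update x.1 m x.2)
        split_ifs with h
        · exact mul_le_mul_of_nonneg_right (mul_le_mul_of_nonneg_left (by linarith) hw) h0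
        · refine mul_nonpos_of_nonpos_of_nonneg (mul_nonpos_of_nonneg_of_nonpos hw ?_) h0
          rw [not_and_or] at h
          rcases h with h | h
          · linarith [one_le_badness h]
          · linarith [one_le_badness h]
    _ ≤ _ := by
        refine sum_le_sum_of_injection (fun x => (colorOf T R (Function.update x.1 m 1),
          colorOf T R x.1, colorOf T R (Function.update x.1 m x.2))) (fun _ _ => mem_univ _) ?_ ?_ ?_
        · rintro ⟨v, n⟩ h ⟨v', n'⟩ h' heq
          simp only [mem_filter, mem_product, hSdef, Fintype.mem_piFinset] at h h'
          simp only [Prod.mk.injEq] at heq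
          have hv : v = v' := by
            rw [← colorProd_colorOf hT h.2.1 h.1.1, heq.2.1, colorProd_colorOf hT h'.2.1 h'.1.1]
          subst hv
          have hup : ∀ n, n ∈ sifted T R → ∀ i, Function.update v m n i ∈ sifted T R :=
            fun n hn i => by
              by_cases hi : i = m
              · subst hi; simpa using hn
              · simpa [hi] using h.1.1 i
          have h1 : Function.update v m n = Function.update v m n' := by
            rw [← colorProd_colorOf hT h.2.2 (hup n h.1.2), heq.2.2,
              colorProd_colorOf hT h'.2.2 (hup n' h'.1.2)]
          have h2 := congrFun h1 m
          simp only [Function.update_self] at h2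
          rw [h2]
        · rintro ⟨v, n⟩ h
          simp only [mem_filter, mem_product, hSdef, Fintype.mem_piFinset] at h
          have hup : ∀ i, Function.update v m n i ∈ sifted T R := fun i => by
            by_cases hi : i = m
            · subst hi; simpa using h.1.2
            · simpa [hi] using h.1.1 i
          simp only
          rw [colorProd_colorOf hT h.2.1 h.1.1, colorProd_colorOf hT h.2.2 hup]
          refine (mul_le_mul_of_nonneg_right (weight_lower hT h.2.1 h.2.2 h.1.1 h.1.2 hk)
            (mul_nonneg (hΦ0 _) (hΦ0 _))).trans (le_of_eq ?_)
          unfold stepVal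
          ring
        · rintro ⟨c, r, r'⟩ _
          have hK : ∀ r : freePrimes T R → Option (Fin k),
              0 ≤ ∏ p, crossAbs m (1 / ((p.1 : ℝ) - 1)) (r p) (c p) := fun r =>
            prod_nonneg fun p _ => crossAbs_nonneg m (hq0 p) _ _
          exact mul_nonneg (mul_nonneg (prod_nonneg fun p _ => hW0 p _)
            (mul_nonneg (hΦ0 _) (hK r))) (mul_nonneg (hΦ0 _) (hK r'))

end Lower

end

end PrimeGaps

/-! ### Distribution in residue classes -/

namespace PrimeGaps

open Finset

noncomputable section

/-- The hypothesis controls one residue per modulus, while many pairs share a modulus with different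
residues. Taking the worst occurring residue for each modulus reduces to it, at the price of the
multiplicity `w`. -/
theorem sum_le_of_class_choice {α : Type*} (s : Finset α) (Q : Finset ℕ) (q r : α → ℕ)
    (good : ℕ → ℕ → Prop) (w : ℕ → ℝ) (E : ℕ → ℕ → ℝ) (X : ℝ) (hQ : ∀ x ∈ s, q x ∈ Q)
    (hgood : ∀ x ∈ s, good (q x) (r x)) (hdef : ∀ y ∈ Q, ∃ z, good y z)
    (hE : ∀ y z, 0 ≤ E y z) (hcount : ∀ y ∈ Q, ((s.filter fun x => q x = y).card : ℝ) ≤ w y)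
    (hX : ∀ ρ : ℕ → ℕ, (∀ y ∈ Q, good y (ρ y)) → ∑ y ∈ Q, w y * E y (ρ y) ≤ X) :
    ∑ x ∈ s, E (q x) (r x) ≤ X := by
  classical
  have hmax : ∀ y : ℕ, ∃ z, (y ∈ Q → good y z) ∧ ∀ x ∈ s, q x = y → E y (r x) ≤ E y z := by
    intro y
    rcases (s.filter fun x => q x = y).eq_empty_or_nonempty with h | h
    · have h' : ∀ x ∈ s, q x ≠ y := fun x hx hxy => by
        have : x ∈ s.filter fun x => q x = y := mem_filter.2 ⟨hx, hxy⟩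
        rw [h] at this
        exact absurd this (notMem_empty x)
      by_cases hy : y ∈ Q
      · obtain ⟨z, hz⟩ := hdef y hy
        exact ⟨z, fun _ => hz, fun x hx hxy => absurd hxy (h' x hx)⟩
      · exact ⟨0, fun h => absurd h hy, fun x hx hxy => absurd hxy (h' x hx)⟩
    · obtain ⟨x₀, hx₀, hx₁⟩ := exists_max_image _ (fun x => E y (r x)) h
      obtain ⟨h1, rfl⟩ := mem_filter.1 hx₀
      exact ⟨r x₀, fun _ => hgood x₀ h1, fun x hx hxy => hx₁ x (mem_filter.2 ⟨hx, hxy⟩)⟩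
  choose ρ hρ using hmax
  refine le_trans ?_ (hX ρ fun y hy => (hρ y).1 hy)
  rw [← sum_fiberwise_of_maps_to (t := Q) (g := q) hQ]
  refine sum_le_sum fun y hy => ?_
  calc ∑ x ∈ s with q x = y, E (q x) (r x) ≤ ∑ x ∈ s with q x = y, E y (ρ y) := by
        refine sum_le_sum fun x hx => ?_
        obtain ⟨h1, h2⟩ := mem_filter.1 hx
        rw [h2]
        exact (hρ y).2 x h1 h2
    _ = ((s.filter fun x => q x = y).card : ℝ) * E y (ρ y) := by rw [sum_const, nsmul_eq_mul]
    _ ≤ _ := mul_le_mul_of_nonneg_right (hcount y hy) (hE _ _)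

section Pairs

variable {T : Finset ℕ} {R : ℝ} {k : ℕ}

/-- Two colourings that agree wherever both are defined. -/
def Compat (d e : freePrimes T R → Option (Fin k)) : Prop :=
  ∀ p i j, d p = some i → e p = some j → i = j

/-- The union of the supports of two colourings. -/
def unionSupp (d e : freePrimes T R → Option (Fin k)) : Finset (freePrimes T R) :=
  univ.filter fun p => d p ≠ none ∨ e p ≠ none

theorem prod_kern_of_compat (g : freePrimes T R → ℝ) {d e : freePrimes T R → Option (Fin k)}
    (h : Compat d e) : ∏ p, kern (g p) (d p) (e p) = ∏ p ∈ unionSupp d e, g p := by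
  rw [unionSupp, prod_filter]
  refine prod_congr rfl fun p _ => ?_
  have hp := h p
  cases hd : d p with
  | none => cases he : e p <;> simp [kern]
  | some i =>
    cases he : e p with
    | none => simp [kern]
    | some j => simp [kern, hp i j hd he]

theorem prod_kern_of_not_compat (g : freePrimes T R → ℝ) {d e : freePrimes T R → Option (Fin k)}
    (h : ¬ Compat d e) : ∏ p, kern (g p) (d p) (e p) = 0 := by
  unfold Compat at h
  push Not at h
  obtain ⟨p, i, j, hd, he, hij⟩ := h
  refine prod_eq_zero (mem_univ p) ?_
  rw [hd, he]
  simp [kern, hij]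

/-- At each prime of `U` there are `3 k` possibilities: a colour in `d` only, in `e` only, or the
same colour in both. -/
theorem card_compat_le (U : Finset (freePrimes T R))
    (s : Finset ((freePrimes T R → Option (Fin k)) × (freePrimes T R → Option (Fin k))))
    (hs : ∀ x ∈ s, Compat x.1 x.2 ∧ unionSupp x.1 x.2 = U) : s.card ≤ (3 * k) ^ U.card := by
  classical
  set V : Finset (Option (Fin k) × Option (Fin k)) :=
    (univ.image fun i : Fin k => (some i, none)) ∪
      ((univ.image fun i : Fin k => (none, some i)) ∪ univ.image fun i : Fin k => (some i, some i))
    with hV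
  have hVc : V.card ≤ 3 * k := by
    have h0 : ∀ f : Fin k → Option (Fin k) × Option (Fin k), (univ.image f).card ≤ k := fun f =>
      card_image_le.trans (by simp)
    have h1 := card_union_le (univ.image fun i : Fin k => ((some i, none) :
      Option (Fin k) × Option (Fin k))) ((univ.image fun i : Fin k => (none, some i)) ∪
        univ.image fun i : Fin k => (some i, some i))
    have h2 := card_union_le (univ.image fun i : Fin k => ((none, some i) :
      Option (Fin k) × Option (Fin k))) (univ.image fun i : Fin k => (some i, some i))
    have h3 := h0 fun i => (some i, none)
    have h4 := h0 fun i => (none, some i)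
    have h5 := h0 fun i => (some i, some i)
    rw [← hV] at h1
    omega
  have hcard : (Fintype.piFinset fun p => if p ∈ U then V else {(none, none)}).card
      = V.card ^ U.card := by
    rw [Fintype.card_piFinset, ← prod_const, ← prod_subset (subset_univ U)]
    · exact prod_congr rfl fun p hp => by rw [if_pos hp]
    · intro p _ hp
      rw [if_neg hp, card_singleton]
  refine le_trans ?_ (hcard.le.trans (Nat.pow_le_pow_left hVc _))
  refine card_le_card_of_injOn (fun x p => (x.1 p, x.2 p)) ?_ ?_
  · intro x hx
    obtain ⟨h1, h2⟩ := hs x hx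
    refine Fintype.mem_piFinset.2 fun p => ?_
    have h3 : p ∈ U ↔ x.1 p ≠ none ∨ x.2 p ≠ none := by rw [← h2, unionSupp]; simp
    change (x.1 p, x.2 p) ∈ if p ∈ U then V else {(none, none)}
    split_ifs with hp
    · have h4 := h1 p
      rw [h3] at hp
      cases hd : x.1 p with
      | none => cases he : x.2 p <;> simp_all
      | some i =>
        cases he : x.2 p with
        | none => simp [hV]
        | some j => simp [hV, h4 i j hd he]
    · rw [h3] at hp
      push Not at hp
      rw [hp.1, hp.2]
      simp
  · intro x _ y _ h
    refine Prod.ext (funext fun p => ?_) (funext fun p => ?_)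
    · exact congrArg Prod.fst (congrFun h p)
    · exact congrArg Prod.snd (congrFun h p)

theorem card_le_tau {W : ℕ} (hW : Squarefree W) (hWP : ∀ p : freePrimes T R, ¬ p.1 ∣ W)
    (hk : 0 < k) (U : Finset (freePrimes T R)) :
    ((3 * k : ℕ) : ℝ) ^ U.card ≤ (ArithmeticFunction.moebius (W * setProd U) : ℝ) ^ 2 *
      (tau (3 * k) (W * setProd U) : ℝ) := by
  have hsqU : Squarefree (setProd U) := by
    rw [Nat.squarefree_iff_prime_squarefree]
    intro q hq hqq
    obtain ⟨p, hp, rfl⟩ := (prime_dvd_setProd_iff hq).1 ((dvd_mul_right _ _).trans hqq)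
    rw [setProd, ← mul_prod_erase U _ hp] at hqq
    have h1 : p.1 ∣ setProd (U.erase p) := Nat.dvd_of_mul_dvd_mul_left hq.pos hqq
    rw [dvd_setProd_iff] at h1
    exact notMem_erase p U h1
  have hcop : W.Coprime (setProd U) := Nat.Coprime.symm (Nat.Coprime.prod_left fun p _ =>
    (Nat.Prime.coprime_iff_not_dvd (prime_of_freePrimes p)).2 (hWP p))
  have hsq : Squarefree (W * setProd U) := (Nat.squarefree_mul hcop).2 ⟨hW, hsqU⟩
  have h1 : (ArithmeticFunction.moebius (W * setProd U) : ℝ) ^ 2 = 1 := by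
    exact_mod_cast ArithmeticFunction.moebius_sq_eq_one_of_squarefree hsq
  rw [h1, one_mul, tau, Nat.card_finMulAntidiag_of_squarefree hsq]
  rw [Nat.cast_pow]
  refine pow_le_pow_right₀ (by exact_mod_cast (by omega : 1 ≤ 3 * k)) ?_
  rw [ArithmeticFunction.cardDistinctFactors_apply, ← List.card_toFinset]
  refine card_le_card_of_injOn (fun p => p.1) (fun p hp => ?_) fun p _ p' _ h => Subtype.ext h
  have : p.1 ∣ W * setProd U := (dvd_setProd_iff.2 hp).mul_left W
  exact Nat.mem_primeFactors.2 ⟨prime_of_freePrimes p, this, hsq.ne_zero⟩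

theorem modEq_setProd_iff (U : Finset (freePrimes T R)) (a b : ℕ) :
    a ≡ b [MOD setProd U] ↔ ∀ p ∈ U, a ≡ b [MOD p.1] := by
  constructor
  · exact fun h p hp => h.of_dvd (dvd_setProd_iff.2 hp)
  · intro h
    rw [Nat.modEq_iff_dvd, setProd, Nat.cast_prod]
    refine prod_dvd_of_coprime ?_ fun p hp => (Nat.modEq_iff_dvd).1 (h p hp)
    intro p _ p' _ hpp
    rw [Function.onFun, Nat.isCoprime_iff_coprime]
    exact (Nat.coprime_primes (prime_of_freePrimes p) (prime_of_freePrimes p')).2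
      fun h => hpp (Subtype.ext h)

/-- The indicator that `n + h i` is divisible by the primes of colour `i`. -/
def DvdBy (h : Fin k → ℕ) (n : ℕ) (d : freePrimes T R → Option (Fin k)) : Prop :=
  ∀ p i, d p = some i → p.1 ∣ n + h i

/-- Chinese remainder theorem: compatibility ensures that each prime imposes at most one residue. -/
theorem exists_class (h : Fin k → ℕ) {W q₀ a₀ ν : ℕ} (hWq : W.Coprime q₀)
    (hWP : ∀ p : freePrimes T R, ¬ p.1 ∣ W) (hqP : ∀ p : freePrimes T R, ¬ p.1 ∣ q₀)
    {d e : freePrimes T R → Option (Fin k)} (hde : Compat d e) :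
    ∃ r : ℕ, r ≡ a₀ [MOD q₀] ∧ r ≡ ν [MOD W] ∧ DvdBy h r d ∧ DvdBy h r e ∧
      ∀ n : ℕ, n ≡ a₀ [MOD q₀] →
        (n ≡ r [MOD W * setProd (unionSupp d e) * q₀] ↔
          n ≡ ν [MOD W] ∧ DvdBy h n d ∧ DvdBy h n e) := by
  classical
  set U := unionSupp d e with hU
  have hcop1 : ∀ m : ℕ, (∀ p : freePrimes T R, ¬ p.1 ∣ m) → (setProd U).Coprime m := fun m hm =>
    Nat.Coprime.prod_left fun p _ => (Nat.Prime.coprime_iff_not_dvd (prime_of_freePrimes p)).2 (hm p)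
  have htarget : ∀ p : freePrimes T R, ∃ z : ℕ,
      (∀ i, d p = some i → p.1 ∣ z + h i) ∧ ∀ i, e p = some i → p.1 ∣ z + h i := by
    intro p
    have hex : ∀ a : ℕ, ∃ z : ℕ, p.1 ∣ z + a := fun a => by
      -- A natural number standing in for `-a` modulo `p`.
      refine ⟨p.1 * a - a, ?_⟩
      rw [Nat.sub_add_cancel (Nat.le_mul_of_pos_left a (prime_of_freePrimes p).pos)]
      exact dvd_mul_right _ _
    cases hd : d p with
    | none =>
      cases he : e p with
      | none => exact ⟨0, by simp, by simp⟩
      | some j =>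
        obtain ⟨z, hz⟩ := hex (h j)
        refine ⟨z, by simp, fun i hi => ?_⟩
        obtain rfl := Option.some_injective _ hi
        exact hz
    | some i =>
      obtain ⟨z, hz⟩ := hex (h i)
      refine ⟨z, fun j hj => ?_, fun j hj => ?_⟩
      · obtain rfl := Option.some_injective _ hj
        exact hz
      · obtain rfl := hde p i j hd hj
        exact hz
  choose tg htg using htarget
  obtain ⟨z, hz⟩ := Nat.chineseRemainderOfFinset tg (fun p => p.1) U
    (fun p _ => (prime_of_freePrimes p).ne_zero) (fun p _ p' _ hpp =>
      (Nat.coprime_primes (prime_of_freePrimes p) (prime_of_freePrimes p')).2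
        fun h => hpp (Subtype.ext h))
  obtain ⟨y, hy1, hy2⟩ := Nat.chineseRemainder hWq ν a₀
  obtain ⟨r, hr1, hr2⟩ := Nat.chineseRemainder
    (Nat.Coprime.mul_right (hcop1 W hWP) (hcop1 q₀ hqP)) z y
  have hrW : r ≡ ν [MOD W] := (hr2.of_dvd (dvd_mul_right _ _)).trans hy1
  have hrq : r ≡ a₀ [MOD q₀] := (hr2.of_dvd (dvd_mul_left _ _)).trans hy2
  have hrp : ∀ p ∈ U, r ≡ tg p [MOD p.1] := fun p hp =>
    ((modEq_setProd_iff U r z).1 hr1 p hp).trans (hz p hp)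
  have hmem : ∀ p, p ∈ U ↔ d p ≠ none ∨ e p ≠ none := fun p => by rw [hU, unionSupp]; simp
  have hsub : ∀ (p : freePrimes T R) (n a : ℕ), n ≡ r [MOD p.1] → p.1 ∣ r + a → p.1 ∣ n + a :=
    fun p n a h1 h2 => ((h1.add_right a).dvd_iff dvd_rfl).2 h2
  have hrd : DvdBy h r d := fun p i hi =>
    ((((hrp p ((hmem p).2 (Or.inl (by simp [hi])))).add_right (h i)).dvd_iff dvd_rfl).2
      ((htg p).1 i hi))
  have hre : DvdBy h r e := fun p i hi =>
    ((((hrp p ((hmem p).2 (Or.inr (by simp [hi])))).add_right (h i)).dvd_iff dvd_rfl).2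
      ((htg p).2 i hi))
  refine ⟨r, hrq, hrW, hrd, hre, fun n hn => ⟨fun hnr => ?_, ?_⟩⟩
  · have h1 : n ≡ r [MOD W] := hnr.of_dvd ⟨setProd U * q₀, by ring⟩
    have h2 : ∀ p ∈ U, n ≡ r [MOD p.1] := fun p hp =>
      hnr.of_dvd ((dvd_setProd_iff.2 hp).trans ⟨W * q₀, by ring⟩)
    refine ⟨h1.trans hrW, fun p i hi => ?_, fun p i hi => ?_⟩
    · exact hsub p n _ (h2 p ((hmem p).2 (Or.inl (by simp [hi])))) (hrd p i hi)
    · exact hsub p n _ (h2 p ((hmem p).2 (Or.inr (by simp [hi])))) (hre p i hi)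
  · rintro ⟨h1, h2, h3⟩
    have hc : ∀ (p : freePrimes T R) (a : ℕ), p.1 ∣ n + a → p.1 ∣ r + a → n ≡ r [MOD p.1] := by
      intro p a ha hb
      have : n + a ≡ r + a [MOD p.1] :=
        ((Nat.modEq_zero_iff_dvd).2 ha).trans ((Nat.modEq_zero_iff_dvd).2 hb).symm
      exact Nat.ModEq.add_right_cancel' a this
    have h4 : n ≡ r [MOD setProd U] := by
      rw [modEq_setProd_iff]
      intro p hp
      rcases (hmem p).1 hp with hd | he
      · obtain ⟨i, hi⟩ := Option.ne_none_iff_exists'.1 hd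
        exact hc p (h i) (h2 p i hi) (hrd p i hi)
      · obtain ⟨i, hi⟩ := Option.ne_none_iff_exists'.1 he
        exact hc p (h i) (h3 p i hi) (hre p i hi)
    have h5 : n ≡ r [MOD W * setProd U] :=
      (Nat.modEq_and_modEq_iff_modEq_mul (hcop1 W hWP).symm).1 ⟨h1.trans hrW.symm, h4⟩
    exact (Nat.modEq_and_modEq_iff_modEq_mul
      (Nat.Coprime.mul_left hWq (hcop1 q₀ hqP))).1 ⟨h5, hn.trans hrq.symm⟩

/-- The square of the sieve sum at `n`. -/
def sieveSq (l : (freePrimes T R → Option (Fin k)) → ℝ) (h : Fin k → ℕ) (n : ℕ) : ℝ := by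
  classical
  exact (∑ d with DvdBy h n d, l d) ^ 2

theorem sieveSq_nonneg (l : (freePrimes T R → Option (Fin k)) → ℝ) (h : Fin k → ℕ) (n : ℕ) :
    0 ≤ sieveSq l h n := sq_nonneg _

/-- Evaluation of a weighted sum of the squared sieve weights, given control of the distribution of
the weight in residue classes. -/
theorem abs_sum_sieveSq_sub_le {h : Fin k → ℕ} {W q₀ a₀ ν : ℕ} (hWq : W.Coprime q₀)
    (hWsq : Squarefree W) (hWP : ∀ p : freePrimes T R, ¬ p.1 ∣ W)
    (hqP : ∀ p : freePrimes T R, ¬ p.1 ∣ q₀) (hk : 0 < k)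
    (hsep : ∀ (p : freePrimes T R) (n : ℕ) (i j : Fin k), p.1 ∣ n + h i → p.1 ∣ n + h j → i = j)
    (A' : Finset ℕ) (hA' : ∀ n ∈ A', n ≡ a₀ [MOD q₀]) (g : ℕ → ℝ)
    (l : (freePrimes T R → Option (Fin k)) → ℝ) {B Err : ℝ} (hl : ∀ d, |l d| ≤ B)
    (Q : Finset ℕ) (good : ℕ → ℕ → Prop)
    (hQ : ∀ d e, l d ≠ 0 → l e ≠ 0 → W * setProd (unionSupp d e) ∈ Q)
    (hgood : ∀ d e r, l d ≠ 0 → l e ≠ 0 → r ≡ a₀ [MOD q₀] → r ≡ ν [MOD W] → DvdBy h r d →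
      DvdBy h r e → good (W * setProd (unionSupp d e)) r)
    (hdef : ∀ y ∈ Q, ∃ z, good y z) (D : ℕ → ℝ) (X : ℝ) (ω : freePrimes T R → ℝ)
    (hD : ∀ U, D (W * setProd U) = X * ∏ p ∈ U, ω p)
    (hErr : ∀ ρ : ℕ → ℕ, (∀ y ∈ Q, good y (ρ y)) →
      ∑ y ∈ Q, (ArithmeticFunction.moebius y : ℝ) ^ 2 * (tau (3 * k) y : ℝ) *
        |(∑ n ∈ A' with n ≡ ρ y [MOD y * q₀], g n) - D y| ≤ Err) :
    |(∑ n ∈ A' with n ≡ ν [MOD W], g n * sieveSq l h n) -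
        X * ∑ d, ∑ e, l d * l e * ∏ p, kern (ω p) (d p) (e p)| ≤ B ^ 2 * Err := by
  classical
  have hB0 : 0 ≤ B := (abs_nonneg _).trans (hl fun _ => none)
  have hclass : ∀ d e : freePrimes T R → Option (Fin k), ∃ r : ℕ, Compat d e →
      r ≡ a₀ [MOD q₀] ∧ r ≡ ν [MOD W] ∧ DvdBy h r d ∧ DvdBy h r e ∧
      ∀ n : ℕ, n ≡ a₀ [MOD q₀] →
        (n ≡ r [MOD W * setProd (unionSupp d e) * q₀] ↔
          n ≡ ν [MOD W] ∧ DvdBy h n d ∧ DvdBy h n e) := by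
    intro d e
    by_cases hde : Compat d e
    · obtain ⟨r, hr⟩ := exists_class h (a₀ := a₀) (ν := ν) hWq hWP hqP hde
      exact ⟨r, fun _ => hr⟩
    · exact ⟨0, fun h => absurd h hde⟩
  choose r hr using hclass
  have hexp : ∑ n ∈ A' with n ≡ ν [MOD W], g n * sieveSq l h n
      = ∑ d, ∑ e, l d * l e *
        ∑ n ∈ A' with n ≡ ν [MOD W] ∧ DvdBy h n d ∧ DvdBy h n e, g n := by
    have h1 : ∀ n, g n * sieveSq l h n
        = ∑ d, ∑ e, if DvdBy h n d ∧ DvdBy h n e then l d * l e * g n else 0 := by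
      intro n
      rw [sieveSq, pow_two, sum_filter, sum_mul_sum, mul_sum]
      refine sum_congr rfl fun d _ => ?_
      rw [mul_sum]
      refine sum_congr rfl fun e _ => ?_
      by_cases h1 : DvdBy h n d <;> by_cases h2 : DvdBy h n e <;> simp [h1, h2]
      ring
    simp_rw [h1]
    rw [sum_comm]
    refine sum_congr rfl fun d _ => ?_
    rw [sum_comm]
    refine sum_congr rfl fun e _ => ?_
    rw [mul_sum, ← filter_filter, sum_filter (fun n => DvdBy h n d ∧ DvdBy h n e)]
  set E : ℕ → ℕ → ℝ := fun y z => |(∑ n ∈ A' with n ≡ z [MOD y * q₀], g n) - D y| with hEdef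
  set s : Finset ((freePrimes T R → Option (Fin k)) × (freePrimes T R → Option (Fin k))) :=
    univ.filter fun x => l x.1 ≠ 0 ∧ l x.2 ≠ 0 ∧ Compat x.1 x.2 with hs
  have hterm : ∀ d e, |l d * l e *
        (∑ n ∈ A' with n ≡ ν [MOD W] ∧ DvdBy h n d ∧ DvdBy h n e, g n) -
        X * (l d * l e * ∏ p, kern (ω p) (d p) (e p))|
      ≤ if l d ≠ 0 ∧ l e ≠ 0 ∧ Compat d e then
          B ^ 2 * E (W * setProd (unionSupp d e)) (r d e) else 0 := by
    intro d e
    by_cases hde : Compat d e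
    · obtain ⟨-, -, -, -, hr5⟩ := hr d e hde
      have h1 : A'.filter (fun n => n ≡ ν [MOD W] ∧ DvdBy h n d ∧ DvdBy h n e)
          = A'.filter fun n => n ≡ r d e [MOD W * setProd (unionSupp d e) * q₀] :=
        filter_congr fun n hn => (hr5 n (hA' n hn)).symm
      rw [h1, prod_kern_of_compat ω hde]
      have h2 : l d * l e * (∑ n ∈ A' with n ≡ r d e [MOD W * setProd (unionSupp d e) * q₀], g n) -
          X * (l d * l e * ∏ p ∈ unionSupp d e, ω p)
          = l d * l e * ((∑ n ∈ A' with n ≡ r d e [MOD W * setProd (unionSupp d e) * q₀], g n) -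
            D (W * setProd (unionSupp d e))) := by
        rw [hD]; ring
      rw [h2, abs_mul, abs_mul]
      split_ifs with h3
      · rw [pow_two]
        exact mul_le_mul_of_nonneg_right (mul_le_mul (hl d) (hl e) (abs_nonneg _) hB0)
          (abs_nonneg _)
      · by_cases hd : l d = 0
        · simp [hd]
        · by_cases he : l e = 0
          · simp [he]
          · exact absurd ⟨hd, he, hde⟩ h3
    · rw [if_neg fun h => hde h.2.2, prod_kern_of_not_compat ω hde]
      -- Incompatible pairs would need one free prime to divide two different `n + h i`; the kernel
      -- vanishes there too.
      have h1 : A'.filter (fun n => n ≡ ν [MOD W] ∧ DvdBy h n d ∧ DvdBy h n e) = ∅ := by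
        refine filter_eq_empty_iff.2 fun n _ hn => hde fun p i j hi hj => ?_
        exact hsep p n i j (hn.2.1 p i hi) (hn.2.2 p j hj)
      rw [h1]
      simp
  have hsum : ∑ x ∈ s, E (W * setProd (unionSupp x.1 x.2)) (r x.1 x.2) ≤ Err := by
    refine sum_le_of_class_choice s Q (fun x => W * setProd (unionSupp x.1 x.2))
      (fun x => r x.1 x.2) good
      (fun y => (ArithmeticFunction.moebius y : ℝ) ^ 2 * (tau (3 * k) y : ℝ)) E Err ?_ ?_ hdef
      (fun _ _ => abs_nonneg _) ?_ hErr
    · intro x hx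
      obtain ⟨h1, h2, -⟩ := (mem_filter.1 hx).2
      exact hQ _ _ h1 h2
    · intro x hx
      obtain ⟨h1, h2, h3⟩ := (mem_filter.1 hx).2
      obtain ⟨r1, r2, r3, r4, -⟩ := hr x.1 x.2 h3
      exact hgood _ _ _ h1 h2 r1 r2 r3 r4
    · intro y _
      rcases (s.filter fun x => W * setProd (unionSupp x.1 x.2) = y).eq_empty_or_nonempty
        with h0 | ⟨x₀, hx₀⟩
      · rw [h0, card_empty, Nat.cast_zero]
        positivity
      · obtain ⟨-, rfl⟩ := mem_filter.1 hx₀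
        refine le_trans ?_ (card_le_tau hWsq hWP hk (unionSupp x₀.1 x₀.2))
        have := card_compat_le (unionSupp x₀.1 x₀.2)
          (s.filter fun x => W * setProd (unionSupp x.1 x.2) =
            W * setProd (unionSupp x₀.1 x₀.2)) fun x hx => by
          obtain ⟨h1, h2⟩ := mem_filter.1 hx
          exact ⟨(mem_filter.1 h1).2.2.2, setProd_injective
            (Nat.eq_of_mul_eq_mul_left (Nat.pos_of_ne_zero hWsq.ne_zero) h2)⟩
        exact_mod_cast this
  rw [hexp, mul_sum, ← sum_sub_distrib]
  simp_rw [mul_sum univ _ X, ← sum_sub_distrib]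
  refine (abs_sum_le_sum_abs _ _).trans ((sum_le_sum fun d _ =>
    (abs_sum_le_sum_abs _ _).trans (sum_le_sum fun e _ => hterm d e)).trans ?_)
  refine le_trans (le_of_eq ?_) (mul_le_mul_of_nonneg_left hsum (sq_nonneg B))
  rw [mul_sum, hs, sum_filter, Fintype.sum_prod_type]

end Pairs

end

end PrimeGaps

/-! ### Auxiliary arithmetic: small moduli, totients, tails of products -/

namespace PrimeGaps

open Finset

noncomputable section

/-! ### The small primes -/

/-- The product of the primes up to `z` not dividing `a`. -/
def smallProd (z : ℝ) (a : ℕ) : ℕ := ∏ p ∈ (Icc 1 ⌊z⌋₊).filter (fun p => p.Prime ∧ ¬ p ∣ a), p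

theorem prime_dvd_smallProd_iff {z : ℝ} {a q : ℕ} (hq : q.Prime) :
    q ∣ smallProd z a ↔ q ≤ ⌊z⌋₊ ∧ ¬ q ∣ a := by
  rw [smallProd, hq.prime.dvd_finsetProd_iff]
  constructor
  · rintro ⟨p, hp, h⟩
    simp only [mem_filter, mem_Icc] at hp
    rw [Nat.prime_dvd_prime_iff_eq hq hp.2.1] at h
    subst h
    exact ⟨hp.1.2, hp.2.2⟩
  · rintro ⟨h1, h2⟩
    exact ⟨q, by simp [h1, h2, hq, hq.one_le], dvd_rfl⟩

theorem smallProd_pos (z : ℝ) (a : ℕ) : 0 < smallProd z a :=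
  prod_pos fun _ hp => (mem_filter.1 hp).2.1.pos

theorem smallProd_le (z : ℝ) (hz : 0 ≤ z) (a : ℕ) : (smallProd z a : ℝ) ≤ 4 ^ z := by
  have h1 : smallProd z a ≤ primorial ⌊z⌋₊ := by
    refine Nat.le_of_dvd (primorial_pos _) (prod_dvd_prod_of_subset _ _ _ fun _ hp => ?_)
    simp only [mem_filter, mem_Icc, mem_range] at hp ⊢
    exact ⟨by omega, hp.2.1⟩
  calc (smallProd z a : ℝ) ≤ ((4 ^ ⌊z⌋₊ : ℕ) : ℝ) := by
        exact_mod_cast h1.trans (primorial_le_four_pow _)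
    _ = (4 : ℝ) ^ (⌊z⌋₊ : ℝ) := by rw [Real.rpow_natCast]; norm_num
    _ ≤ 4 ^ z := Real.rpow_le_rpow_of_exponent_le (by norm_num) (Nat.floor_le hz)

theorem smallProd_squarefree (z : ℝ) (a : ℕ) : Squarefree (smallProd z a) := by
  rw [Nat.squarefree_iff_prime_squarefree]
  intro q hq hqq
  have h1 := (prime_dvd_smallProd_iff hq).1 ((dvd_mul_right _ _).trans hqq)
  have hmem : q ∈ (Icc 1 ⌊z⌋₊).filter (fun p => p.Prime ∧ ¬ p ∣ a) := by
    simp [h1.1, h1.2, hq, hq.one_le]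
  rw [smallProd, ← mul_prod_erase _ _ hmem] at hqq
  have h2 := Nat.dvd_of_mul_dvd_mul_left hq.pos hqq
  rw [hq.prime.dvd_finsetProd_iff] at h2
  obtain ⟨p, hp, h3⟩ := h2
  rw [mem_erase, mem_filter] at hp
  exact hp.1 ((Nat.prime_dvd_prime_iff_eq hq hp.2.2.1).1 h3).symm

theorem smallProd_coprime (z : ℝ) {a c : ℕ} (hc : c ∣ a) : (smallProd z a).Coprime c := by
  refine Nat.Coprime.prod_left fun p hp => ?_
  obtain ⟨-, h1, h2⟩ := mem_filter.1 hp
  exact (Nat.Prime.coprime_iff_not_dvd h1).2 fun h => h2 (h.trans hc)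

theorem exists_admissible_class {k : ℕ} {h : Fin k → ℕ} (hadm : IsAdmissible (univ.image h))
    (z : ℝ) (a : ℕ) : ∃ ν : ℕ, ∀ p : ℕ, p.Prime → p ∣ smallProd z a → ∀ i, ¬ p ∣ ν + h i := by
  have h1 : ∀ p : ℕ, ∃ x : ℕ, p.Prime → ∀ i, ¬ p ∣ x + h i := by
    intro p
    by_cases hp : p.Prime
    · obtain ⟨c, hc⟩ := hadm p hp
      have hp0 : (p : ℤ) ≠ 0 := by exact_mod_cast hp.ne_zero
      -- If the tuple misses the class `c`, then `-c + h i` is never `0` mod `p`.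
      refine ⟨((-c) % p).toNat, fun _ i hdvd => hc (h i) (mem_image_of_mem _ (mem_univ i)) ?_⟩
      have h2 : (p : ℤ) ∣ (((-c) % p).toNat : ℤ) + h i := by exact_mod_cast hdvd
      rw [Int.toNat_of_nonneg (Int.emod_nonneg _ hp0)] at h2
      rw [Int.modEq_iff_dvd]
      have h3 : (p : ℤ) ∣ -c - (-c) % p := Int.dvd_self_sub_emod
      have := dvd_add h3 h2
      have e : -c - (-c) % (p : ℤ) + ((-c) % p + h i) = h i - c := by ring
      rwa [e] at this
    · exact ⟨0, fun h => absurd h hp⟩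
  choose x hx using h1
  obtain ⟨ν, hν⟩ := Nat.chineseRemainderOfFinset x (fun p => p)
    ((Icc 1 ⌊z⌋₊).filter (fun p => p.Prime ∧ ¬ p ∣ a))
    (fun p hp => (mem_filter.1 hp).2.1.ne_zero) (fun p hp p' hp' hpp =>
      (Nat.coprime_primes (mem_filter.1 hp).2.1 (mem_filter.1 hp').2.1).2 hpp)
  refine ⟨ν, fun p hp hpW i hdvd => hx p hp i ?_⟩
  obtain ⟨h1, h2⟩ := (prime_dvd_smallProd_iff hp).1 hpW
  have h3 := hν p (by simp [h1, h2, hp, hp.one_le])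
  exact ((h3.add_right (h i)).dvd_iff dvd_rfl).1 hdvd

/-! ### Totients and densities -/

theorem density_primeFactors {n : ℕ} (hn : 0 < n) : density n.primeFactors = n.totient / n := by
  have h := Nat.totient_eq_mul_prod_factors n
  have hn' : (n : ℝ) ≠ 0 := by exact_mod_cast hn.ne'
  rw [eq_div_iff hn', mul_comm, density]
  have h2 : ((n.totient : ℚ) : ℝ) = ((n * ∏ p ∈ n.primeFactors, (1 - (p : ℚ)⁻¹) : ℚ) : ℝ) := by
    rw [h]
  push_cast at h2
  rw [h2]
  simp

theorem sum_log_primeFactors_le {n : ℕ} (hn : 0 < n) :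
    ∑ p ∈ n.primeFactors, Real.log p ≤ Real.log n := by
  rw [← Real.log_prod fun p hp => by
    exact_mod_cast (Nat.prime_of_mem_primeFactors hp).ne_zero]
  rw [← Nat.cast_prod]
  refine Real.log_le_log ?_ (by exact_mod_cast Nat.le_of_dvd hn (Nat.prod_primeFactors_dvd n))
  exact_mod_cast prod_pos fun p hp => (Nat.prime_of_mem_primeFactors hp).pos

section FreePrimes

variable {T : Finset ℕ} {R : ℝ}

theorem totient_setProd (U : Finset (freePrimes T R)) :
    ((setProd U).totient : ℝ) = ∏ p ∈ U, ((p.1 : ℝ) - 1) := by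
  classical
  induction U using Finset.induction_on with
  | empty => simp [setProd]
  | insert p U hp ih =>
    have h1 : setProd (insert p U) = p.1 * setProd U := prod_insert hp
    have h2 : p.1.Coprime (setProd U) :=
      (Nat.Prime.coprime_iff_not_dvd (prime_of_freePrimes p)).2 fun h => hp (dvd_setProd_iff.1 h)
    rw [h1, Nat.totient_mul h2, Nat.totient_prime (prime_of_freePrimes p), prod_insert hp, ← ih,
      Nat.cast_mul, Nat.cast_sub (prime_of_freePrimes p).one_le, Nat.cast_one]

theorem div_totient_mul_setProd (Y : ℝ) {a : ℕ} (ha : ∀ p : freePrimes T R, ¬ p.1 ∣ a)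
    (U : Finset (freePrimes T R)) :
    Y / ((a * setProd U).totient : ℝ) = Y / (a.totient : ℝ) * ∏ p ∈ U, 1 / ((p.1 : ℝ) - 1) := by
  have h : a.Coprime (setProd U) := Nat.Coprime.symm (Nat.Coprime.prod_left fun p _ =>
    (Nat.Prime.coprime_iff_not_dvd (prime_of_freePrimes p)).2 (ha p))
  rw [Nat.totient_mul h, Nat.cast_mul, totient_setProd, prod_div_distrib, prod_const_one,
    div_mul_div_comm, mul_one]

/-- The sum over all integers beyond `n` telescopes, as `1 / (j (j - 1)) = 1 / (j - 1) - 1 / j`. -/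
theorem tailSum_le {n : ℕ} (hn : 0 < n) (h : ∀ p : freePrimes T R, n < p.1) :
    tailSum T R ≤ 1 / n := by
  have tele : ∀ X : ℕ, n ≤ X → ∑ j ∈ Ico (n + 1) (X + 1), 1 / ((j : ℝ) * ((j : ℝ) - 1))
      = 1 / n - 1 / X := by
    intro X hX
    induction X, hX using Nat.le_induction with
    | base => simp
    | succ X hX ih =>
      have hX' : (X : ℝ) ≠ 0 := by exact_mod_cast (by omega : X ≠ 0)
      have hX1 : (X : ℝ) + 1 ≠ 0 := by positivity
      rw [sum_Ico_succ_top (by omega), ih]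
      push_cast
      rw [add_sub_cancel_right]
      field_simp
      ring
  set X := max n ⌈R⌉₊ with hX
  have hle : tailSum T R ≤ ∑ j ∈ Ico (n + 1) (X + 1), 1 / ((j : ℝ) * ((j : ℝ) - 1)) := by
    refine sum_le_sum_of_injection (fun p => p.1) (fun p _ => mem_Ico.2 ⟨h p, ?_⟩)
      (fun p _ p' _ h => Subtype.ext h) (fun _ _ => le_rfl) fun j hj => ?_
    · have := Nat.lt_ceil.2 (lt_of_freePrimes p)
      have := le_max_right n ⌈R⌉₊
      omega
    · have : (1 : ℝ) ≤ j := by exact_mod_cast (by have := (mem_Ico.1 hj).1; omega : 1 ≤ j)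
      exact one_div_nonneg.2 (mul_nonneg (by linarith) (by linarith))
  rw [tele X (le_max_left _ _)] at hle
  have : (0 : ℝ) ≤ 1 / X := by positivity
  linarith

theorem prod_one_add_le_exp {α : Type*} (s : Finset α) (f : α → ℝ) (hf : ∀ x ∈ s, 0 ≤ f x) :
    ∏ x ∈ s, (1 + f x) ≤ Real.exp (∑ x ∈ s, f x) := by
  rw [Real.exp_sum]
  exact prod_le_prod (fun x hx => by linarith [hf x hx]) fun x _ => by
    linarith [Real.add_one_le_exp (f x)]

theorem prod_one_add_tail_le (T : Finset ℕ) (R : ℝ) :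
    ∏ p : freePrimes T R, (1 + 1 / ((p.1 : ℝ) * ((p.1 : ℝ) - 1))) ≤ Real.exp (tailSum T R) :=
  prod_one_add_le_exp _ _ fun p _ => one_div_nonneg.2
    (mul_nonneg (cast_pos_of_freePrimes p).le (freePrimes_sub_one_pos p).le)

theorem prod_one_add_tail_two_le (h3 : ∀ p : freePrimes T R, (3 : ℝ) ≤ p.1) :
    ∏ p : freePrimes T R, (1 + 1 / ((p.1 : ℝ) * ((p.1 : ℝ) - 2)))
      ≤ Real.exp (2 * tailSum T R) := by
  refine (prod_one_add_le_exp _ _ fun p _ => one_div_nonneg.2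
    (mul_nonneg (cast_pos_of_freePrimes p).le (by linarith [h3 p]))).trans (Real.exp_le_exp.2 ?_)
  rw [tailSum, mul_sum]
  refine sum_le_sum fun p _ => ?_
  have := h3 p
  rw [mul_one_div, div_le_div_iff₀ (mul_pos (by linarith) (by linarith))
    (mul_pos (by linarith) (by linarith))]
  nlinarith

theorem setProd_unionSupp_le {k : ℕ} (d e : freePrimes T R → Option (Fin k)) :
    (setProd (unionSupp d e) : ℝ) ≤ (∏ i, (colorProd d i : ℝ)) * ∏ i, (colorProd e i : ℝ) := by
  have h1 : ∀ d : freePrimes T R → Option (Fin k),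
      ∏ i, (colorProd d i : ℝ) = ∏ p, colWeight (p.1 : ℝ) (d p) := by
    intro d
    rw [prod_colWeight]
    exact prod_congr rfl fun i _ => by rw [colorProd, setProd, Nat.cast_prod]
  rw [h1, h1, ← prod_mul_distrib, setProd, Nat.cast_prod, unionSupp, prod_filter]
  refine prod_le_prod (fun p _ => by split_ifs <;> positivity) fun p _ => ?_
  have hp : (1 : ℝ) ≤ p.1 := by exact_mod_cast (prime_of_freePrimes p).one_le
  cases d p <;> cases e p <;> simp [colWeight]
  nlinarith

theorem stepForm_avoid_nonneg {k M : ℕ} {Φ : (Fin k → ℕ) → ℝ}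
    (hk : ∀ p : freePrimes T R, (k : ℝ) + 1 ≤ p.1) (m : Fin k) :
    0 ≤ ∑ d, ∑ e, avoid m (stepWeight Φ M) d * avoid m (stepWeight Φ M) e *
        ∏ p : freePrimes T R, kern (1 / ((p.1 : ℝ) - 1)) (d p) (e p) := by
  refine le_trans ?_ (le_sieveForm_avoid (fun p : freePrimes T R => (p.1 : ℝ)) (by simpa using hk)
    (fun p => by linarith [freePrimes_sub_one_pos p]) m (yCoeff Φ M))
  refine sum_nonneg fun c _ => mul_nonneg (prod_nonneg fun p _ => ?_) (sq_nonneg _)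
  cases c p with
  | none => exact zero_le_one
  | some i =>
    refine mul_nonneg (one_div_nonneg.2 (freePrimes_sub_one_pos p).le) ?_
    rw [Fintype.card_fin, mul_one_div, sub_nonneg, div_le_one (freePrimes_sub_one_pos p)]
    linarith [hk p]

theorem abs_avoid_le {ι κ : Type*} [Fintype ι] [DecidableEq κ] (m : κ)
    (l : (ι → Option κ) → ℝ) (d : ι → Option κ) : |avoid m l d| ≤ |l d| := by
  rw [avoid, abs_mul, abs_prod]
  refine mul_le_of_le_one_right (abs_nonneg _) (prod_le_one (fun _ _ => abs_nonneg _) fun p _ => ?_)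
  split_ifs <;> simp

theorem avoid_ne_zero {ι κ : Type*} [Fintype ι] [DecidableEq κ] {m : κ}
    {l : (ι → Option κ) → ℝ} {d : ι → Option κ} (h : avoid m l d ≠ 0) :
    l d ≠ 0 ∧ ∀ p, d p ≠ some m := by
  refine ⟨left_ne_zero_of_mul h, fun p hp => ?_⟩
  have := prod_ne_zero_iff.1 (right_ne_zero_of_mul h) p (mem_univ p)
  rw [if_pos hp] at this
  exact this rfl

/-- A prime of colour `m` in a contributing colouring would divide `n + h m`. Hence colour `m` may
be forbidden wherever `n + h m` has no free prime factor. -/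
theorem sieveSq_avoid {k : ℕ} {m : Fin k} (l : (freePrimes T R → Option (Fin k)) → ℝ)
    {h : Fin k → ℕ} {n : ℕ} (hn : ∀ p : freePrimes T R, ¬ p.1 ∣ n + h m) :
    sieveSq (avoid m l) h n = sieveSq l h n := by
  classical
  unfold sieveSq
  congr 1
  refine sum_congr rfl fun d hd => ?_
  have hd' : DvdBy h n d := (mem_filter.1 hd).2
  rw [avoid, prod_eq_one, mul_one]
  intro p _
  rw [if_neg fun hp => hn p (hd' p m hp)]

end FreePrimes

end

end PrimeGaps

/-! ### Evaluation of the two sieve sums from (I) and (II) -/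

namespace PrimeGaps

open Finset

noncomputable section

/-- The data shared by the evaluations of the sieve sums: the small primes are handled by the class
`ν` modulo `W`, the others are the primes below `R` outside `T`. -/
structure Frame {k : ℕ} (N θ : ℝ) (q₀ q₁ a₀ W ν : ℕ) (T : Finset ℕ) (R : ℝ) (h : Fin k → ℕ) :
    Prop where
  k_pos : 0 < k
  W_squarefree : Squarefree W
  W_q₀ : W.Coprime q₀
  W_q₁ : W.Coprime q₁
  q₀_pos : 0 < q₀
  W_free : ∀ p : freePrimes T R, ¬ p.1 ∣ W
  q₀_free : ∀ p : freePrimes T R, ¬ p.1 ∣ q₀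
  q₁_free : ∀ p : freePrimes T R, ¬ p.1 ∣ q₁
  sep : ∀ (p : freePrimes T R) (n : ℕ) (i j : Fin k), p.1 ∣ n + h i → p.1 ∣ n + h j → i = j
  ν_spec : ∀ p : ℕ, p.Prime → p ∣ W → ∀ i, ¬ p ∣ ν + h i
  h_dvd : ∀ m, q₀ ∣ h m
  level : (W : ℝ) * R ^ 2 ≤ N ^ θ
  R_pos : 0 < R

section Evaluate

variable {k : ℕ} {N θ : ℝ} {q₀ q₁ a₀ W ν : ℕ} {T : Finset ℕ} {R : ℝ} {h : Fin k → ℕ}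

theorem Frame.mem_moduli (F : Frame N θ q₀ q₁ a₀ W ν T R h)
    {d e : freePrimes T R → Option (Fin k)}
    (hd : ∏ i, (colorProd d i : ℝ) ≤ R) (he : ∏ i, (colorProd e i : ℝ) ≤ R) :
    W * setProd (unionSupp d e) ∈ moduli N θ q₀ q₁ := by
  have hcop : ∀ m : ℕ, (∀ p : freePrimes T R, ¬ p.1 ∣ m) →
      (setProd (unionSupp d e)).Coprime m := fun m hm => Nat.Coprime.prod_left fun p _ =>
    (Nat.Prime.coprime_iff_not_dvd (prime_of_freePrimes p)).2 (hm p)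
  have hpos : 0 < W * setProd (unionSupp d e) :=
    Nat.mul_pos (Nat.pos_of_ne_zero F.W_squarefree.ne_zero) (setProd_pos _)
  refine mem_filter.2 ⟨mem_Icc.2 ⟨hpos, Nat.le_floor ?_⟩, ?_⟩
  · rw [Nat.cast_mul]
    refine le_trans (mul_le_mul_of_nonneg_left ?_ (Nat.cast_nonneg W)) F.level
    refine (setProd_unionSupp_le d e).trans ?_
    rw [pow_two]
    exact mul_le_mul hd he (prod_nonneg fun i _ => Nat.cast_nonneg _) F.R_pos.le
  · exact Nat.Coprime.mul_left (Nat.Coprime.mul_right F.W_q₀ F.W_q₁)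
      (Nat.Coprime.mul_right (hcop _ F.q₀_free) (hcop _ F.q₁_free))

theorem Frame.sum_sieveSq (F : Frame N θ q₀ q₁ a₀ W ν T R h) {A : Finset ℕ} {Y ε C : ℝ}
    (hA : ∀ n ∈ A, n ≡ a₀ [MOD q₀]) (hI : RegularityI k θ ε C N A Y q₀ q₁ a₀)
    {l : (freePrimes T R → Option (Fin k)) → ℝ} {B : ℝ} (hB : ∀ d, |l d| ≤ B)
    (hl : ∀ d, l d ≠ 0 → ∏ i, (colorProd d i : ℝ) ≤ R) :
    |(∑ n ∈ A with n ≡ ν [MOD W], sieveSq l h n) -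
        Y / ((q₀ : ℝ) * W) * ∑ d, ∑ e, l d * l e * ∏ p : freePrimes T R,
          kern (1 / (p.1 : ℝ)) (d p) (e p)|
      ≤ B ^ 2 * (C * (Y / ((q₀ : ℝ) * Real.log N ^ ((k : ℝ) + ε)))) := by
  have := abs_sum_sieveSq_sub_le (h := h) (a₀ := a₀) (ν := ν) F.W_q₀ F.W_squarefree F.W_free
    F.q₀_free F.k_pos F.sep A hA (fun _ => 1) l hB (moduli N θ q₀ q₁)
    (fun _ r => r ≡ a₀ [MOD q₀]) (fun d e hd he => F.mem_moduli (hl d hd) (hl e he))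
    (fun _ _ _ _ _ h1 _ _ _ => h1) (fun _ _ => ⟨a₀, rfl⟩)
    (fun y => Y / ((y : ℝ) * q₀)) (Y / ((q₀ : ℝ) * W)) (fun p => 1 / (p.1 : ℝ))
    (fun U => by
      rw [prod_one_div, Nat.cast_mul, div_mul_div_comm, mul_one]
      congr 1
      ring)
    (Err := C * (Y / ((q₀ : ℝ) * Real.log N ^ ((k : ℝ) + ε))))
    (fun ρ hρ => by simpa using hI ρ hρ)
  simpa using this

/-- The substitution `n ↦ n + h m` preserves the class mod `q₀`. The shifted class is reduced: at
primes of `W` by the choice of `ν`, and at free primes because colour `m` is absent and no prime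
divides two of the `n + h i`. -/
theorem Frame.sum_sieveSq_avoid (F : Frame N θ q₀ q₁ a₀ W ν T R h) {A : Finset ℕ} {Y ε C : ℝ}
    (hA : ∀ n ∈ A, n ≡ a₀ [MOD q₀]) (m : Fin k) (ϱ : ℕ → ℝ) (Y' : ℝ)
    (hII : ∀ r : ℕ → ℕ,
      (∀ q ∈ moduli N θ q₀ q₁, r q ≡ a₀ [MOD q₀] ∧ (r q).Coprime q) →
      ∑ q ∈ moduli N θ q₀ q₁, (ArithmeticFunction.moebius q : ℝ) ^ 2 * (tau (3 * k) q : ℝ) *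
          |(∑ n ∈ ((A.image (fun x => x + h m)) ∩ A).filter (fun n => n ≡ r q [MOD q * q₀]),
              ϱ n) - Y' / ((q₀ * q).totient : ℝ)|
        ≤ C * (Y / ((q₀.totient : ℝ) * Real.log N ^ ((k : ℝ) + ε))))
    {l : (freePrimes T R → Option (Fin k)) → ℝ} {B : ℝ} (hB : ∀ d, |l d| ≤ B)
    (hl : ∀ d, l d ≠ 0 → ∏ i, (colorProd d i : ℝ) ≤ R) :
    |(∑ n ∈ (A.filter fun n => n + h m ∈ A) with n ≡ ν [MOD W],
          ϱ (n + h m) * sieveSq (avoid m l) h n) -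
        Y' / ((q₀ * W).totient : ℝ) * ∑ d, ∑ e, avoid m l d * avoid m l e *
          ∏ p : freePrimes T R, kern (1 / ((p.1 : ℝ) - 1)) (d p) (e p)|
      ≤ B ^ 2 * (C * (Y / ((q₀.totient : ℝ) * Real.log N ^ ((k : ℝ) + ε)))) := by
  have hshift : ∀ r, r + h m ≡ r [MOD q₀] := fun r => by
    have := (Nat.modEq_zero_iff_dvd.2 (F.h_dvd m)).add_left r
    simpa using this
  have hqW : ∀ p : freePrimes T R, ¬ p.1 ∣ q₀ * W := fun p hp => by
    rcases (prime_of_freePrimes p).dvd_mul.1 hp with h1 | h1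
    · exact F.q₀_free p h1
    · exact F.W_free p h1
  refine abs_sum_sieveSq_sub_le (h := h) (a₀ := a₀) (ν := ν) F.W_q₀ F.W_squarefree F.W_free
    F.q₀_free F.k_pos F.sep (A.filter fun n => n + h m ∈ A) (fun n hn => hA n (mem_filter.1 hn).1)
    (fun n => ϱ (n + h m)) (avoid m l) (fun d => (abs_avoid_le m l d).trans (hB d))
    (moduli N θ q₀ q₁) (fun y r => r ≡ a₀ [MOD q₀] ∧ (r + h m).Coprime y)
    (fun d e hd he => F.mem_moduli (hl d (avoid_ne_zero hd).1) (hl e (avoid_ne_zero he).1))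
    ?_ ?_ (fun y => Y' / ((q₀ * y).totient : ℝ)) _ (fun p => 1 / ((p.1 : ℝ) - 1))
    (fun U => by rw [← mul_assoc, div_totient_mul_setProd Y' hqW]) ?_
  · intro d e r hd he h1 h2 h3 h4
    refine ⟨h1, Nat.Coprime.mul_right ?_ ?_⟩
    · refine Nat.coprime_of_dvd fun p hp hpr hpW => F.ν_spec p hp hpW m ?_
      exact (((h2.of_dvd hpW).add_right (h m)).dvd_iff dvd_rfl).1 hpr
    · refine Nat.Coprime.prod_right fun p hp => Nat.Coprime.symm
        ((Nat.Prime.coprime_iff_not_dvd (prime_of_freePrimes p)).2 fun hpr => ?_)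
      rcases (mem_filter.1 hp).2 with h5 | h5
      · obtain ⟨i, hi⟩ := Option.ne_none_iff_exists'.1 h5
        have := F.sep p r i m (h3 p i hi) hpr
        exact (avoid_ne_zero hd).2 p (this ▸ hi)
      · obtain ⟨i, hi⟩ := Option.ne_none_iff_exists'.1 h5
        have := F.sep p r i m (h4 p i hi) hpr
        exact (avoid_ne_zero he).2 p (this ▸ hi)
  · intro y hy
    obtain ⟨h1, h2⟩ := mem_filter.1 hy
    have hy0 : 0 < y := (mem_Icc.1 h1).1
    have hyq : y.Coprime q₀ := Nat.Coprime.coprime_mul_right_right h2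
    -- Moduli not attained by any pair also need a permitted class. Take `z ≡ 1` mod `y` and
    -- subtract `h m`, realised in `ℕ` by adding `(q₀ * y - 1) * h m`.
    obtain ⟨z, hz1, hz2⟩ := Nat.chineseRemainder hyq 1 a₀
    have hqy : 0 < q₀ * y := Nat.mul_pos F.q₀_pos hy0
    refine ⟨z + (q₀ * y - 1) * h m, ?_, ?_⟩
    · have h3 : (q₀ * y - 1) * h m ≡ 0 [MOD q₀] :=
        Nat.modEq_zero_iff_dvd.2 ((F.h_dvd m).mul_left _)
      simpa using hz2.add h3
    · have h3 : z + (q₀ * y - 1) * h m + h m = z + y * (q₀ * h m) := by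
        obtain ⟨c, hc⟩ : ∃ c, q₀ * y = c + 1 := Nat.exists_eq_succ_of_ne_zero hqy.ne'
        rw [hc, Nat.add_sub_cancel]
        have : y * (q₀ * h m) = (c + 1) * h m := by rw [← hc]; ring
        rw [this]
        ring
      rw [h3, Nat.coprime_add_mul_left_left]
      have h4 := hz1.gcd_eq
      rw [Nat.Coprime, h4, Nat.gcd_one_left]
  · intro ρ hρ
    refine le_trans (le_of_eq ?_) (hII (fun q => ρ q + h m) fun q hq =>
      ⟨(hshift _).trans (hρ q hq).1, (hρ q hq).2⟩)
    refine sum_congr rfl fun q _ => ?_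
    congr 3
    refine sum_bij' (fun n _ => n + h m) (fun n _ => n - h m) ?_ ?_ ?_ ?_ ?_
    · intro n hn
      simp only [mem_filter, mem_inter, mem_image] at hn ⊢
      exact ⟨⟨⟨n, hn.1.1, rfl⟩, hn.1.2⟩, hn.2.add_right _⟩
    · intro n hn
      simp only [mem_filter, mem_inter, mem_image] at hn ⊢
      obtain ⟨⟨⟨n', hn', rfl⟩, h1⟩, h2⟩ := hn
      rw [Nat.add_sub_cancel]
      exact ⟨⟨hn', h1⟩, Nat.ModEq.add_right_cancel' _ h2⟩
    · intro n _
      exact Nat.add_sub_cancel _ _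
    · intro n hn
      simp only [mem_filter, mem_inter, mem_image] at hn
      obtain ⟨⟨⟨n', hn', rfl⟩, h1⟩, h2⟩ := hn
      rw [Nat.add_sub_cancel]
    · intro n _
      rfl

end Evaluate

/-- A translate of the tuple containing many primes gives a short set of primes. -/
theorem exists_prime_set {k t : ℕ} {A : Finset ℕ} {h : Fin k → ℕ} (hinj : Function.Injective h)
    {n : ℕ} (hn : t ≤ (univ.filter fun m : Fin k => (n + h m).Prime ∧ n + h m ∈ A).card) :
    ∃ S : Finset ℕ, S.card = t ∧ (∀ p ∈ S, p.Prime ∧ p ∈ A) ∧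
      diameter S ≤ diameter (univ.image h) := by
  obtain ⟨U, hU, hUc⟩ := exists_subset_card_eq hn
  refine ⟨U.image fun m => n + h m, ?_, ?_, ?_⟩
  · rw [card_image_of_injective _ fun a b hab => hinj (Nat.add_left_cancel hab), hUc]
  · intro p hp
    obtain ⟨m, hm, rfl⟩ := mem_image.1 hp
    exact (mem_filter.1 (hU hm)).2
  · unfold diameter
    split_ifs with h1 h2
    · obtain ⟨m, _, hm⟩ := mem_image.1 (max'_mem _ h1)
      obtain ⟨m', _, hm'⟩ := mem_image.1 (min'_mem _ h1)
      have h3 := le_max' (univ.image h) (h m) (mem_image_of_mem _ (mem_univ m))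
      have h4 := min'_le (univ.image h) (h m') (mem_image_of_mem _ (mem_univ m'))
      rw [← hm, ← hm']
      omega
    · obtain ⟨m, hm⟩ := h1.of_image
      exact absurd ⟨h m, mem_image_of_mem _ (mem_univ m)⟩ h2
    · exact Nat.zero_le _
    · exact le_rfl

end

end PrimeGaps

/-! ### Counting primes through the minorant; sizes of the parameters -/

namespace PrimeGaps

open Finset

noncomputable section

/-- If no translate of the tuple contains more than `c` primes of `A`, then a weighted sum of a
minorant for the primes is at most `c` times the total weight. -/
theorem sum_minorant_le {k : ℕ} {A X : Finset ℕ} {h : Fin k → ℕ} {w f : ℕ → ℝ}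
    (hw : ∀ n, 0 ≤ w n) (hf : ∀ n ∈ A, f n ≤ if n.Prime then 1 else 0) {c : ℝ}
    (hc : ∀ n ∈ X,
      ((univ.filter fun m : Fin k => (n + h m).Prime ∧ n + h m ∈ A).card : ℝ) ≤ c) :
    ∑ m, ∑ n ∈ X.filter (fun n => n + h m ∈ A), f (n + h m) * w n ≤ c * ∑ n ∈ X, w n := by
  simp_rw [sum_filter]
  rw [sum_comm, mul_sum]
  refine sum_le_sum fun n hn => ?_
  refine le_trans ?_ (mul_le_mul_of_nonneg_right (hc n hn) (hw n))
  rw [card_filter, Nat.cast_sum, sum_mul]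
  refine sum_le_sum fun m _ => ?_
  by_cases hA : n + h m ∈ A
  · have := mul_le_mul_of_nonneg_right (hf _ hA) (hw n)
    simpa [hA] using this
  · simp [hA]

/-- Termwise approximation of a sum with signs. -/
theorem signed_sum_ge {s : ℕ} (a : ℕ) {x y : Fin s → ℝ} {e : ℝ} (hxy : ∀ g, |x g - y g| ≤ e) :
    ((∑ g with g.val < a, y g) - ∑ g with ¬ g.val < a, y g) - s * e ≤
      (∑ g with g.val < a, x g) - ∑ g with ¬ g.val < a, x g := by
  have h1 : (s : ℝ) * e = (∑ g : Fin s with g.val < a, e) + ∑ g : Fin s with ¬ g.val < a, e := by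
    rw [sum_filter_add_sum_filter_not]
    simp
  rw [h1]
  have h2 : ∑ g : Fin s with g.val < a, (y g - e) ≤ ∑ g : Fin s with g.val < a, x g :=
    sum_le_sum fun g _ => by linarith [(abs_le.1 (hxy g)).1]
  have h3 : ∑ g : Fin s with ¬ g.val < a, x g ≤ ∑ g : Fin s with ¬ g.val < a, (y g + e) :=
    sum_le_sum fun g _ => by linarith [(abs_le.1 (hxy g)).2]
  rw [sum_sub_distrib] at h2
  rw [sum_add_distrib] at h3
  linarith

/-- The quantitative smallness of the parameters of a `Frame`. -/
structure Scale (k : ℕ) (N θ' ε κ : ℝ) (q₀ W : ℕ) (T : Finset ℕ) (R : ℝ) : Prop where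
  κ_pos : 0 < κ
  κ_le_one : κ ≤ 1
  exp_le : Real.exp κ ≤ 2
  log_pos : 0 < Real.log N
  θ'_pos : 0 < θ'
  log_R : Real.log R = θ' * Real.log N
  one_lt_R : 1 < R
  W_le : (W : ℝ) ≤ κ * Real.log N ^ ε
  tail_le : tailSum T R ≤ κ
  large : ∀ p : freePrimes T R, (k : ℝ) + 3 ≤ p.1
  T_prime : ∀ p ∈ T, p.Prime
  sieve : ∀ x : ℝ, 1 ≤ x →
    |siftedSum T x - density T * Real.log x| ≤ κ * density T * Real.log R
  density_le : density T ≤ (q₀.totient : ℝ) / q₀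
  le_totient : (1 - κ) / ((q₀ : ℝ) * W * density T) ≤ 1 / ((q₀ * W).totient : ℝ)

section Scale

variable {k : ℕ} {N θ' ε κ : ℝ} {q₀ W : ℕ} {T : Finset ℕ} {R : ℝ}

theorem Scale.density_mul_log_pos (S : Scale k N θ' ε κ q₀ W T R) :
    0 < density T * Real.log R :=
  mul_pos (density_pos S.T_prime) (Real.log_pos S.one_lt_R)

theorem Scale.siftedSum_le (S : Scale k N θ' ε κ q₀ W T R) :
    siftedSum T R ≤ density T * Real.log R * (1 + κ) := by
  have := (abs_le.1 (S.sieve R S.one_lt_R.le)).2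
  linarith

theorem Scale.abs_stepWeight_le (S : Scale k N θ' ε κ q₀ W T R) {M : ℕ} (hM : 0 < M)
    {Φ : (Fin k → ℕ) → ℝ} (hΦ : ∀ j, Φ j ≠ 0 → ∑ i, (j i + 1) ≤ M) {B : ℝ} (hB : ∀ j, |Φ j| ≤ B)
    (d : freePrimes T R → Option (Fin k)) :
    |stepWeight Φ M d| ≤ B * (4 * (density T * Real.log R)) ^ k := by
  have hB0 : 0 ≤ B := (abs_nonneg _).trans (hB fun _ => 0)
  refine (PrimeGaps.abs_stepWeight_le hM S.one_lt_R S.T_prime hΦ hB d).trans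
    (mul_le_mul_of_nonneg_left (pow_le_pow_left₀ (mul_nonneg (siftedSum_nonneg _ _) ?_) ?_ k) hB0)
  · exact prod_nonneg fun p _ => by
      have h1 := S.large p
      have h2 : (0 : ℝ) ≤ k := Nat.cast_nonneg k
      have h3 : (0 : ℝ) ≤ (p.1 : ℝ) - 1 := by linarith
      positivity
  · have hP := S.density_mul_log_pos
    have h1 : ∏ p : freePrimes T R, (1 + 1 / ((p.1 : ℝ) * ((p.1 : ℝ) - 1))) ≤ 2 :=
      (prod_one_add_tail_le T R).trans ((Real.exp_le_exp.2 S.tail_le).trans S.exp_le)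
    have h2 : siftedSum T R ≤ density T * Real.log R * 2 :=
      S.siftedSum_le.trans (mul_le_mul_of_nonneg_left (by linarith [S.κ_le_one]) hP.le)
    calc siftedSum T R * ∏ p : freePrimes T R, (1 + 1 / ((p.1 : ℝ) * ((p.1 : ℝ) - 1)))
        ≤ siftedSum T R * 2 := mul_le_mul_of_nonneg_left h1 (siftedSum_nonneg _ _)
      _ ≤ density T * Real.log R * 2 * 2 := mul_le_mul_of_nonneg_right h2 (by norm_num)
      _ = 4 * (density T * Real.log R) := by ring

/-- The squared weights have size `(density T * log R) ^ (2 k)`. Half of this power stays in the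
main term; the other half is `density T ^ k * θ' ^ k * log N ^ k`, whose logarithms cancel and whose
density is absorbed by `y`, namely `q₀` for (I) and its totient for (II). The remaining `log N ^ ε`
beats `W`. -/
theorem Scale.error_le (S : Scale k N θ' ε κ q₀ W T R) (hq₀ : 0 < q₀) (hW : 0 < W) {y B C Y : ℝ}
    (hy : density T ^ k * q₀ ≤ y) (hC : 0 ≤ C) (hY : 0 ≤ Y) :
    (B * (4 * (density T * Real.log R)) ^ k) ^ 2 * (C * (Y / (y * Real.log N ^ ((k : ℝ) + ε)))) ≤
      Y / ((q₀ : ℝ) * W) * (density T * Real.log R) ^ k * (B ^ 2 * 16 ^ k * C * θ' ^ k * κ) := by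
  have hL := S.log_pos
  have hV := density_pos S.T_prime
  have hP := S.density_mul_log_pos
  have hq : (0 : ℝ) < q₀ := Nat.cast_pos.2 hq₀
  have hW' : (0 : ℝ) < W := Nat.cast_pos.2 hW
  have hy0 : 0 < y := lt_of_lt_of_le (by positivity) hy
  have hLε : 0 < Real.log N ^ ε := Real.rpow_pos_of_pos hL _
  rw [Real.rpow_add hL, Real.rpow_natCast]
  have h1 : (density T ^ k * q₀) * W ≤ y * (κ * Real.log N ^ ε) :=
    mul_le_mul hy S.W_le hW'.le hy0.le
  have h2 : density T ^ k / (y * Real.log N ^ ε) ≤ κ / (q₀ * W) := by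
    rw [div_le_div_iff₀ (by positivity) (by positivity)]
    linarith
  have h16 : ((4 : ℝ) ^ k) ^ 2 = 16 ^ k := by rw [← pow_mul, mul_comm, pow_mul]; norm_num
  have h3 : (B * (4 * (density T * Real.log R)) ^ k) ^ 2 *
      (C * (Y / (y * (Real.log N ^ k * Real.log N ^ ε)))) =
      (B ^ 2 * 16 ^ k * C * θ' ^ k * Y * (density T * Real.log R) ^ k) *
        (density T ^ k / (y * Real.log N ^ ε)) := by
    have h4 : (density T * Real.log R) ^ k = density T ^ k * θ' ^ k * Real.log N ^ k := by
      rw [S.log_R]; ring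
    have h5 : (B * (4 * (density T * Real.log R)) ^ k) ^ 2 =
      B ^ 2 * 16 ^ k * (density T * Real.log R) ^ k *
        (density T ^ k * θ' ^ k * Real.log N ^ k) := by
      rw [← h4, ← h16, mul_pow]; ring
    rw [h5]
    field_simp
  rw [h3]
  have hθ := S.θ'_pos
  refine (mul_le_mul_of_nonneg_left h2 (by positivity)).trans (le_of_eq ?_)
  field_simp

end Scale

end

end PrimeGaps

/-! ### The two main estimates and their comparison -/

namespace PrimeGaps

open Finset

noncomputable section

section Bounds

variable {k : ℕ} {N θ θ' ε κ : ℝ} {q₀ q₁ a₀ W ν : ℕ} {T : Finset ℕ} {R : ℝ} {h : Fin k → ℕ}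
  {M : ℕ} {Φ : (Fin k → ℕ) → ℝ} {A : Finset ℕ} {B C Y : ℝ}

theorem Frame.sum_sieveSq_stepWeight_le (F : Frame N θ q₀ q₁ a₀ W ν T R h)
    (S : Scale k N θ' ε κ q₀ W T R) (hM : 0 < M)
    (hΦ : ∀ j, Φ j ≠ 0 → ∑ i, (j i + 1) ≤ M) (hB : ∀ j, |Φ j| ≤ B)
    (hA : ∀ n ∈ A, n ≡ a₀ [MOD q₀]) (hI : RegularityI k θ ε C N A Y q₀ q₁ a₀)
    (hC : 0 ≤ C) (hY : 0 ≤ Y) :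
    ∑ n ∈ A with n ≡ ν [MOD W], sieveSq (stepWeight Φ M : (freePrimes T R → _) → ℝ) h n ≤
      Y / ((q₀ : ℝ) * W) * (density T * Real.log R) ^ k *
        (Real.exp (2 * κ) * ((1 / M + 2 * κ) ^ k * ∑ j ∈ grid (Fin k) M, Φ j ^ 2) +
          B ^ 2 * 16 ^ k * C * θ' ^ k * κ) := by
  have hk0 : (0 : ℝ) ≤ k := Nat.cast_nonneg k
  have hW : 0 < W := Nat.pos_of_ne_zero F.W_squarefree.ne_zero
  have hP := S.density_mul_log_pos
  have hκ := S.κ_pos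
  have h1 := (abs_le.1 (F.sum_sieveSq hA hI (S.abs_stepWeight_le hM hΦ hB)
    fun d hd => prod_colorProd_le_of_stepWeight_ne_zero hM S.one_lt_R hΦ hd)).2
  have hVk : density T ^ k * q₀ ≤ q₀ := mul_le_of_le_one_left (Nat.cast_nonneg _)
    (pow_le_one₀ (density_pos S.T_prime).le (density_le_one S.T_prime))
  have h2 := S.error_le (B := B) F.q₀_pos hW hVk hC hY
  have h3 := stepForm_le hM S.one_lt_R S.T_prime hΦ S.sieve
    (fun p => by linarith [S.large p]) (fun p => by linarith [S.large p])
  have h4 : ∏ p : freePrimes T R, (1 + 1 / ((p.1 : ℝ) * ((p.1 : ℝ) - 2))) ≤ Real.exp (2 * κ) :=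
    (prod_one_add_tail_two_le fun p => by linarith [S.large p]).trans
      (Real.exp_le_exp.2 (by linarith [S.tail_le]))
  have h5 : 0 ≤ (density T * Real.log R * (1 / M + 2 * κ)) ^ k * ∑ j ∈ grid (Fin k) M, Φ j ^ 2 :=
    mul_nonneg (by positivity) (sum_nonneg fun j _ => sq_nonneg _)
  have h6 := mul_le_mul_of_nonneg_left (h3.trans (mul_le_mul_of_nonneg_right h4 h5))
    (by positivity : 0 ≤ Y / ((q₀ : ℝ) * W))
  have h7 : Y / ((q₀ : ℝ) * W) * (Real.exp (2 * κ) *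
      ((density T * Real.log R * (1 / M + 2 * κ)) ^ k * ∑ j ∈ grid (Fin k) M, Φ j ^ 2)) =
      Y / ((q₀ : ℝ) * W) * (density T * Real.log R) ^ k *
        (Real.exp (2 * κ) * ((1 / M + 2 * κ) ^ k * ∑ j ∈ grid (Fin k) M, Φ j ^ 2)) := by
    rw [mul_pow]; ring
  rw [h7] at h6
  rw [mul_add]
  linarith

/-- All `ϱ_g` meet the same form `Q`, so only the signed sum of the `Y' g` matters, and it is at
least `Y (b - s κ) / log N`. The sieve square may be replaced by its version without colour `m`
because `ϱ_g` vanishes where they differ. -/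
theorem Frame.le_sum_minorant (F : Frame N θ q₀ q₁ a₀ W ν T R h)
    (S : Scale k N θ' ε κ q₀ W T R) (hM : 0 < M) (hΦ0 : ∀ j, 0 ≤ Φ j)
    (hΦ : ∀ j, Φ j ≠ 0 → ∑ i, (j i + 1) ≤ M) (hB : ∀ j, |Φ j| ≤ B)
    (hA : ∀ n ∈ A, n ≡ a₀ [MOD q₀]) (hC : 0 ≤ C) (hY : 0 ≤ Y) (hκM : 2 * κ ≤ 1 / M)
    {s a : ℕ} (m : Fin k) {β Y' : Fin s → ℝ} {b : ℝ}
    (hβ : b ≤ (∑ g with g.val < a, β g) - ∑ g with ¬ g.val < a, β g) (hb : s * κ ≤ b)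
    (hY' : ∀ g, ∃ e : ℝ, |e| ≤ κ ∧ Y' g = Y * (β g + e) / Real.log N)
    (ϱ : Fin s → ℕ → ℝ)
    (hII : ∀ g, ∀ r : ℕ → ℕ,
      (∀ q ∈ moduli N θ q₀ q₁, r q ≡ a₀ [MOD q₀] ∧ (r q).Coprime q) →
      ∑ q ∈ moduli N θ q₀ q₁, (ArithmeticFunction.moebius q : ℝ) ^ 2 * (tau (3 * k) q : ℝ) *
          |(∑ n ∈ ((A.image (fun x => x + h m)) ∩ A).filter (fun n => n ≡ r q [MOD q * q₀]),
              ϱ g n) - Y' g / ((q₀ * q).totient : ℝ)|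
        ≤ C * (Y / ((q₀.totient : ℝ) * Real.log N ^ ((k : ℝ) + ε))))
    (hsupp : ∀ g, ∀ n ∈ A, (∃ p : freePrimes T R, p.1 ∣ n) → ϱ g n = 0) :
    Y / ((q₀ : ℝ) * W) * (density T * Real.log R) ^ k *
      ((b - s * κ) * (1 - κ) * θ' * ((1 / M - 2 * κ) ^ (k + 1) *
          (∑ j ∈ grid (Fin k) M, ∑ l ∈ range M, Φ j * Φ (Function.update j m l)) -
          B ^ 2 * (6 * k ^ 2 * κ * (1 + κ) ^ (k + 1))) -
        s * (B ^ 2 * 16 ^ k * C * θ' ^ k * κ)) ≤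
    ∑ n ∈ (A.filter fun n => n ≡ ν [MOD W]).filter (fun n => n + h m ∈ A),
      ((∑ g with g.val < a, ϱ g (n + h m)) - ∑ g with ¬ g.val < a, ϱ g (n + h m)) *
        sieveSq (stepWeight Φ M : (freePrimes T R → _) → ℝ) h n := by
  have hW : 0 < W := Nat.pos_of_ne_zero F.W_squarefree.ne_zero
  have hq : (0 : ℝ) < q₀ := Nat.cast_pos.2 F.q₀_pos
  have hW' : (0 : ℝ) < W := Nat.cast_pos.2 hW
  have hP := S.density_mul_log_pos
  have hV := density_pos S.T_prime
  have hκ := S.κ_pos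
  have hκ1 := S.κ_le_one
  have hL := S.log_pos
  have hB2 : 0 ≤ B ^ 2 := sq_nonneg B
  have hVk : density T ^ k * q₀ ≤ q₀.totient := by
    have h1 : density T ^ k ≤ density T :=
      pow_le_of_le_one hV.le (density_le_one S.T_prime) F.k_pos.ne'
    exact (le_div_iff₀ hq).1 (h1.trans S.density_le)
  have herr := S.error_le (B := B) F.q₀_pos hW hVk hC hY
  set E := B ^ 2 * 16 ^ k * C * θ' ^ k * κ
  set P := density T * Real.log R with hPdef
  set Z := Y / ((q₀ : ℝ) * W) * P ^ k with hZ
  set J := ∑ j ∈ grid (Fin k) M, ∑ l ∈ range M, Φ j * Φ (Function.update j m l)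
  set l : (freePrimes T R → Option (Fin k)) → ℝ := stepWeight Φ M with hl
  set Q := ∑ d, ∑ e, avoid m l d * avoid m l e *
          ∏ p : freePrimes T R, kern (1 / ((p.1 : ℝ) - 1)) (d p) (e p) with hQ
  -- Needed separately: the explicit lower bound for `Q` is not known to be nonnegative.
  have hQ0 : 0 ≤ Q := stepForm_avoid_nonneg (fun p => by linarith [S.large p]) m
  have hQlow : P ^ (k + 1) * ((1 / M - 2 * κ) ^ (k + 1) * J -
      B ^ 2 * (6 * k ^ 2 * κ * (1 + κ) ^ (k + 1))) ≤ Q := by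
    refine le_trans ?_ (le_stepForm_avoid hM S.one_lt_R S.T_prime hΦ0 hB hκM S.sieve
      (fun p => by linarith [S.large p]) m)
    have h1 : siftedSum T R ^ (k + 1) ≤ (P * (1 + κ)) ^ (k + 1) :=
      pow_le_pow_left₀ (siftedSum_nonneg _ _) S.siftedSum_le _
    have h2 : tailSum T R * siftedSum T R ^ (k + 1) ≤ κ * (P * (1 + κ)) ^ (k + 1) :=
      mul_le_mul S.tail_le h1 (pow_nonneg (siftedSum_nonneg _ _) _) hκ.le
    have h3 := mul_le_mul_of_nonneg_left h2 (by positivity : 0 ≤ B ^ 2 * (6 * (k : ℝ) ^ 2))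
    rw [mul_pow] at h3
    have h4 : (density T * Real.log R * (1 / M - 2 * κ)) ^ (k + 1) =
        P ^ (k + 1) * (1 / M - 2 * κ) ^ (k + 1) := mul_pow _ _ _
    rw [h4]
    linarith
  have hsum : ∀ g, |(∑ n ∈ (A.filter fun n => n ≡ ν [MOD W]).filter (fun n => n + h m ∈ A),
      ϱ g (n + h m) * sieveSq l h n) - Y' g / ((q₀ * W).totient : ℝ) * Q| ≤ Z * E := by
    intro g
    have h1 := F.sum_sieveSq_avoid hA m (ϱ g) (Y' g) (hII g)
      (S.abs_stepWeight_le hM hΦ hB)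
      fun d hd => prod_colorProd_le_of_stepWeight_ne_zero hM S.one_lt_R hΦ hd
    refine le_trans (le_of_eq ?_) (h1.trans herr)
    congr 2
    rw [filter_comm]
    refine sum_congr rfl fun n hn => ?_
    have hn' : n + h m ∈ A := (mem_filter.1 (mem_filter.1 hn).1).2
    by_cases hp : ∃ p : freePrimes T R, p.1 ∣ n + h m
    · rw [hsupp g _ hn' hp, zero_mul, zero_mul]
    · rw [sieveSq_avoid _ fun p hp' => hp ⟨p, hp'⟩]
  have h1 := signed_sum_ge a hsum
  have h2 : ∑ n ∈ (A.filter fun n => n ≡ ν [MOD W]).filter (fun n => n + h m ∈ A),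
      ((∑ g with g.val < a, ϱ g (n + h m)) - ∑ g with ¬ g.val < a, ϱ g (n + h m)) *
        sieveSq l h n =
      (∑ g with g.val < a, ∑ n ∈ (A.filter fun n => n ≡ ν [MOD W]).filter
        (fun n => n + h m ∈ A), ϱ g (n + h m) * sieveSq l h n) -
      ∑ g with ¬ g.val < a, ∑ n ∈ (A.filter fun n => n ≡ ν [MOD W]).filter
        (fun n => n + h m ∈ A), ϱ g (n + h m) * sieveSq l h n := by
    simp_rw [sub_mul, sum_sub_distrib, sum_mul]
    congr 1 <;> exact sum_comm
  rw [h2]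
  refine le_trans ?_ h1
  have h3 : Y * (b - s * κ) / Real.log N ≤
      (∑ g with g.val < a, Y' g) - ∑ g with ¬ g.val < a, Y' g := by
    have h4 := signed_sum_ge a (x := Y') (y := fun g => Y / Real.log N * β g)
      (e := Y / Real.log N * κ) fun g => by
        obtain ⟨e, he, hY'e⟩ := hY' g
        have : Y' g - Y / Real.log N * β g = Y / Real.log N * e := by rw [hY'e]; ring
        rw [this, abs_mul, abs_of_nonneg (by positivity : 0 ≤ Y / Real.log N)]
        exact mul_le_mul_of_nonneg_left he (by positivity)
    refine le_trans ?_ h4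
    rw [← mul_sum, ← mul_sum, ← mul_sub]
    have h5 := mul_le_mul_of_nonneg_left hβ (by positivity : 0 ≤ Y / Real.log N)
    have h6 : Y * (b - s * κ) / Real.log N =
      Y / Real.log N * b - s * (Y / Real.log N * κ) := by ring
    linarith
  have h4 : Y * (b - s * κ) / Real.log N * ((1 - κ) / ((q₀ : ℝ) * W * density T)) ≤
      ((∑ g with g.val < a, Y' g) - ∑ g with ¬ g.val < a, Y' g) *
        (1 / ((q₀ * W).totient : ℝ)) := by
    have h5 : 0 ≤ Y * (b - s * κ) / Real.log N :=
      div_nonneg (mul_nonneg hY (by linarith)) hL.le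
    exact mul_le_mul h3 S.le_totient (div_nonneg (by linarith) (by positivity)) (h5.trans h3)
  have h5 : ((∑ g with g.val < a, Y' g / ((q₀ * W).totient : ℝ) * Q) -
      ∑ g with ¬ g.val < a, Y' g / ((q₀ * W).totient : ℝ) * Q) =
      ((∑ g with g.val < a, Y' g) - ∑ g with ¬ g.val < a, Y' g) *
        (1 / ((q₀ * W).totient : ℝ)) * Q := by
    rw [← sum_mul, ← sum_mul, ← sum_div, ← sum_div]
    ring
  rw [h5, mul_sub]
  have h6 : Z * (s * E) = s * (Z * E) := by ring
  rw [h6]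
  refine sub_le_sub_right ?_ _
  have hc0 : 0 ≤ Y * (b - s * κ) / Real.log N * ((1 - κ) / ((q₀ : ℝ) * W * density T)) :=
    mul_nonneg (div_nonneg (mul_nonneg hY (by linarith)) hL.le)
      (div_nonneg (by linarith) (by positivity))
  refine le_trans ?_ ((mul_le_mul_of_nonneg_left hQlow hc0).trans
    (mul_le_mul_of_nonneg_right h4 hQ0))
  refine le_of_eq ?_
  have h7 : P ^ (k + 1) = P ^ k * (density T * (θ' * Real.log N)) := by
    rw [pow_succ, hPdef, S.log_R]
  rw [h7, hZ]
  field_simp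

/-- The comparison of the two sums produces a translate with many primes. -/
theorem Frame.exists_many_primes (F : Frame N θ q₀ q₁ a₀ W ν T R h)
    (S : Scale k N θ' ε κ q₀ W T R) (hM : 0 < M) (hΦ0 : ∀ j, 0 ≤ Φ j)
    (hΦ : ∀ j, Φ j ≠ 0 → ∑ i, (j i + 1) ≤ M) (hB : ∀ j, |Φ j| ≤ B)
    (hA : ∀ n ∈ A, n ≡ a₀ [MOD q₀]) (hI : RegularityI k θ ε C N A Y q₀ q₁ a₀)
    (hC : 0 ≤ C) (hY : 0 < Y) (hκM : 2 * κ ≤ 1 / M)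
    {s a t : ℕ} (ht : 1 ≤ t) {β Y' : Fin s → Fin k → ℝ} {b : ℝ}
    (hβ : ∀ m, b ≤ (∑ g with g.val < a, β g m) - ∑ g with ¬ g.val < a, β g m)
    (hb : s * κ ≤ b)
    (hY' : ∀ g m, ∃ e : ℝ, |e| ≤ κ ∧ Y' g m = Y * (β g m + e) / Real.log N)
    (ϱ : Fin s → ℕ → ℝ)
    (hII : ∀ m g, ∀ r : ℕ → ℕ,
      (∀ q ∈ moduli N θ q₀ q₁, r q ≡ a₀ [MOD q₀] ∧ (r q).Coprime q) →
      ∑ q ∈ moduli N θ q₀ q₁, (ArithmeticFunction.moebius q : ℝ) ^ 2 * (tau (3 * k) q : ℝ) *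
          |(∑ n ∈ ((A.image (fun x => x + h m)) ∩ A).filter (fun n => n ≡ r q [MOD q * q₀]),
              ϱ g n) - Y' g m / ((q₀ * q).totient : ℝ)|
        ≤ C * (Y / ((q₀.totient : ℝ) * Real.log N ^ ((k : ℝ) + ε))))
    (hsupp : ∀ g, ∀ n ∈ A, (∃ p : freePrimes T R, p.1 ∣ n) → ϱ g n = 0)
    (hmin : ∀ n ∈ A, (∑ g with g.val < a, ϱ g n) - (∑ g with ¬ g.val < a, ϱ g n)
        ≤ if n.Prime then (1 : ℝ) else 0)
    (hκ : ((t : ℝ) - 1) * (Real.exp (2 * κ) *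
          ((1 / M + 2 * κ) ^ k * ∑ j ∈ grid (Fin k) M, Φ j ^ 2) +
          B ^ 2 * 16 ^ k * C * θ' ^ k * κ) <
      ∑ m : Fin k, ((b - s * κ) * (1 - κ) * θ' * ((1 / M - 2 * κ) ^ (k + 1) *
          (∑ j ∈ grid (Fin k) M, ∑ l ∈ range M, Φ j * Φ (Function.update j m l)) -
          B ^ 2 * (6 * k ^ 2 * κ * (1 + κ) ^ (k + 1))) -
        s * (B ^ 2 * 16 ^ k * C * θ' ^ k * κ))) :
    ∃ n, t ≤ (univ.filter fun m : Fin k => (n + h m).Prime ∧ n + h m ∈ A).card := by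
  by_contra! hcon
  have ht' : (0 : ℝ) ≤ (t : ℝ) - 1 := by
    have : (1 : ℝ) ≤ t := by exact_mod_cast ht
    linarith
  have hW : (0 : ℝ) < W := Nat.cast_pos.2 (Nat.pos_of_ne_zero F.W_squarefree.ne_zero)
  have hq : (0 : ℝ) < q₀ := Nat.cast_pos.2 F.q₀_pos
  have hZ : 0 < Y / ((q₀ : ℝ) * W) * (density T * Real.log R) ^ k := by
    have := S.density_mul_log_pos
    positivity
  have h1 := sum_minorant_le (X := A.filter fun n => n ≡ ν [MOD W])
    (sieveSq_nonneg (stepWeight Φ M : (freePrimes T R → _) → ℝ) h) hmin (c := (t : ℝ) - 1)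
    fun n _ => by
      have h2 : (univ.filter fun m : Fin k => (n + h m).Prime ∧ n + h m ∈ A).card + 1 ≤ t :=
        hcon n
      have h3 : (((univ.filter fun m : Fin k => (n + h m).Prime ∧ n + h m ∈ A).card + 1 : ℕ) : ℝ)
        ≤ t := by exact_mod_cast h2
      push_cast at h3
      linarith
  have h2 := mul_le_mul_of_nonneg_left
    (F.sum_sieveSq_stepWeight_le S hM hΦ hB hA hI hC hY.le) ht'
  have h3 := sum_le_sum fun m (_ : m ∈ (univ : Finset (Fin k))) =>
    F.le_sum_minorant S hM hΦ0 hΦ hB hA hC hY.le hκM (a := a) m (hβ m) hb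
      (fun g => hY' g m) ϱ (hII m) hsupp
  rw [← mul_sum] at h3
  have h4 := mul_lt_mul_of_pos_left hκ hZ
  linarith

end Bounds

end

end PrimeGaps

/-! ### Choice of the parameters -/

namespace PrimeGaps

open Finset Filter

noncomputable section

/-- Only some `k' ≤ k` is obtained, so monotonicity of `bigM` is not needed: the sieve is run on
`k'` elements of the tuple, and the hypotheses for `k` imply those for `k'`. -/
theorem exists_lt_bigM_of_kZero_le {t k : ℕ} {b θ : ℝ} (h : kZero t b θ ≤ (k : ℕ∞)) :
    ∃ k' ≤ k, (((2 * (t : ℝ) - 2) / (b * θ) : ℝ) : EReal) < bigM k' := by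
  by_contra! hcon
  have h1 : ((k + 1 : ℕ) : ℕ∞) ≤ kZero t b θ := le_iInf₂ fun j hj => by
    have : k + 1 ≤ j := by
      by_contra! hlt
      exact absurd hj (not_lt.2 (hcon j (by omega)))
    exact_mod_cast this
  have h2 : k + 1 ≤ k := by exact_mod_cast h1.trans h
  omega

theorem tau_mono_of_squarefree {i j q : ℕ} (hij : i ≤ j) (hq : Squarefree q) :
    tau i q ≤ tau j q := by
  rw [tau, tau, Nat.card_finMulAntidiag_of_squarefree hq, Nat.card_finMulAntidiag_of_squarefree hq]
  exact Nat.pow_le_pow_left hij _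

theorem moebius_sq_mul_tau_mono {i j : ℕ} (hij : i ≤ j) (q : ℕ) :
    (ArithmeticFunction.moebius q : ℝ) ^ 2 * (tau i q : ℝ) ≤
      (ArithmeticFunction.moebius q : ℝ) ^ 2 * (tau j q : ℝ) := by
  by_cases hq : Squarefree q
  · exact mul_le_mul_of_nonneg_left (Nat.cast_le.2 (tau_mono_of_squarefree hij hq)) (sq_nonneg _)
  · simp [ArithmeticFunction.moebius_eq_zero_of_not_squarefree hq]

theorem error_mono {k' k : ℕ} (hk : k' ≤ k) {N ε C Y y : ℝ} (hN : 1 ≤ Real.log N) (hY : 0 ≤ Y)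
    (hy : 0 < y) :
    C * (Y / (y * Real.log N ^ ((k : ℝ) + ε))) ≤
      |C| * (Y / (y * Real.log N ^ ((k' : ℝ) + ε))) := by
  have h0 : 0 < Real.log N ^ ((k' : ℝ) + ε) := Real.rpow_pos_of_pos (by linarith) _
  have h1 : Real.log N ^ ((k' : ℝ) + ε) ≤ Real.log N ^ ((k : ℝ) + ε) :=
    Real.rpow_le_rpow_of_exponent_le hN (by have : (k' : ℝ) ≤ k := Nat.cast_le.2 hk
                                            linarith)
  have h2 : Y / (y * Real.log N ^ ((k : ℝ) + ε)) ≤ Y / (y * Real.log N ^ ((k' : ℝ) + ε)) :=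
    div_le_div_of_nonneg_left hY (by positivity) (mul_le_mul_of_nonneg_left h1 hy.le)
  have h3 : 0 ≤ Y / (y * Real.log N ^ ((k : ℝ) + ε)) :=
    div_nonneg hY (mul_nonneg hy.le (h0.le.trans h1))
  exact mul_le_mul (le_abs_self C) h2 h3 (abs_nonneg C)

theorem RegularityI.mono {k' k : ℕ} (hk : k' ≤ k) {θ ε C N : ℝ} {A : Finset ℕ} {Y : ℝ}
    {q₀ q₁ a₀ : ℕ} (h : RegularityI k θ ε C N A Y q₀ q₁ a₀) (hN : 1 ≤ Real.log N) (hY : 0 ≤ Y)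
    (hq₀ : 0 < q₀) : RegularityI k' θ ε |C| N A Y q₀ q₁ a₀ := fun r hr =>
  (sum_le_sum fun q _ => mul_le_mul_of_nonneg_right
    (moebius_sq_mul_tau_mono (by omega : 3 * k' ≤ 3 * k) q) (abs_nonneg _)).trans
      ((h r hr).trans (error_mono hk hN hY (Nat.cast_pos.2 hq₀)))

theorem Setting.comp {k' k : ℕ} {N δ : ℝ} {A : Finset ℕ} {Y : ℝ} {q₀ q₁ a₀ : ℕ} {h : Fin k → ℕ}
    (S : Setting N δ A Y q₀ q₁ a₀ h) {f : Fin k' → Fin k} (hf : Function.Injective f) :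
    Setting N δ A Y q₀ q₁ a₀ (h ∘ f) :=
  { S with
    h_injective := S.h_injective.comp hf
    h_admissible := fun p hp => by
      obtain ⟨a, ha⟩ := S.h_admissible p hp
      refine ⟨a, fun x hx => ha x ?_⟩
      obtain ⟨m, _, rfl⟩ := mem_image.1 hx
      exact mem_image_of_mem _ (mem_univ _)
    h_dvd := fun m => S.h_dvd _
    h_diff := fun m m' hm => S.h_diff _ _ (hf.ne hm) }

theorem diameter_mono {S S' : Finset ℕ} (h : S ⊆ S') : diameter S ≤ diameter S' := by
  unfold diameter
  split_ifs with h1 h2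
  · have h3 := le_max' S' _ (h (max'_mem S h1))
    have h4 := min'_le S' _ (h (min'_mem S h1))
    omega
  · exact absurd (h1.mono h) h2
  · exact Nat.zero_le _
  · exact le_rfl

/-- The main inequality survives a small perturbation of the parameters. -/
theorem exists_perturbation {k M s : ℕ} (hM : 0 < M) {τ I B C θ' b : ℝ} (J : Fin k → ℝ)
    (hb : 0 < b) (h : τ * M * I < b * θ' * ∑ m, J m) :
    ∃ κ : ℝ, 0 < κ ∧ κ ≤ 1 ∧ Real.exp κ ≤ 2 ∧ 2 * κ ≤ 1 / M ∧ s * κ ≤ b ∧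
      τ * (Real.exp (2 * κ) * ((1 / M + 2 * κ) ^ k * I) + B ^ 2 * 16 ^ k * C * θ' ^ k * κ) <
      ∑ m : Fin k, ((b - s * κ) * (1 - κ) * θ' * ((1 / M - 2 * κ) ^ (k + 1) * J m -
          B ^ 2 * (6 * k ^ 2 * κ * (1 + κ) ^ (k + 1))) -
        s * (B ^ 2 * 16 ^ k * C * θ' ^ k * κ)) := by
  have hM' : (0 : ℝ) < M := Nat.cast_pos.2 hM
  -- Every requirement is a strict inequality at `κ = 0` between continuous functions of `κ`, hence
  -- persists for small `κ > 0`.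
  have ev : ∀ f g : ℝ → ℝ, Continuous f → Continuous g → f 0 < g 0 →
      ∀ᶠ κ in nhdsWithin (0 : ℝ) (Set.Ioi 0), f κ < g κ := fun f g hf hg hfg =>
    nhdsWithin_le_nhds (hf.continuousAt.eventually_lt hg.continuousAt hfg)
  have e1 := ev (fun κ => κ) (fun _ => 1) (by fun_prop) (by fun_prop) one_pos
  have e2 := ev (fun κ => Real.exp κ) (fun _ => 2) (by fun_prop) (by fun_prop) (by simp)
  have e3 := ev (fun κ => 2 * κ) (fun _ => 1 / M) (by fun_prop) (by fun_prop) (by simpa using hM)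
  have e4 := ev (fun κ => s * κ) (fun _ => b) (by fun_prop) (by fun_prop) (by simpa using hb)
  have e5 := ev (fun κ => τ * (Real.exp (2 * κ) * ((1 / M + 2 * κ) ^ k * I) +
      B ^ 2 * 16 ^ k * C * θ' ^ k * κ))
    (fun κ => ∑ m : Fin k, ((b - s * κ) * (1 - κ) * θ' * ((1 / M - 2 * κ) ^ (k + 1) * J m -
          B ^ 2 * (6 * k ^ 2 * κ * (1 + κ) ^ (k + 1))) -
        s * (B ^ 2 * 16 ^ k * C * θ' ^ k * κ))) (by fun_prop) (by fun_prop) (by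
      simp only [mul_zero, Real.exp_zero, add_zero, one_mul, sub_zero, mul_one, zero_mul]
      rw [← mul_sum, ← mul_sum]
      have h1 := mul_lt_mul_of_pos_left h (by positivity : 0 < (1 / (M : ℝ)) ^ (k + 1))
      have h2 : (1 / (M : ℝ)) ^ (k + 1) * (τ * M * I) = τ * ((1 / M) ^ k * I) := by
        rw [pow_succ]
        field_simp
      rw [h2] at h1
      refine h1.trans_le (le_of_eq ?_)
      ring)
  have e0 : ∀ᶠ κ in nhdsWithin (0 : ℝ) (Set.Ioi 0), 0 < κ := self_mem_nhdsWithin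
  obtain ⟨κ, h0, h1, h2, h3, h4, h5⟩ :=
    (e0.and (e1.and (e2.and (e3.and (e4.and e5))))).exists
  exact ⟨κ, h0, h1.le, h2.le, h3.le, h4.le, h5⟩

theorem tendsto_div_log_atTop : Tendsto (fun x : ℝ => x / Real.log x) atTop atTop := by
  have h1 : Tendsto (fun x : ℝ => Real.log x / x) atTop (nhdsWithin 0 (Set.Ioi 0)) := by
    refine tendsto_nhdsWithin_iff.2 ⟨?_, ?_⟩
    · simpa using Real.tendsto_pow_log_div_mul_add_atTop 1 0 1 one_ne_zero
    · filter_upwards [eventually_gt_atTop 1] with x hx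
      exact div_pos (Real.log_pos hx) (by linarith)
  refine h1.inv_tendsto_nhdsGT_zero.congr fun x => ?_
  simp [inv_div]

theorem tendsto_log_log_atTop : Tendsto (fun N : ℝ => Real.log (Real.log N)) atTop atTop :=
  Real.tendsto_log_atTop.comp Real.tendsto_log_atTop

theorem tendsto_DZero : Tendsto DZero atTop atTop :=
  tendsto_div_log_atTop.comp tendsto_log_log_atTop

/-- With `x = log log N`, the left side has logarithm `log 4 * x / log x = o(x)`, the right side `ε
* x + log κ`. -/
theorem eventually_four_rpow_DZero_le {κ ε : ℝ} (hκ : 0 < κ) (hε : 0 < ε) :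
    ∀ᶠ N : ℝ in atTop, (4 : ℝ) ^ DZero N ≤ κ * Real.log N ^ ε := by
  have h1 : ∀ᶠ x : ℝ in atTop, Real.log 4 * (x / Real.log x) ≤ Real.log κ + ε * x := by
    filter_upwards [eventually_gt_atTop 1, Real.tendsto_log_atTop.eventually_ge_atTop
      (Real.log 4 * (2 / ε)), eventually_ge_atTop (-Real.log κ * (2 / ε))] with x hx h2 h3
    have hl := Real.log_pos hx
    have h4 : Real.log 4 * (x / Real.log x) ≤ ε / 2 * x := by
      rw [mul_div_assoc', div_le_iff₀ hl]
      have h5 := mul_le_mul_of_nonneg_left h2 (by positivity : 0 ≤ ε / 2 * x)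
      have h6 : ε / 2 * x * (Real.log 4 * (2 / ε)) = Real.log 4 * x := by field_simp
      linarith
    have h7 := mul_le_mul_of_nonneg_left h3 (by positivity : 0 ≤ ε / 2)
    have h8 : ε / 2 * (-Real.log κ * (2 / ε)) = -Real.log κ := by field_simp
    linarith
  filter_upwards [tendsto_log_log_atTop.eventually h1,
    Real.tendsto_log_atTop.eventually_gt_atTop 0] with N h2 h3
  rw [Real.rpow_def_of_pos (by norm_num : (0 : ℝ) < 4), Real.rpow_def_of_pos h3]
  calc Real.exp (Real.log 4 * DZero N)
      ≤ Real.exp (Real.log κ + ε * Real.log (Real.log N)) := Real.exp_le_exp.2 h2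
    _ = κ * Real.exp (Real.log (Real.log N) * ε) := by
      rw [Real.exp_add, Real.exp_log hκ, mul_comm ε]

theorem eventually_four_rpow_DZero_le_rpow {η : ℝ} (hη : 0 < η) :
    ∀ᶠ N : ℝ in atTop, (4 : ℝ) ^ DZero N ≤ N ^ η := by
  filter_upwards [eventually_four_rpow_DZero_le one_pos one_pos,
    (isLittleO_log_rpow_atTop hη).bound one_pos, eventually_ge_atTop 1] with N h1 h2 h3
  rw [one_mul, Real.rpow_one] at h1
  rw [one_mul, Real.norm_of_nonneg (Real.log_nonneg h3),
    Real.norm_of_nonneg (Real.rpow_nonneg (by linarith) _)] at h2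
  exact h1.trans h2

theorem density_mul {q₀ q₁ W : ℕ} (h0 : 0 < q₀) (h1 : 0 < q₁) (hW : 0 < W)
    (h01 : q₁.Coprime q₀) (hW0 : W.Coprime q₀) (hW1 : W.Coprime q₁) :
    density (q₀ * q₁ * W).primeFactors =
      (q₀.totient / q₀ : ℝ) * (q₁.totient / q₁) * (W.totient / W) := by
  rw [density_primeFactors (by positivity),
    Nat.totient_mul (Nat.Coprime.mul_right hW0 hW1).symm, Nat.totient_mul h01.symm]
  push_cast
  field_simp

/-- The choice of the parameters of the sieve. -/
theorem Setting.exists_frame {k : ℕ} {N θ θ' ε κ δ L₀ : ℝ} {A : Finset ℕ} {Y : ℝ}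
    {q₀ q₁ a₀ : ℕ} {h : Fin k → ℕ} (S : Setting N δ A Y q₀ q₁ a₀ h) (hk : 0 < k)
    (hκ0 : 0 < κ) (hκ1 : κ ≤ 1) (hκe : Real.exp κ ≤ 2) (hθ' : 0 < θ') (hδ : δ ≤ κ)
    (hN : 1 < N) (hL₀ : L₀ ≤ Real.log N)
    (hsieve : ∀ L : ℝ, L₀ ≤ L → ∀ T : Finset ℕ, (∀ p ∈ T, p.Prime) →
      ∑ p ∈ T, Real.log p ≤ 3 * L → ∀ x : ℝ, 1 ≤ x →
      |siftedSum T x - density T * Real.log x| ≤ κ * θ' * density T * L)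
    (hD : (k : ℝ) + 3 ≤ DZero N) (hDκ : 1 / κ + 1 ≤ DZero N)
    (h4κ : (4 : ℝ) ^ DZero N ≤ κ * Real.log N ^ ε) (h4N : (4 : ℝ) ^ DZero N ≤ N ^ (1 : ℝ))
    (h4θ : (4 : ℝ) ^ DZero N ≤ N ^ (θ - 2 * θ')) :
    ∃ (W ν : ℕ) (T : Finset ℕ), Frame N θ q₀ q₁ a₀ W ν T (N ^ θ') h ∧
      Scale k N θ' ε κ q₀ W T (N ^ θ') := by
  have hk0 : (0 : ℝ) ≤ k := Nat.cast_nonneg k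
  have hD0 : 0 ≤ DZero N := by linarith
  have hN0 : 0 < N := by linarith
  have hlog : 0 < Real.log N := Real.log_pos hN
  obtain ⟨ν, hν⟩ := exists_admissible_class S.h_admissible (DZero N) (q₀ * q₁)
  set W := smallProd (DZero N) (q₀ * q₁) with hWdef
  have hW : 0 < W := smallProd_pos _ _
  have hW4 : (W : ℝ) ≤ 4 ^ DZero N := smallProd_le _ hD0 _
  have hq0 := S.q₀_pos
  have hq1 := S.q₁_pos
  have hW0 : W.Coprime q₀ := smallProd_coprime _ (dvd_mul_right _ _)
  have hW1 : W.Coprime q₁ := smallProd_coprime _ (dvd_mul_left _ _)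
  have h01 : q₁.Coprime q₀ := Nat.Coprime.coprime_mul_right_right S.q₁_coprime
  have hprod : 0 < q₀ * q₁ * W := by positivity
  have hT : ∀ p ∈ (q₀ * q₁ * W).primeFactors, p.Prime := fun p hp => Nat.prime_of_mem_primeFactors hp
  have hfree : ∀ p : freePrimes (q₀ * q₁ * W).primeFactors (N ^ θ'), ¬ p.1 ∣ q₀ * q₁ * W :=
    fun p hp => notMem_of_freePrimes p
      (Nat.mem_primeFactors.2 ⟨prime_of_freePrimes p, hp, hprod.ne'⟩)
  have hfloor : ∀ p : freePrimes (q₀ * q₁ * W).primeFactors (N ^ θ'), ⌊DZero N⌋₊ < p.1 := by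
    intro p
    by_contra! hle
    refine hfree p (Dvd.dvd.mul_left ((prime_dvd_smallProd_iff (prime_of_freePrimes p)).2
      ⟨hle, fun hd => hfree p (hd.mul_right _)⟩) _)
  have hgt : ∀ p : freePrimes (q₀ * q₁ * W).primeFactors (N ^ θ'), DZero N < p.1 :=
    fun p => Nat.lt_of_floor_lt (hfloor p)
  have hdens := density_mul hq0 hq1 hW h01 hW0 hW1
  have hq0' : (0 : ℝ) < q₀ := Nat.cast_pos.2 hq0
  have hq1' : (0 : ℝ) < q₁ := Nat.cast_pos.2 hq1
  have hW' : (0 : ℝ) < W := Nat.cast_pos.2 hW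
  have htot : ∀ n : ℕ, 0 < n → (n.totient / n : ℝ) ≤ 1 := fun n hn =>
    (div_le_one (Nat.cast_pos.2 hn)).2 (Nat.cast_le.2 (Nat.totient_le n))
  have htot0 : ∀ n : ℕ, (0 : ℝ) ≤ (n.totient / n : ℝ) := fun n => by positivity
  -- Primes up to `DZero N` divide `q₀`, `q₁` or `W`, so every free prime exceeds `DZero N`.
  refine ⟨W, ν, (q₀ * q₁ * W).primeFactors, ?_, ?_⟩
  · exact
      { k_pos := hk
        W_squarefree := smallProd_squarefree _ _
        W_q₀ := hW0
        W_q₁ := hW1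
        q₀_pos := hq0
        W_free := fun p hp => hfree p (hp.mul_left _)
        q₀_free := fun p hp => hfree p ((hp.mul_right _).mul_right _)
        q₁_free := fun p hp => hfree p ((hp.mul_left _).mul_right _)
        sep := fun p n i j hi hj => by
          by_contra hij
          refine hfree p (((S.h_diff i j hij p.1 (prime_of_freePrimes p) (hgt p) ?_).mul_right
            _).mul_right _)
          have h1 := dvd_sub (Int.natCast_dvd_natCast.2 hi) (Int.natCast_dvd_natCast.2 hj)
          push_cast at h1
          simpa using h1
        ν_spec := hν
        h_dvd := S.h_dvd
        level := by
          have h1 : (N ^ θ') ^ 2 = N ^ (2 * θ') := by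
            rw [← Real.rpow_natCast, ← Real.rpow_mul hN0.le]
            congr 1
            push_cast
            ring
          rw [h1]
          calc (W : ℝ) * N ^ (2 * θ') ≤ N ^ (θ - 2 * θ') * N ^ (2 * θ') :=
                mul_le_mul_of_nonneg_right (hW4.trans h4θ) (Real.rpow_nonneg hN0.le _)
            _ = N ^ θ := by
                rw [← Real.rpow_add hN0]
                congr 1
                ring
        R_pos := Real.rpow_pos_of_pos hN0 _ }
  · exact
      { κ_pos := hκ0
        κ_le_one := hκ1
        exp_le := hκe
        log_pos := hlog
        θ'_pos := hθ'
        log_R := Real.log_rpow hN0 _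
        one_lt_R := Real.one_lt_rpow hN hθ'
        W_le := hW4.trans h4κ
        tail_le := by
          have h1 : 0 < ⌊DZero N⌋₊ := Nat.floor_pos.2 (by linarith)
          refine (tailSum_le h1 hfloor).trans ?_
          have h2 := Nat.lt_floor_add_one (DZero N)
          have h3 : 1 / κ ≤ (⌊DZero N⌋₊ : ℝ) := by linarith
          rw [one_div_le (Nat.cast_pos.2 h1) hκ0]
          exact h3
        large := fun p => hD.trans (hgt p).le
        T_prime := hT
        sieve := fun x hx => by
          -- The `3` counts the factors `q₀`, `q₁`, `W`, each at most `N`.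
          have h1 : ∑ p ∈ (q₀ * q₁ * W).primeFactors, Real.log p ≤ 3 * Real.log N := by
            refine (sum_log_primeFactors_le hprod).trans ?_
            push_cast
            rw [Real.log_mul (by positivity) hW'.ne', Real.log_mul hq0'.ne' hq1'.ne']
            have e1 := Real.log_le_log hq0' S.q₀_le
            have e2 := Real.log_le_log hq1' S.q₁_le
            have e3 := Real.log_le_log hW' (hW4.trans (h4N.trans (Real.rpow_one N).le))
            linarith
          refine (hsieve _ hL₀ _ hT h1 x hx).trans (le_of_eq ?_)
          rw [Real.log_rpow hN0]
          ring
        density_le := by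
          rw [hdens, mul_assoc]
          exact mul_le_of_le_one_right (htot0 _)
            (mul_le_one₀ (htot _ hq1) (htot0 _) (htot _ hW))
        le_totient := by
          have hφ0 : (0 : ℝ) < q₀.totient := Nat.cast_pos.2 (Nat.totient_pos.2 hq0)
          have hφW : (0 : ℝ) < W.totient := Nat.cast_pos.2 (Nat.totient_pos.2 hW)
          have hφ1 : (0 : ℝ) < q₁.totient := Nat.cast_pos.2 (Nat.totient_pos.2 hq1)
          have h1 : 1 - κ ≤ (q₁.totient / q₁ : ℝ) := by
            have := (abs_le.1 S.totient_q₁).1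
            linarith
          rw [hdens, Nat.totient_mul hW0.symm]
          -- The density is short of `φ(q₀ W) / (q₀ W)` only by the factor `φ(q₁) / q₁`, which is at
          -- least `1 - κ`.
          have h2 : (q₀ : ℝ) * W * ((q₀.totient / q₀ : ℝ) * (q₁.totient / q₁) *
              (W.totient / W)) = (q₀.totient * W.totient) * (q₁.totient / q₁ : ℝ) := by
            field_simp
          rw [h2, Nat.cast_mul, div_le_div_iff₀ (by positivity) (by positivity), one_mul, mul_comm]
          exact mul_le_mul_of_nonneg_left h1 (by positivity) }

end

end PrimeGaps

/-! ### Assembly -/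

open PrimeGaps Finset Filter
theorem theorem1
    (t : ℕ) (ht : 1 ≤ t) (θ : ℝ) (hθ : 0 < θ) (ε : ℝ) (hε : 0 < ε)
    (b : ℝ) (hb : 0 < b) (k : ℕ) (hk : PrimeGaps.kZero t b θ ≤ (k : ℕ∞))
    (s a : ℕ) (ha : 0 < a) (has : a ≤ s)
    (β : Fin s → Fin k → ℝ) (hβ : ∀ g m, 0 < β g m)
    (hβb : ∀ m, b ≤ (∑ g with g.val < a, β g m) - (∑ g with ¬ g.val < a, β g m))
    (C : ℝ) (δ : ℝ → ℝ) (hδ : Filter.Tendsto δ Filter.atTop (nhds 0)) :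
    ∃ N₀ : ℝ, ∀ N : ℝ, N₀ ≤ N →
      ∀ (A : Finset ℕ) (Y : ℝ) (q₀ q₁ a₀ : ℕ) (h : Fin k → ℕ),
        PrimeGaps.Setting N (δ N) A Y q₀ q₁ a₀ h →
        PrimeGaps.RegularityI k θ ε C N A Y q₀ q₁ a₀ →
        PrimeGaps.RegularityII a β θ ε C N (δ N) A Y q₀ q₁ a₀ h →
        ∃ S : Finset ℕ, S.card = t ∧ (∀ p ∈ S, p.Prime ∧ p ∈ A) ∧
          PrimeGaps.diameter S ≤ PrimeGaps.diameter (Finset.univ.image h) := by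

  obtain ⟨k', hk', hρ⟩ := exists_lt_bigM_of_kZero_le hk
  obtain ⟨M, Φ, hM, hΦ0, hΦ, hlt⟩ := exists_grid_function hρ
  have hM' : (0 : ℝ) < M := Nat.cast_pos.2 hM
  have ht' : (0 : ℝ) ≤ (t : ℝ) - 1 := by
    have : (1 : ℝ) ≤ t := by exact_mod_cast ht
    linarith
  set I := ∑ j ∈ grid (Fin k') M, Φ j ^ 2 with hI
  set J : Fin k' → ℝ := fun m =>
    ∑ j ∈ grid (Fin k') M, ∑ l ∈ range M, Φ j * Φ (Function.update j m l) with hJ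
  have hI0 : 0 ≤ I := sum_nonneg fun j _ => sq_nonneg _
  have hleft : 0 ≤ (2 * (t : ℝ) - 2) / (b * θ) * M * I :=
    mul_nonneg (mul_nonneg (div_nonneg (by linarith) (by positivity)) hM'.le) hI0
  have hJ0 : 0 < ∑ m, J m := hleft.trans_lt hlt
  have hk'0 : 0 < k' := by
    rcases Nat.eq_zero_or_pos k' with h0 | h0
    · subst h0
      simp at hJ0
    · exact h0
  -- At `θ / 2` the grid inequality is strict, so it survives for a slightly smaller `θ'`. The gap
  -- leaves room for `W * R ^ 2 ≤ N ^ θ`, and puts all free primes below `N ^ (θ / 2)`, where the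
  -- `ϱ_g` are sifted.
  obtain ⟨θ', hθ'1, hθ'2⟩ : ∃ θ', ((t : ℝ) - 1) * M * I / (b * ∑ m, J m) < θ' ∧ θ' < θ / 2 := by
    refine exists_between ?_
    rw [div_lt_iff₀ (by positivity)]
    have h1 : (2 * (t : ℝ) - 2) / (b * θ) * M * I = ((t : ℝ) - 1) * M * I / (θ / 2 * b) := by
      field_simp
    have h2 : ((t : ℝ) - 1) * M * I / (θ / 2 * b) < ∑ m, J m := h1 ▸ hlt
    rw [div_lt_iff₀ (by positivity)] at h2
    linarith
  have hθ'0 : 0 < θ' :=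
    lt_of_le_of_lt (div_nonneg (mul_nonneg (mul_nonneg ht' hM'.le) hI0) (by positivity)) hθ'1
  rw [div_lt_iff₀ (by positivity)] at hθ'1
  have hΦB : ∀ j, |Φ j| ≤ ∑ j ∈ grid (Fin k') M, Φ j := fun j => by
    rw [abs_of_nonneg (hΦ0 j)]
    by_cases hj : Φ j = 0
    · rw [hj]
      exact sum_nonneg fun j _ => hΦ0 j
    · refine single_le_sum (fun j _ => hΦ0 j) (mem_grid.2 fun i => ?_)
      have h1 := single_le_sum (f := fun i => j i + 1) (fun _ _ => Nat.zero_le _) (mem_univ i)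
      have h2 := hΦ j hj
      omega
  obtain ⟨κ, hκ0, hκ1, hκe, hκM, hκb, hκ⟩ := exists_perturbation (s := s) (C := |C|)
    (B := ∑ j ∈ grid (Fin k') M, Φ j) hM J hb
    (by linarith : ((t : ℝ) - 1) * M * I < b * θ' * ∑ m, J m)
  obtain ⟨L₀, hL₀⟩ := siftedSum_asymptotic (mul_pos hκ0 hθ'0)
  have hev : ∀ᶠ N : ℝ in atTop, δ N ≤ κ ∧ 1 < N ∧ max L₀ 1 ≤ Real.log N ∧
      max ((k' : ℝ) + 3) (1 / κ + 1) ≤ DZero N ∧ (4 : ℝ) ^ DZero N ≤ κ * Real.log N ^ ε ∧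
      (4 : ℝ) ^ DZero N ≤ N ^ (1 : ℝ) ∧ (4 : ℝ) ^ DZero N ≤ N ^ (θ - 2 * θ') :=
    (hδ.eventually (eventually_le_nhds hκ0)).and <| (eventually_gt_atTop 1).and <|
      (Real.tendsto_log_atTop.eventually_ge_atTop _).and <|
      (tendsto_DZero.eventually_ge_atTop _).and <|
      (eventually_four_rpow_DZero_le hκ0 hε).and <|
      (eventually_four_rpow_DZero_le_rpow one_pos).and <|
      eventually_four_rpow_DZero_le_rpow (by linarith)
  obtain ⟨N₀, hN₀⟩ := eventually_atTop.1 hev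
  refine ⟨N₀, fun N hN A Y q₀ q₁ a₀ h S hRI hRII => ?_⟩
  obtain ⟨hδκ, hN1, hL, hD, h4κ, h4N, h4θ⟩ := hN₀ N hN
  have hL1 : 1 ≤ Real.log N := (le_max_right _ _).trans hL
  have hinj : Function.Injective (Fin.castLE hk') := Fin.castLE_injective hk'
  have S' := S.comp hinj
  -- The sieve acts on the first `k'` members of the tuple; its diameter is at most that of the
  -- whole.
  obtain ⟨W, ν, T, F, Sc⟩ := S'.exists_frame hk'0 hκ0 hκ1 hκe hθ'0 hδκ hN1
    ((le_max_left _ _).trans hL) hL₀ ((le_max_left _ _).trans hD) ((le_max_right _ _).trans hD)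
    h4κ h4N h4θ
  obtain ⟨ϱ, Y', _, hmin, _, hY', hII, hsupp⟩ := hRII
  have hφ : (0 : ℝ) < q₀.totient := Nat.cast_pos.2 (Nat.totient_pos.2 S.q₀_pos)
  obtain ⟨n, hn⟩ := F.exists_many_primes Sc hM hΦ0 hΦ hΦB S.A_residue
    (hRI.mono hk' hL1 S.Y_pos.le S.q₀_pos) (abs_nonneg C) S.Y_pos hκM ht
    (a := a) (β := fun g m => β g (Fin.castLE hk' m)) (Y' := fun g m => Y' g (Fin.castLE hk' m))
    (fun m => hβb _) hκb
    (fun g m => by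
      obtain ⟨e, he, hY'e⟩ := hY' g (Fin.castLE hk' m)
      exact ⟨e, he.trans hδκ, hY'e⟩) ϱ
    (fun m g r hr => (sum_le_sum fun q _ => mul_le_mul_of_nonneg_right
      (moebius_sq_mul_tau_mono (by omega : 3 * k' ≤ 3 * k) q) (abs_nonneg _)).trans
        ((hII _ g r hr).trans (error_mono hk' hL1 S.Y_pos.le hφ)))
    (fun g n hn hp => by
      obtain ⟨p, hp⟩ := hp
      refine hsupp g n (S.A_range n hn).1 (S.A_range n hn).2 fun hc => ?_
      have h1 : p.1 ∣ primeProd (N ^ (θ / 2)) := by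
        refine dvd_prod_of_mem _ (mem_filter.2 ⟨mem_range.2 (Nat.lt_ceil.2 ?_),
          prime_of_freePrimes p⟩)
        exact (lt_of_freePrimes p).trans_le
          (Real.rpow_le_rpow_of_exponent_le hN1.le hθ'2.le)
      exact (prime_of_freePrimes p).one_lt.ne' (Nat.eq_one_of_dvd_coprimes hc hp h1))
    (fun n hn => hmin n (S.A_range n hn).1 (S.A_range n hn).2) hκ
  obtain ⟨U, hU1, hU2, hU3⟩ := exists_prime_set S'.h_injective hn
  refine ⟨U, hU1, hU2, hU3.trans (diameter_mono fun x hx => ?_)⟩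
  obtain ⟨m, _, rfl⟩ := mem_image.1 hx
  exact mem_image_of_mem _ (mem_univ _)
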